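/- Let $p$ be a prime, $F$ a finite extension of $\mathbb{Q}_p$ with residue field of cardinality $q=p^f$, and $D$ a central division algebra of dimension $w^2$ over $F$, with ring of integers $\mathcal{O}_D$, uniformizer $\varpi$ and residue field $k_D$ (so $|k_D|=q^w$). Fix an embedding $k_D\hookrightarrow\overline{\mathbb{F}}_p$ and a multiplicative section $[\cdot]:k_D\to\mathcal{O}_D$ of the reduction map with $[0]=0$. Let $G=GL_2(D)$, $K=GL_2(\mathcal{O}_D)$, let $Z$ be the center of $G$, $Z'$ the group generated by the scalar matrix $\varpi$, $I\subset K$ the subgroup of matrices that are upper triangular modulo $\varpi$, $I(1)\subset I$ the subgroup of matrices with both diagonal entries $\equiv 1$ modulo $\varpi$, and $\beta=\begin{pmatrix}0&1\\ \varpi&0\end{pmatrix}$. Let $\vec r=(r_0,\dots,r_{wf-1})$ with $0\le r_j\le p-1$, put $r=\sum_j p^jr_j$, and let $V=\bigotimes_{j=0}^{wf-1}\mathrm{Sym}^{r_j}\overline{\mathbb{F}}_p^2$ with basis $\bigotimes_j x_j^{r_j-i_j}y_j^{i_j}$, on which $K$ acts through $GL_2(k_D)$ by $$\begin{pmatrix}a&b\\c&d\end{pmatrix}\bigotimes_j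 x_j^{r_j-i_j}y_j^{i_j}=\bigotimes_j(a^{p^j}x_j+c^{p^j}y_j)^{r_j-i_j}(b^{p^j}x_j+d^{p^j}y_j)^{i_j}.$$ Let $\sigma$ be any representation of $KZZ'$ on $V$ extending this action of $K$. Let $\mathrm{ind}_{KZZ'}^G\sigma$ be the space of functions $\phi:G\to V$, supported on finitely many cosets $KZZ'g$, with $\phi(hg)=\sigma(h)\phi(g)$ for $h\in KZZ'$, on which $G$ acts by right translation. For $g\in G$ and $v\in V$ let $[g,v]$ be the element supported on $KZZ'g^{-1}$ with $[g,v](g')=\sigma(g'g)v$ there. For $n\ge 0$ let $I_n=\{\sum_{i=0}^{n-1}\varpi^i[\mu_i]:\mu_i\in k_D\}$ (so $I_0=\{0\}$) and $$s_n^0=\sum_{\mu\in I_n}\Big[\begin{pmatrix}\varpi^n&\mu\\0&1\end{pmatrix},\ \bigotimes_j x_j^{r_j}\Big].$$ Then the family consisting of $s_n^0$ and $\beta s_n^0$ for all $n\ge 0$ is a basis of the $\overline{\mathbb{F}}_p$-vector space of $I(1)$-invariants of $\mathrm{ind}_{KZZ'}^G\sigma$. Moreover: 1. If $0<r\le q^w-1$,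 then for every $n\ge 0$ the $KZZ'$-module generated by $s_n^0$ is isomorphic to $\sigma$ and irreducible, and the $KZZ'$-module generated by $\beta s_n^0$ is a reducible (that is, not irreducible) principal series of dimension $q^w+1$, i.e. it is isomorphic to $\mathrm{Ind}_{IZZ'}^{KZZ'}\chi$ for a character $\chi$ of $IZZ'$ that is trivial on $I(1)$. 2. If $r=0$, then for every $n\ge 0$ the element $s_n^0+\beta s_{n-1}^0$ (meaning $s_0^0$ when $n=0$) generates an irreducible one-dimensional $KZZ'$-module isomorphic to $\sigma$. 3. If $r=q^w-1$, then for every $n\ge 1$ the element $s_n^0+\beta s_{n-1}^0$ generates an irreducible one-dimensional $KZZ'$-module. -/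

import Mathlib

noncomputable section

namespace GL2D

open Matrix MvPolynomial

/-! ### The ring of integers of a division algebra over a `p`-adic field -/

section Integers

variable (p : ℕ) [Fact p.Prime]

/-- The multiplicative function `x ↦ |N_{D/ℚ_p}(x)|_p` on a finite-dimensional division algebra
`D` over `ℚ_p`. It is a positive power of the unique norm of `D` extending `|·|_p`. -/
def absNorm (D : Type*) [DivisionRing D] [Algebra ℚ_[p] D] : D →* ℝ where
  toFun x := ‖Algebra.norm ℚ_[p] x‖
  map_one' := by simp
  map_mul' x y := by simp

theorem norm_eq_spectralNorm_pow (E : Type*) [Field E] [Algebra ℚ_[p] E]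
    [FiniteDimensional ℚ_[p] E] (a : E) :
    ‖Algebra.norm ℚ_[p] a‖ = spectralNorm ℚ_[p] E a ^ Module.finrank ℚ_[p] E := by
  have hint : IsIntegral ℚ_[p] a := Algebra.IsIntegral.isIntegral a
  have hd : (minpoly ℚ_[p] a).natDegree ≠ 0 := (minpoly.natDegree_pos hint).ne'
  have hs : spectralNorm ℚ_[p] E a ^ (minpoly ℚ_[p] a).natDegree
      = ‖(minpoly ℚ_[p] a).coeff 0‖ := by
    rw [spectralNorm.spectralNorm_eq_norm_coeff_zero_rpow, one_div, Real.rpow_inv_natCast_pow (norm_nonneg _) hd]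
  have hf : Module.finrank ℚ_[p] E = (minpoly ℚ_[p] a).natDegree *
      Module.finrank (IntermediateField.adjoin ℚ_[p] {a}) E := by
    rw [← IntermediateField.adjoin.finrank hint, Module.finrank_mul_finrank]
  rw [Algebra.norm_eq_norm_adjoin, norm_pow, hf, pow_mul, hs]
  have h2 := Algebra.PowerBasis.norm_gen_eq_coeff_zero_minpoly
    (IntermediateField.adjoin.powerBasis hint)
  rw [IntermediateField.adjoin.powerBasis_gen, IntermediateField.minpoly_gen] at h2
  rw [h2, norm_mul, norm_pow, norm_neg, norm_one, one_pow, one_mul]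

theorem norm_algHom (E : Type*) [Field E] [Algebra ℚ_[p] E] [FiniteDimensional ℚ_[p] E]
    (D : Type*) [DivisionRing D] [Algebra ℚ_[p] D] [FiniteDimensional ℚ_[p] D]
    (φ : E →ₐ[ℚ_[p]] D) : ∃ k : ℕ, k ≠ 0 ∧ ∀ a : E,
      Algebra.norm ℚ_[p] (φ a) = Algebra.norm ℚ_[p] a ^ k := by
  let _ : Module E D := Module.compHom D φ.toRingHom
  have hsm : ∀ (a : E) (d : D), a • d = φ a * d := fun _ _ => rfl
  have : IsScalarTower ℚ_[p] E D := ⟨fun c a d => by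
    rw [hsm, hsm, map_smul, smul_mul_assoc]⟩
  have : FiniteDimensional E D := FiniteDimensional.right ℚ_[p] E D
  refine ⟨Module.finrank E D, Module.finrank_pos.ne', fun a => ?_⟩
  have h := LinearMap.det_restrictScalars (R := ℚ_[p]) (S := E) (A := D)
    (f := a • (LinearMap.id : D →ₗ[E] D))
  rw [LinearMap.det_smul, LinearMap.det_id, mul_one, map_pow] at h
  rw [← h, Algebra.norm_apply]
  congr 1

theorem absNorm_one_add (D : Type*) [DivisionRing D] [Algebra ℚ_[p] D]
    [FiniteDimensional ℚ_[p] D] (z : D) (hz : ‖Algebra.norm ℚ_[p] z‖ ≤ 1) :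
    ‖Algebra.norm ℚ_[p] (1 + z)‖ ≤ 1 := by
  have hint : IsIntegral ℚ_[p] z := Algebra.IsIntegral.isIntegral z
  have : Fact (Irreducible (minpoly ℚ_[p] z)) := ⟨minpoly.irreducible hint⟩
  have : FiniteDimensional ℚ_[p] (AdjoinRoot (minpoly ℚ_[p] z)) :=
    (AdjoinRoot.powerBasis (minpoly.ne_zero hint)).finite
  let φ : AdjoinRoot (minpoly ℚ_[p] z) →ₐ[ℚ_[p]] D :=
    Ideal.Quotient.liftₐ (Ideal.span {minpoly ℚ_[p] z}) (Polynomial.aeval z) (fun a ha => by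
      obtain ⟨b, rfl⟩ := Ideal.mem_span_singleton.1 ha
      simp)
  have hφ : φ (AdjoinRoot.root (minpoly ℚ_[p] z)) = z := by
    change Polynomial.aeval z Polynomial.X = z
    simp
  obtain ⟨k, hk, h⟩ := norm_algHom p _ D φ
  set α := AdjoinRoot.root (minpoly ℚ_[p] z)
  have hn : Module.finrank ℚ_[p] (AdjoinRoot (minpoly ℚ_[p] z)) ≠ 0 := Module.finrank_pos.ne'
  have h1 : spectralNorm ℚ_[p] _ α ≤ 1 := by
    rw [← hφ, h, norm_pow, norm_eq_spectralNorm_pow, pow_le_one_iff_of_nonneg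
      (pow_nonneg (spectralNorm_nonneg _) _) hk,
      pow_le_one_iff_of_nonneg (spectralNorm_nonneg _) hn] at hz
    exact hz
  have h2 : spectralNorm ℚ_[p] _ (1 + α) ≤ 1 :=
    (isNonarchimedean_spectralNorm 1 α).trans (max_le (by rw [spectralNorm_one]) h1)
  have h3 : 1 + z = φ (1 + α) := by rw [map_add, map_one, hφ]
  rw [h3, h, norm_pow, norm_eq_spectralNorm_pow]
  exact pow_le_one₀ (pow_nonneg (spectralNorm_nonneg _) _) (pow_le_one₀ (spectralNorm_nonneg _) h2)

theorem absNorm_add_le (D : Type*) [DivisionRing D] [Algebra ℚ_[p] D]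
    [FiniteDimensional ℚ_[p] D] (x y : D) :
    absNorm p D (x + y) ≤ max (absNorm p D x) (absNorm p D y) := by
  have key : ∀ x y : D, absNorm p D x ≤ absNorm p D y → absNorm p D (x + y) ≤ absNorm p D y := by
    intro x y h
    by_cases hy : y = 0
    · subst hy
      have h0 : absNorm p D 0 = 0 := by simp [absNorm]
      have hx : ‖Algebra.norm ℚ_[p] x‖ = 0 := le_antisymm (h.trans_eq h0) (norm_nonneg _)
      rw [norm_eq_zero] at hx
      have : x = 0 := by
        by_contra hne
        have h1 : Algebra.norm ℚ_[p] x * Algebra.norm ℚ_[p] x⁻¹ = 1 := by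
          rw [← map_mul, mul_inv_cancel₀ hne, map_one]
        simp [hx] at h1
      simp [this]
    · have hpos : 0 < absNorm p D y := by
        refine lt_of_le_of_ne (norm_nonneg (Algebra.norm ℚ_[p] y)) fun h0 => ?_
        have h1 : absNorm p D y * absNorm p D y⁻¹ = 1 := by
          rw [← map_mul, mul_inv_cancel₀ hy, map_one]
        rw [← h0, zero_mul] at h1
        exact zero_ne_one h1
      have e : x + y = (1 + x * y⁻¹) * y := by
        rw [add_mul, mul_assoc, inv_mul_cancel₀ hy]
        simp [add_comm]
      have hz : absNorm p D (x * y⁻¹) ≤ 1 := by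
        have h2 : absNorm p D (x * y⁻¹) * absNorm p D y = absNorm p D x := by
          rw [← map_mul, mul_assoc, inv_mul_cancel₀ hy, mul_one]
        by_contra hlt
        nlinarith
      rw [e, map_mul]
      exact mul_le_of_le_one_left hpos.le (absNorm_one_add p D _ hz)
  rcases le_total (absNorm p D x) (absNorm p D y) with h | h
  · exact (key x y h).trans (le_max_right _ _)
  · rw [add_comm]
    exact (key y x h).trans (le_max_left _ _)

variable (D : Type*) [DivisionRing D] [Algebra ℚ_[p] D] [FiniteDimensional ℚ_[p] D]

theorem absNorm_zero : absNorm p D 0 = 0 := by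
  simp [absNorm]

theorem absNorm_nonneg (x : D) : 0 ≤ absNorm p D x :=
  norm_nonneg (Algebra.norm ℚ_[p] x)

theorem absNorm_neg (x : D) : absNorm p D (-x) = absNorm p D x := by
  have h1 : absNorm p D (-1) = 1 := by
    have h : absNorm p D (-1) * absNorm p D (-1) = 1 := by rw [← map_mul]; simp
    nlinarith [absNorm_nonneg p D (-1)]
  rw [← neg_one_mul, map_mul, h1, one_mul]

/-- The ring of integers `𝒪_D`, the closed unit ball of the norm of `D`. -/
def integers : Subring D where
  carrier := {x | absNorm p D x ≤ 1}
  mul_mem' {x y} hx hy := by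
    simp only [Set.mem_ofPred_eq, map_mul] at *
    exact mul_le_one₀ hx (absNorm_nonneg p D y) hy
  one_mem' := by simp
  add_mem' {x y} hx hy := (absNorm_add_le p D x y).trans (max_le hx hy)
  zero_mem' := by simp [absNorm_zero]
  neg_mem' {x} hx := by simpa [absNorm_neg] using hx

/-- The maximal ideal of `𝒪_D`, the open unit ball of the norm of `D`. -/
def maxIdeal : Ideal (integers p D) where
  carrier := {x | absNorm p D (x : D) < 1}
  add_mem' {x y} hx hy := (absNorm_add_le p D x y).trans_lt (max_lt hx hy)
  zero_mem' := by simp [absNorm_zero]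
  smul_mem' c x hx := by
    simp only [Set.mem_ofPred_eq, smul_eq_mul, Subring.coe_mul, map_mul] at *
    exact mul_lt_one_of_nonneg_of_lt_one_right c.2 (absNorm_nonneg p D _) hx

instance : (maxIdeal p D).IsTwoSided where
  mul_mem_of_left {a} b ha := by
    change absNorm p D ((a * b : integers p D) : D) < 1
    rw [Subring.coe_mul, map_mul]
    exact mul_lt_one_of_nonneg_of_lt_one_left (absNorm_nonneg p D _) ha b.2

/-- The residue ring `k_D`, the quotient of `𝒪_D` by its maximal ideal. -/
abbrev residueRing : Type _ := integers p D ⧸ maxIdeal p D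

/-- The reduction map `𝒪_D → k_D`. -/
abbrev red : integers p D →+* residueRing p D := Ideal.Quotient.mk (maxIdeal p D)

variable {D}

/-- `ϖ` is a uniformizer of `D`: it generates the maximal ideal of `𝒪_D`. -/
def IsUniformizer (ϖ : Dˣ) : Prop :=
  ∀ x : D, absNorm p D x < 1 ↔ ∃ y ∈ integers p D, x = (ϖ : D) * y

end Integers

/-! ### Subgroups and elements of `GL₂(D)` -/

section Groups

variable (p : ℕ) [Fact p.Prime]
variable (D : Type*) [DivisionRing D] [Algebra ℚ_[p] D] [FiniteDimensional ℚ_[p] D]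

/-- The inclusion `GL₂(𝒪_D) → GL₂(D)`. -/
def incl : GL (Fin 2) (integers p D) →* GL (Fin 2) D :=
  Units.map ((integers p D).subtype.mapMatrix (m := Fin 2)).toMonoidHom

/-- `K = GL₂(𝒪_D)` as a subgroup of `GL₂(D)`. -/
def maxCompact : Subgroup (GL (Fin 2) D) := (incl p D).range

variable {p D} in
theorem lower_mem {g : GL (Fin 2) (integers p D)} (hg : g.1 1 0 ∈ maxIdeal p D) :
    (g⁻¹).1 1 0 ∈ maxIdeal p D := by
  have e := g.mul_inv
  have e0 := congrFun (congrFun e 1) 0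
  have e1 := congrFun (congrFun e 1) 1
  simp only [Matrix.mul_apply, Fin.sum_univ_two, Matrix.one_apply_eq, ne_eq, one_ne_zero,
    not_false_eq_true, Matrix.one_apply_ne] at e0 e1
  set h := g⁻¹
  have hu : ¬ g.1 1 1 ∈ maxIdeal p D := fun hm => by
    have : (1 : integers p D) ∈ maxIdeal p D := e1 ▸
      add_mem (Ideal.mul_mem_right _ _ hg) (Ideal.mul_mem_right _ _ hm)
    have h1 : absNorm p D ((1 : integers p D) : D) < 1 := this
    simp at h1
  have hv : g.1 1 1 * h.1 1 0 ∈ maxIdeal p D := by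
    rw [eq_neg_of_add_eq_zero_right e0]
    exact neg_mem (Ideal.mul_mem_right _ _ hg)
  have hu1 : absNorm p D (g.1 1 1 : D) = 1 :=
    le_antisymm (g.1 1 1).2 (not_lt.1 hu)
  have hv1 : absNorm p D ((g.1 1 1 * h.1 1 0 : integers p D) : D) < 1 := hv
  rw [Subring.coe_mul, map_mul, hu1, one_mul] at hv1
  exact hv1

theorem diag_mul_mem {R : Type*} [Ring R] (I : Ideal R) [I.IsTwoSided] {a b c d : R}
    (ha : a - 1 ∈ I) (hb : b - 1 ∈ I) (hcd : c * d ∈ I) : a * b + c * d - 1 ∈ I := by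
  have e : a * b + c * d - 1 = a * (b - 1) + (a - 1) + c * d := by noncomm_ring
  rw [e]
  exact add_mem (add_mem (Ideal.mul_mem_left _ _ hb) ha) hcd

theorem diag_inv_mem {R : Type*} [Ring R] (I : Ideal R) [I.IsTwoSided] {a b c d : R}
    (ha : a - 1 ∈ I) (hcd : c * d ∈ I) (h : a * b + c * d = 1) : b - 1 ∈ I := by
  have e : b - 1 = -((a - 1) * b) - c * d := by
    calc b - 1 = b - (a * b + c * d) := by rw [h]
      _ = _ := by noncomm_ring
  rw [e]
  exact sub_mem (neg_mem (Ideal.mul_mem_right _ _ ha)) hcd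

variable {p D} in
theorem upper_inv_mem {g : GL (Fin 2) (integers p D)} (hg : g.1 1 0 ∈ maxIdeal p D)
    (h0 : g.1 0 0 - 1 ∈ maxIdeal p D) (h1 : g.1 1 1 - 1 ∈ maxIdeal p D) :
    (g⁻¹).1 0 0 - 1 ∈ maxIdeal p D ∧ (g⁻¹).1 1 1 - 1 ∈ maxIdeal p D := by
  have e := g.mul_inv
  have e0 := congrFun (congrFun e 0) 0
  have e1 := congrFun (congrFun e 1) 1
  simp only [Matrix.mul_apply, Fin.sum_univ_two, Matrix.one_apply_eq] at e0 e1
  rw [add_comm] at e1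
  exact ⟨diag_inv_mem _ h0 (Ideal.mul_mem_left _ _ (lower_mem hg)) e0,
    diag_inv_mem _ h1 (Ideal.mul_mem_right _ _ hg) e1⟩

/-- The Iwahori subgroup `I`: invertible matrices over `𝒪_D` that are upper triangular modulo the
maximal ideal. -/
def iwahori : Subgroup (GL (Fin 2) D) :=
  Subgroup.map (incl p D)
    { carrier := {g | g.1 1 0 ∈ maxIdeal p D}
      mul_mem' := fun {g h} hg hh => by
        simp only [Set.mem_ofPred_eq, Units.val_mul, Matrix.mul_apply, Fin.sum_univ_two] at *
        exact add_mem (Ideal.mul_mem_right _ _ hg) (Ideal.mul_mem_left _ _ hh)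
      one_mem' := by simp
      inv_mem' := fun hg => lower_mem hg }

/-- The pro-`p` Iwahori subgroup `I(1)`: invertible matrices over `𝒪_D` that are upper triangular
with `1`s on the diagonal modulo the maximal ideal. -/
def proPIwahori : Subgroup (GL (Fin 2) D) :=
  Subgroup.map (incl p D)
    { carrier := {g | g.1 1 0 ∈ maxIdeal p D ∧ g.1 0 0 - 1 ∈ maxIdeal p D ∧
        g.1 1 1 - 1 ∈ maxIdeal p D}
      mul_mem' := fun {g h} hg hh => by
        simp only [Set.mem_ofPred_eq, Units.val_mul, Matrix.mul_apply, Fin.sum_univ_two] at *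
        refine ⟨add_mem (Ideal.mul_mem_right _ _ hg.1) (Ideal.mul_mem_left _ _ hh.1),
          diag_mul_mem _ hg.2.1 hh.2.1 (Ideal.mul_mem_left _ _ hh.1), ?_⟩
        rw [add_comm (g.1 1 0 * _)]
        exact diag_mul_mem _ hg.2.2 hh.2.2 (Ideal.mul_mem_right _ _ hg.1)
      one_mem' := by simp
      inv_mem' := fun {g} hg => ⟨lower_mem hg.1, upper_inv_mem hg.1 hg.2.1 hg.2.2⟩ }

variable {D}

/-- The scalar matrix with diagonal entries `ϖ`. -/
def scalarUnit (ϖ : Dˣ) : GL (Fin 2) D where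
  val := !![(ϖ : D), 0; 0, (ϖ : D)]
  inv := !![((ϖ⁻¹ : Dˣ) : D), 0; 0, ((ϖ⁻¹ : Dˣ) : D)]
  val_inv := by simp [Matrix.one_fin_two]
  inv_val := by simp [Matrix.one_fin_two]

/-- The subgroup `KZZ'` of `GL₂(D)`, where `Z` is the center and `Z'` is generated by the scalar
matrix `ϖ`. -/
def KZZ (ϖ : Dˣ) : Subgroup (GL (Fin 2) D) :=
  maxCompact p D ⊔ Subgroup.center (GL (Fin 2) D) ⊔ Subgroup.zpowers (scalarUnit ϖ)

/-- The subgroup `IZZ'` of `GL₂(D)`. -/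
def IZZ (ϖ : Dˣ) : Subgroup (GL (Fin 2) D) :=
  iwahori p D ⊔ Subgroup.center (GL (Fin 2) D) ⊔ Subgroup.zpowers (scalarUnit ϖ)

variable {p} in
/-- An element of `GL₂(𝒪_D)` as an element of `KZZ'`. -/
def toKZZ (ϖ : Dˣ) (g : GL (Fin 2) (integers p D)) : KZZ p ϖ :=
  ⟨incl p D g, Subgroup.mem_sup_left (Subgroup.mem_sup_left ⟨g, rfl⟩)⟩

/-- The matrix `β = (0 1; ϖ 0)`. -/
def betaUnit (ϖ : Dˣ) : GL (Fin 2) D where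
  val := !![0, 1; (ϖ : D), 0]
  inv := !![0, ((ϖ⁻¹ : Dˣ) : D); 1, 0]
  val_inv := by simp [Matrix.one_fin_two]
  inv_val := by simp [Matrix.one_fin_two]

/-- The matrix `(a b; 0 1)`. -/
def affineUnit (a : Dˣ) (b : D) : GL (Fin 2) D where
  val := !![(a : D), b; 0, 1]
  inv := !![((a⁻¹ : Dˣ) : D), -(((a⁻¹ : Dˣ) : D) * b); 0, 1]
  val_inv := by simp [Matrix.one_fin_two]
  inv_val := by simp [Matrix.one_fin_two]

end Groups

/-! ### Weights -/

section Weights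

variable (p : ℕ) [Fact p.Prime]

/-- The coefficient field, an algebraic closure of `𝔽_p`. -/
abbrev Coef : Type := AlgebraicClosure (ZMod p)

/-- The space `⊗_j Sym^{r_j}`, modelled by the polynomials in the variables `x_j = X (j, 0)` and
`y_j = X (j, 1)` that are, for every `j`, homogeneous of degree `r_j` in `x_j, y_j`. -/
def Wt {m : ℕ} (r : Fin m → ℕ) : Submodule (Coef p) (MvPolynomial (Fin m × Fin 2) (Coef p)) :=
  weightedHomogeneousSubmodule (Coef p) (fun v : Fin m × Fin 2 => (Pi.single v.1 1 : Fin m → ℕ)) r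

/-- The substitution `x_j ↦ a^{p^j} x_j + c^{p^j} y_j`, `y_j ↦ b^{p^j} x_j + d^{p^j} y_j`
attached to the matrix `(a b; c d)`. -/
def subst (m : ℕ) (A : Matrix (Fin 2) (Fin 2) (Coef p)) :
    MvPolynomial (Fin m × Fin 2) (Coef p) →ₐ[Coef p] MvPolynomial (Fin m × Fin 2) (Coef p) :=
  aeval fun v => C (A 0 v.2 ^ p ^ (v.1 : ℕ)) * X (v.1, 0) + C (A 1 v.2 ^ p ^ (v.1 : ℕ)) * X (v.1, 1)

theorem subst_mem {m : ℕ} (r : Fin m → ℕ) (A : Matrix (Fin 2) (Fin 2) (Coef p))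
    (P : MvPolynomial (Fin m × Fin 2) (Coef p)) (hP : P ∈ Wt p r) : subst p m A P ∈ Wt p r := by
  have hX : ∀ v : Fin m × Fin 2, IsWeightedHomogeneous (R := Coef p)
      (fun v : Fin m × Fin 2 => (Pi.single v.1 1 : Fin m → ℕ)) (subst p m A (X v))
      (Pi.single v.1 1) := by
    intro v
    rw [subst, aeval_X]
    exact ((isWeightedHomogeneous_X _ _ (v.1, (0 : Fin 2))).C_mul _).add
      ((isWeightedHomogeneous_X _ _ (v.1, (1 : Fin 2))).C_mul _)
  rw [P.as_sum, map_sum]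
  refine sum_mem fun d hd => ?_
  have hw := hP (mem_support_iff.1 hd)
  rw [monomial_eq, map_mul, ← algebraMap_eq, AlgHom.commutes, algebraMap_eq, Finsupp.prod,
    map_prod]
  refine IsWeightedHomogeneous.C_mul ?_ _
  have h2 := IsWeightedHomogeneous.prod d.support (fun v => subst p m A (X v ^ d v))
    (fun v => d v • (Pi.single v.1 1 : Fin m → ℕ)) (fun v _ => by
      rw [map_pow]; exact (hX v).pow _)
  rw [← hw, Finsupp.weight_apply, Finsupp.sum]
  exact h2

theorem subst_one (m : ℕ) : subst p m 1 = AlgHom.id _ _ := by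
  ext1 v
  obtain ⟨j, i⟩ := v
  have hp : p ≠ 0 := (Fact.out : p.Prime).ne_zero
  fin_cases i <;> simp [subst, hp]

theorem subst_mul (m : ℕ) (A B : Matrix (Fin 2) (Fin 2) (Coef p)) :
    subst p m (A * B) = (subst p m A).comp (subst p m B) := by
  ext1 v
  obtain ⟨j, i⟩ := v
  simp only [subst, aeval_X, AlgHom.comp_apply, map_add, map_mul, algHom_C, algebraMap_eq,
    Matrix.mul_apply, Fin.sum_univ_two, add_pow_char_pow, mul_pow]
  ring

/-- The action of `2 × 2` matrices on `⊗_j Sym^{r_j}`, with the `j`-th factor twisted by the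
`j`-th power of the Frobenius. -/
def wtAction {m : ℕ} (r : Fin m → ℕ) :
    Matrix (Fin 2) (Fin 2) (Coef p) →* Module.End (Coef p) (Wt p r) where
  toFun A := (subst p m A).toLinearMap.restrict (subst_mem p r A)
  map_one' := by
    ext1 P; apply Subtype.ext; simp [subst_one]
  map_mul' A B := by
    ext1 P; apply Subtype.ext
    change subst p m (A * B) P = subst p m A (subst p m B P)
    rw [subst_mul]; rfl

/-- The vector `⊗_j x_j^{r_j}`. -/
def highest {m : ℕ} (r : Fin m → ℕ) : Wt p r :=
  ⟨∏ j, X (j, 0) ^ r j, by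
    have h := IsWeightedHomogeneous.prod (R := Coef p)
      (w := fun v : Fin m × Fin 2 => (Pi.single v.1 1 : Fin m → ℕ)) Finset.univ
      (fun j : Fin m => X (j, (0 : Fin 2)) ^ r j) (fun j => r j • (Pi.single j 1 : Fin m → ℕ))
      (fun j _ => (isWeightedHomogeneous_X _ _ (j, (0 : Fin 2))).pow _)
    have e : ∑ j, r j • (Pi.single j 1 : Fin m → ℕ) = r := by
      ext i
      simp [Finset.sum_apply, Pi.single_apply]
    rwa [e] at h⟩

variable {p}
variable {D : Type*} [DivisionRing D] [Algebra ℚ_[p] D] [FiniteDimensional ℚ_[p] D]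

/-- The inflation to `GL₂(𝒪_D)` of the weight of `GL₂(k_D)` attached to `r`, where `k_D` is
embedded in the coefficient field by `ι`. -/
def weight {m : ℕ} (ι : residueRing p D →+* Coef p) (r : Fin m → ℕ) :
    Representation (Coef p) (GL (Fin 2) (integers p D)) (Wt p r) :=
  (wtAction p r).comp (((ι.comp (red p D)).mapMatrix (m := Fin 2)).toMonoidHom.comp
    (Units.coeHom _))

end Weights

/-! ### Compact induction -/

section CompactInduction

variable {k G V : Type*} [Field k] [Group G] [AddCommGroup V] [Module k V] {H : Subgroup G}

/-- The underlying space of the compact induction of `σ` from `H` to `G`: functions `f : G → V`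
with `f (h g) = σ(h) f(g)` whose support is contained in finitely many cosets `H s`. -/
def cIndV (σ : Representation k H V) : Submodule k (G → V) where
  carrier := {f | (∀ (h : H) (g : G), f (h * g) = σ h (f g)) ∧
    ∃ S : Finset G, ∀ g, f g ≠ 0 → ∃ s ∈ S, g * s⁻¹ ∈ H}
  add_mem' := by
    classical
    rintro f₁ f₂ ⟨h₁, S₁, hS₁⟩ ⟨h₂, S₂, hS₂⟩
    refine ⟨fun h g => by simp [h₁, h₂], S₁ ∪ S₂, fun g hg => ?_⟩
    by_cases h : f₁ g = 0
    · obtain ⟨s, hs, hs'⟩ := hS₂ g (fun h' => hg (by simp [h, h']))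
      exact ⟨s, Finset.mem_union_right _ hs, hs'⟩
    · obtain ⟨s, hs, hs'⟩ := hS₁ g h
      exact ⟨s, Finset.mem_union_left _ hs, hs'⟩
  zero_mem' := ⟨by simp, ∅, by simp⟩
  smul_mem' := by
    rintro c f ⟨h₁, S₁, hS₁⟩
    exact ⟨fun h g => by simp [h₁], S₁, fun g hg => hS₁ g (fun h' => hg (by simp [h']))⟩

/-- The action of `G` on the compact induction by right translation. -/
def cInd (σ : Representation k H V) : Representation k G (cIndV σ) where
  toFun x := (LinearMap.funLeft k V (· * x)).restrict (by
    rintro f ⟨h₁, S, hS⟩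
    classical
    refine ⟨fun h g => by simp [LinearMap.funLeft_apply, mul_assoc, h₁],
      S.image (· * x⁻¹), fun g hg => ?_⟩
    obtain ⟨s, hs, hs'⟩ := hS (g * x) hg
    exact ⟨s * x⁻¹, Finset.mem_image_of_mem _ hs, by simpa [mul_assoc] using hs'⟩)
  map_one' := by ext; simp
  map_mul' _ _ := by ext; simp [mul_assoc]

open scoped Classical in
/-- The function `[g, v]`, supported on `H g⁻¹`, with `[g, v](x) = σ(x g) v` there. -/
def bracket (σ : Representation k H V) (g : G) (v : V) : cIndV σ :=
  ⟨fun x => if h : x * g ∈ H then σ ⟨x * g, h⟩ v else 0, by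
    refine ⟨fun h x => ?_, {g⁻¹}, fun x hx => ⟨g⁻¹, by simp, ?_⟩⟩
    · by_cases hx : x * g ∈ H
      · have hx' : (h : G) * x * g ∈ H := by rw [mul_assoc]; exact H.mul_mem h.2 hx
        simp only [dif_pos hx, dif_pos hx']
        rw [← Module.End.mul_apply, ← map_mul]
        congr 2
        exact Subtype.ext (mul_assoc _ _ _)
      · have hx' : ¬ (h : G) * x * g ∈ H := by
          rw [mul_assoc, H.mul_mem_cancel_left h.2]; exact hx
        simp only [dif_neg hx, dif_neg hx', map_zero]
    · by_contra hn
      rw [inv_inv] at hn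
      exact hx (dif_neg hn)⟩

/-- The subrepresentation generated by a vector. -/
def generated (ρ : Representation k G V) (v : V) : Subrepresentation ρ where
  toSubmodule := Submodule.span k (Set.range fun g => ρ g v)
  apply_mem_toSubmodule g x hx := by
    refine Submodule.span_induction (p := fun x _ => ρ g x ∈
      Submodule.span k (Set.range fun g => ρ g v)) ?_ (by simp)
      (fun x y _ _ hx hy => by rw [map_add]; exact add_mem hx hy)
      (fun c x _ hx => by rw [map_smul]; exact Submodule.smul_mem _ c hx) hx
    rintro _ ⟨h, rfl⟩
    refine Submodule.subset_span ⟨g * h, ?_⟩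
    simp

end CompactInduction

/-! ### The vectors `s_n^0` and principal series -/

section Vectors

variable {p : ℕ} [Fact p.Prime]
variable {D : Type*} [DivisionRing D] [Algebra ℚ_[p] D] [FiniteDimensional ℚ_[p] D]

/-- The element `∑_{i<n} ϖ^i [μ_i]` of `𝒪_D ⊆ D`, with `[·]` the multiplicative lift `τ`. The set
`I_n` consists of these elements. -/
def digits (ϖ : Dˣ) (τ : residueRing p D →*₀ integers p D) {n : ℕ}
    (μ : Fin n → residueRing p D) : D :=
  ∑ i : Fin n, (ϖ : D) ^ (i : ℕ) * (τ (μ i) : D)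

/-- `s_n^0 = ∑_{μ ∈ I_n} [g_{n,μ}^0, ⊗_j x_j^{r_j}]` with `g_{n,μ}^0 = (ϖ^n μ; 0 1)`. The sum is
finite because `k_D` is finite. -/
def sVec {m : ℕ} {r : Fin m → ℕ} (ϖ : Dˣ) (τ : residueRing p D →*₀ integers p D)
    (σ : Representation (Coef p) (KZZ p ϖ) (Wt p r)) (n : ℕ) : cIndV σ :=
  ∑ᶠ μ : Fin n → residueRing p D,
    bracket σ (affineUnit (ϖ ^ n) (digits ϖ τ μ)) (highest p r)

/-- The vector `β s_n^0`. -/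
def betaVec {m : ℕ} {r : Fin m → ℕ} (ϖ : Dˣ) (τ : residueRing p D →*₀ integers p D)
    (σ : Representation (Coef p) (KZZ p ϖ) (Wt p r)) (n : ℕ) : cIndV σ :=
  cInd σ (betaUnit ϖ) (sVec ϖ τ σ n)

/-- The restriction to `KZZ'` of the compact induction. -/
abbrev resKZZ {m : ℕ} {r : Fin m → ℕ} {ϖ : Dˣ}
    (σ : Representation (Coef p) (KZZ p ϖ) (Wt p r)) :
    Representation (Coef p) (KZZ p ϖ) (cIndV σ) :=
  (cInd σ).comp (KZZ p ϖ).subtype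

/-- The restriction to `I(1)` of the compact induction. -/
abbrev resProP {m : ℕ} {r : Fin m → ℕ} {ϖ : Dˣ}
    (σ : Representation (Coef p) (KZZ p ϖ) (Wt p r)) :
    Representation (Coef p) (proPIwahori p D) (cIndV σ) :=
  (cInd σ).comp (proPIwahori p D).subtype

/-- A representation of `KZZ'` is a principal series if it is isomorphic to the induction from
`IZZ'` to `KZZ'` of a character (one-dimensional representation) of `IZZ'` that is trivial
on `I(1)`. -/
def IsPrincipalSeries {ϖ : Dˣ} {W : Type*} [AddCommGroup W] [Module (Coef p) W]
    (ρ : Representation (Coef p) (KZZ p ϖ) W) : Prop :=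
  ∃ χ : Representation (Coef p) ((IZZ p ϖ).subgroupOf (KZZ p ϖ)) (Coef p),
    (∀ h, (h.1.1 : GL (Fin 2) D) ∈ proPIwahori p D → χ h = 1) ∧
    Nonempty (ρ.Equiv (cInd χ))

end Vectors

end GL2D

end

/-!
The double cosets `I(1) \ G / KZZ'` are represented by the matrices `(ϖ^n 0; 0 1)` and
`β (ϖ^n 0; 0 1)` with `n ≥ 0` (`exists_proPIwahori_decomposition`), and a function `φ` in the compact
induction that is invariant under `I(1)` is determined by its values at the inverses of these
matrices. Such a value is fixed by all upper unipotent matrices of `GL₂(𝒪_D)`, because `I(1)`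
contains their conjugates; hence it is a multiple of `⊗_j x_j^{r_j}` (`eq_smul_highest_of_fixed`,
`apply_baseVertex_eq_smul`). Each `s_n^0` and each `β s_n^0` is invariant, takes the value
`⊗_j x_j^{r_j}` at one of these points and vanishes at the others, so they form the basis dual to
the evaluations (`exists_basis_invariants`).

Two facts about weights enter, both of which rest on `|k_D| = p^{wf}` (`card_residueRing`). Setting
`x_j = 1` and `y_j = t^{p^j}` identifies `⊗_j Sym^{r_j}` with a space of polynomials in `t` of degree
less than `p^{wf}`, and such a polynomial is determined by its values on `k_D`. So the vectors fixed
by the unipotent matrices are the multiples of `⊗_j x_j^{r_j}`, and the weight is irreducible.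
The cardinality comes from the identity `e f = [D : ℚ_p]`, which counts the index of `p 𝒪_D` in
the lattice `𝒪_D`: commutative subfields of `D` have degree at most `w` over `F`, and those generated
by a lift of a generator of `k_D^×` and by a uniformizer bound the residue degree and the ramification
index of `D` over `F` by `w`, so both are equal to `w`.

The vector `β s_n^0` is an eigenvector of `IZZ'`, and its `q^w + 1` translates by `KZZ' / IZZ'` are
linearly independent, so the module it generates is induced from its eigencharacter
(`generated_equiv_cInd`). In that module, `s_{n+1}^0` is a sum of translates of `β s_n^0`
(`sVec_succ`). The functional on `σ` that reads off the coefficient of `⊗_j y_j^{r_j}` is an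
eigenvector of `IZZ'` too; by Frobenius reciprocity it gives an embedding of `σ` in the induced
module that takes `⊗_j x_j^{r_j}` to `s_{n+1}^0 + 0^r β s_n^0` (`exists_frobenius`,
`generated_succ_equiv`). For `r > 0` this vector is `s_{n+1}^0`, and for `r = 0` it is
`s_{n+1}^0 + β s_n^0`. For `r = q^w - 1` the eigencharacter of `β s_n^0` extends to `KZZ'`
(`scaleChar`), and Frobenius reciprocity, applied to the extended character instead of `σ`, shows
that `s_{n+1}^0 + β s_n^0` is an eigenvector of `KZZ'` (`exists_smul_of_eq_card_sub_one`).
-/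

noncomputable section

namespace GL2D

set_option linter.unusedSectionVars false

universe u

/-! ### The norm of `D` and digit expansions -/

section Valuation

variable (p : ℕ) [Fact p.Prime]
variable {D : Type*} [DivisionRing D] [Algebra ℚ_[p] D] [FiniteDimensional ℚ_[p] D]

theorem absNorm_pos {x : D} (hx : x ≠ 0) : 0 < absNorm p D x := by
  refine lt_of_le_of_ne (absNorm_nonneg p D x) fun h0 => ?_
  have h1 : absNorm p D x * absNorm p D x⁻¹ = 1 := by
    rw [← map_mul, mul_inv_cancel₀ hx, map_one]
  rw [← h0, zero_mul] at h1
  exact zero_ne_one h1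

theorem absNorm_eq_zero {x : D} : absNorm p D x = 0 ↔ x = 0 :=
  ⟨fun h => by_contra fun hx => (absNorm_pos p hx).ne' h, fun h => by rw [h, absNorm_zero]⟩

theorem absNorm_inv (x : D) : absNorm p D x⁻¹ = (absNorm p D x)⁻¹ := by
  by_cases hx : x = 0
  · simp [hx, absNorm_zero]
  · refine eq_inv_of_mul_eq_one_left ?_
    rw [← map_mul, inv_mul_cancel₀ hx, map_one]

theorem absNorm_zpow (x : D) (j : ℤ) : absNorm p D (x ^ j) = absNorm p D x ^ j := by
  cases j with
  | ofNat n => simp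
  | negSucc n => rw [zpow_negSucc, zpow_negSucc, absNorm_inv, map_pow]

theorem absNorm_sub_le (x y : D) :
    absNorm p D (x - y) ≤ max (absNorm p D x) (absNorm p D y) := by
  rw [sub_eq_add_neg, ← absNorm_neg p D y]
  exact absNorm_add_le p D x (-y)

theorem absNorm_add_le_of_le {x y : D} {c : ℝ} (hx : absNorm p D x ≤ c) (hy : absNorm p D y ≤ c) :
    absNorm p D (x + y) ≤ c :=
  (absNorm_add_le p D x y).trans (max_le hx hy)

theorem absNorm_sub_le_of_le {x y : D} {c : ℝ} (hx : absNorm p D x ≤ c) (hy : absNorm p D y ≤ c) :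
    absNorm p D (x - y) ≤ c :=
  (absNorm_sub_le p x y).trans (max_le hx hy)

theorem absNorm_add_eq_of_lt {x y : D} (h : absNorm p D x < absNorm p D y) :
    absNorm p D (x + y) = absNorm p D y := by
  refine le_antisymm (absNorm_add_le_of_le p h.le le_rfl) (not_lt.1 fun hlt => ?_)
  have h1 := absNorm_sub_le p (x + y) x
  rw [add_sub_cancel_left] at h1
  exact absurd h1 (not_le.2 (max_lt hlt h))

theorem mem_integers {x : D} : x ∈ integers p D ↔ absNorm p D x ≤ 1 := Iff.rfl

theorem mem_maxIdeal {x : integers p D} : x ∈ maxIdeal p D ↔ absNorm p D (x : D) < 1 := Iff.rfl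

theorem red_eq_iff {x y : integers p D} :
    red p D x = red p D y ↔ absNorm p D ((x : D) - y) < 1 := by
  rw [Ideal.Quotient.eq, mem_maxIdeal]; rfl

theorem red_eq_zero_iff {x : integers p D} : red p D x = 0 ↔ absNorm p D (x : D) < 1 := by
  rw [Ideal.Quotient.eq_zero_iff_mem, mem_maxIdeal]

theorem red_surjective : Function.Surjective (red p D) := Ideal.Quotient.mk_surjective

theorem absNorm_eq_one_of_red_ne_zero {x : integers p D} (hx : red p D x ≠ 0) :
    absNorm p D (x : D) = 1 :=
  le_antisymm x.2 (not_lt.1 fun h => hx ((red_eq_zero_iff p).2 h))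

instance : Nontrivial (residueRing p D) := by
  refine ⟨0, 1, fun h => ?_⟩
  rw [← map_one (red p D), eq_comm, red_eq_zero_iff] at h
  simp at h

/-- The residue ring is a division ring. -/
theorem isUnit_residue {x : residueRing p D} (hx : x ≠ 0) : IsUnit x := by
  obtain ⟨y, rfl⟩ := red_surjective p x
  have hy := absNorm_eq_one_of_red_ne_zero p hx
  have hy0 : (y : D) ≠ 0 := fun h => by rw [h, absNorm_zero] at hy; exact zero_ne_one hy
  let z : integers p D := ⟨(y : D)⁻¹, by rw [mem_integers, absNorm_inv, hy, inv_one]⟩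
  refine IsUnit.map (red p D) (⟨⟨y, z, ?_, ?_⟩, rfl⟩ : IsUnit y)
  · exact Subtype.ext (mul_inv_cancel₀ hy0)
  · exact Subtype.ext (inv_mul_cancel₀ hy0)

/-- Every nonzero residue class is a unit, so a homomorphism from the residue ring is injective. -/
theorem residue_hom_injective {E : Type*} [Ring E] [Nontrivial E] (ι : residueRing p D →+* E) :
    Function.Injective ι := by
  refine (injective_iff_map_eq_zero ι).2 fun x hx => by_contra fun hne => ?_
  exact ((isUnit_residue p hne).map ι).ne_zero hx

variable {p}
variable {ϖ : Dˣ} (hϖ : IsUniformizer p ϖ)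
include hϖ

theorem IsUniformizer.lt_one : absNorm p D (ϖ : D) < 1 :=
  (hϖ ϖ).2 ⟨1, one_mem _, by simp⟩

omit hϖ in
theorem uniformizer_pos (ϖ : Dˣ) : 0 < absNorm p D (ϖ : D) := absNorm_pos p ϖ.ne_zero

theorem IsUniformizer.le_of_lt_one {x : D} (hx : absNorm p D x < 1) :
    absNorm p D x ≤ absNorm p D (ϖ : D) := by
  obtain ⟨y, hy, rfl⟩ := (hϖ x).1 hx
  rw [map_mul]
  exact mul_le_of_le_one_right (absNorm_nonneg p D _) hy

omit hϖ in
theorem isUniformizer_of_max {ϖ : Dˣ} (h1 : absNorm p D (ϖ : D) < 1)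
    (h : ∀ x : D, absNorm p D x < 1 → absNorm p D x ≤ absNorm p D (ϖ : D)) :
    IsUniformizer p ϖ := by
  refine fun x => ⟨fun hx => ⟨((ϖ⁻¹ : Dˣ) : D) * x, ?_, by simp⟩, ?_⟩
  · rw [mem_integers, map_mul, Units.val_inv_eq_inv_val, absNorm_inv,
      inv_mul_le_iff₀ (uniformizer_pos ϖ), mul_one]
    exact h x hx
  · rintro ⟨y, hy, rfl⟩
    rw [map_mul]
    exact mul_lt_one_of_nonneg_of_lt_one_left (absNorm_nonneg p D _) h1 hy

theorem IsUniformizer.exists_zpow {x : D} (hx : x ≠ 0) :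
    ∃ j : ℤ, absNorm p D x = absNorm p D (ϖ : D) ^ j := by
  have hpos := uniformizer_pos (p := p) ϖ
  obtain ⟨j, hj1, hj2⟩ := exists_mem_Ioc_zpow (absNorm_pos p hx)
    (one_lt_inv_iff₀.2 ⟨hpos, hϖ.lt_one⟩)
  refine ⟨-(j + 1), le_antisymm (by simpa using hj2) ?_⟩
  -- `y = ϖ^(j+1) x` has norm in `(|ϖ|, 1]`, hence norm `1`
  have hy : absNorm p D ((ϖ : D) ^ (j + 1) * x) = absNorm p D (ϖ : D) ^ (j + 1) * absNorm p D x := by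
    rw [map_mul, absNorm_zpow]
  have h2 : absNorm p D (ϖ : D) < absNorm p D ((ϖ : D) ^ (j + 1) * x) := by
    rw [hy, zpow_add_one₀ hpos.ne', mul_right_comm]
    refine lt_mul_of_one_lt_left hpos ?_
    rw [inv_zpow] at hj1
    exact (inv_lt_iff_one_lt_mul₀' (zpow_pos hpos _)).1 hj1
  have h3 : 1 ≤ absNorm p D ((ϖ : D) ^ (j + 1) * x) :=
    not_lt.1 fun h => absurd (hϖ.le_of_lt_one h) (not_le.2 h2)
  rw [hy] at h3
  rw [zpow_neg]
  exact (inv_le_iff_one_le_mul₀' (zpow_pos hpos _)).2 h3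

theorem IsUniformizer.zpow_le_zpow_iff {i j : ℤ} :
    absNorm p D (ϖ : D) ^ i ≤ absNorm p D (ϖ : D) ^ j ↔ j ≤ i :=
  zpow_le_zpow_iff_right_of_lt_one₀ (uniformizer_pos ϖ) hϖ.lt_one

theorem IsUniformizer.zpow_lt_zpow_iff {i j : ℤ} :
    absNorm p D (ϖ : D) ^ i < absNorm p D (ϖ : D) ^ j ↔ j < i :=
  zpow_lt_zpow_iff_right_of_lt_one₀ (uniformizer_pos ϖ) hϖ.lt_one

theorem IsUniformizer.lt_zpow_iff {x : D} {j : ℤ} :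
    absNorm p D x < absNorm p D (ϖ : D) ^ j ↔ absNorm p D x ≤ absNorm p D (ϖ : D) ^ (j + 1) := by
  by_cases hx : x = 0
  · simp [hx, absNorm_zero, zpow_pos (uniformizer_pos (p := p) ϖ),
      (zpow_pos (uniformizer_pos (p := p) ϖ) _).le]
  · obtain ⟨i, hi⟩ := hϖ.exists_zpow hx
    rw [hi, hϖ.zpow_lt_zpow_iff, hϖ.zpow_le_zpow_iff]
    omega

end Valuation

section Digits

variable {p : ℕ} [Fact p.Prime]
variable {D : Type*} [DivisionRing D] [Algebra ℚ_[p] D] [FiniteDimensional ℚ_[p] D]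
variable {ϖ : Dˣ} (hϖ : IsUniformizer p ϖ)

/-- The sum `∑_{i<n} ϖ^i s(μ_i)` for an arbitrary set-theoretic lift `s` of the residue ring. -/
def digitSum (ϖ : Dˣ) (s : residueRing p D → integers p D) {n : ℕ}
    (μ : Fin n → residueRing p D) : D :=
  ∑ i : Fin n, (ϖ : D) ^ (i : ℕ) * (s (μ i) : D)

theorem digitSum_succ (s : residueRing p D → integers p D) {n : ℕ}
    (μ : Fin (n + 1) → residueRing p D) :
    digitSum ϖ s μ = s (μ 0) + (ϖ : D) * digitSum ϖ s (fun i => μ i.succ) := by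
  rw [digitSum, Fin.sum_univ_succ, digitSum, Finset.mul_sum]
  simp [pow_succ', mul_assoc]

include hϖ

theorem absNorm_digitSum_le (s : residueRing p D → integers p D) {n : ℕ}
    (μ : Fin n → residueRing p D) : absNorm p D (digitSum ϖ s μ) ≤ 1 := by
  induction n with
  | zero => simp [digitSum, absNorm_zero]
  | succ n ih =>
    rw [digitSum_succ]
    refine absNorm_add_le_of_le p (s _).2 ?_
    rw [map_mul]
    exact mul_le_one₀ hϖ.lt_one.le (absNorm_nonneg p D _) (ih _)

/-- The digit sums of length `n` meet every class of `𝒪_D` modulo `ϖ^n`. -/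
theorem digitSum_exists {s : residueRing p D → integers p D} (hs : ∀ x, red p D (s x) = x) (n : ℕ)
    {x : D} (hx : absNorm p D x ≤ 1) :
    ∃ μ : Fin n → residueRing p D,
      absNorm p D (x - digitSum ϖ s μ) ≤ absNorm p D (ϖ : D) ^ n := by
  induction n generalizing x with
  | zero => exact ⟨Fin.elim0, by simpa [digitSum] using hx⟩
  | succ n ih =>
    let a := red p D ⟨x, hx⟩
    have h1 : absNorm p D (x - s a) < 1 := (red_eq_iff p).1 (hs a).symm
    obtain ⟨y, hy, hxy⟩ := (hϖ _).1 h1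
    obtain ⟨μ, hμ⟩ := ih hy
    refine ⟨Fin.cons a μ, ?_⟩
    rw [digitSum_succ]
    have e : x - (s a + (ϖ : D) * digitSum ϖ s μ) = ϖ * (y - digitSum ϖ s μ) := by
      rw [mul_sub, ← hxy, sub_sub]
    simp only [Fin.cons_zero, Fin.cons_succ]
    rw [e, map_mul, pow_succ']
    exact mul_le_mul_of_nonneg_left hμ (absNorm_nonneg p D _)

/-- Digit sums of length `n` with different digits are not congruent modulo `ϖ^n`. -/
theorem digitSum_unique {s : residueRing p D → integers p D} (hs : ∀ x, red p D (s x) = x) {n : ℕ}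
    {μ ν : Fin n → residueRing p D}
    (h : absNorm p D (digitSum ϖ s μ - digitSum ϖ s ν) ≤ absNorm p D (ϖ : D) ^ n) : μ = ν := by
  induction n with
  | zero => exact Subsingleton.elim _ _
  | succ n ih =>
    have e : digitSum ϖ s μ - digitSum ϖ s ν = ((s (μ 0) : D) - s (ν 0)) +
        ϖ * (digitSum ϖ s (fun i => μ i.succ) - digitSum ϖ s (fun i => ν i.succ)) := by
      rw [digitSum_succ, digitSum_succ]; noncomm_ring
    have h2 : absNorm p D (ϖ * (digitSum ϖ s (fun i => μ i.succ)
        - digitSum ϖ s (fun i => ν i.succ))) ≤ absNorm p D (ϖ : D) := by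
      rw [map_mul]
      exact mul_le_of_le_one_right (absNorm_nonneg p D _) (absNorm_sub_le_of_le p
        (absNorm_digitSum_le hϖ s _) (absNorm_digitSum_le hϖ s _))
    have h0 : μ 0 = ν 0 := by
      rw [← hs (μ 0), ← hs (ν 0), red_eq_iff]
      rw [eq_sub_of_add_eq e.symm]
      refine (absNorm_sub_le_of_le p (h.trans ?_) h2).trans_lt hϖ.lt_one
      exact pow_le_of_le_one (absNorm_nonneg p D _) hϖ.lt_one.le (Nat.succ_ne_zero _)
    rw [h0, sub_self, zero_add] at e
    rw [e, map_mul, pow_succ'] at h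
    have h3 := ih (le_of_mul_le_mul_left h (uniformizer_pos ϖ))
    funext i
    refine Fin.cases h0 (fun j => congrFun h3 j) i

end Digits

/-! ### The lattice `𝒪_D` -/

section Lattices

variable {p : ℕ} [Fact p.Prime]
variable {D : Type*} [DivisionRing D] [Algebra ℚ_[p] D] [FiniteDimensional ℚ_[p] D]

/-- The integral elements have bounded coordinates: the norm form is homogeneous and does not
vanish on the compact unit sphere, where it is therefore bounded below. -/
theorem exists_coord_bound {n : ℕ} (b : Module.Basis (Fin n) ℚ_[p] D) :
    ∃ C : ℝ, ∀ x ∈ integers p D, ∀ i, ‖b.repr x i‖ ≤ C := by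
  have hn : n = Module.finrank ℚ_[p] D := by simp [Module.finrank_eq_card_basis b]
  have hn0 : n ≠ 0 := hn ▸ Module.finrank_pos.ne'
  let g : (Fin n → ℚ_[p]) → ℝ := fun v => absNorm p D (b.equivFun.symm v)
  have hg : Continuous g := by
    have h1 : Continuous (((Algebra.leftMulMatrix b).toLinearMap).comp
        (b.equivFun.symm.toLinearMap)) := LinearMap.continuous_on_pi _
    have h2 : g = fun v => ‖((((Algebra.leftMulMatrix b).toLinearMap).comp
        (b.equivFun.symm.toLinearMap)) v).det‖ := by
      funext v
      exact congrArg norm (Algebra.norm_eq_matrix_det b (b.equivFun.symm v))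
    rw [h2]
    exact (Continuous.matrix_det h1).norm
  have hgs : ∀ (c : ℚ_[p]) (v : Fin n → ℚ_[p]), g (c • v) = ‖c‖ ^ n * g v := by
    intro c v
    change absNorm p D (b.equivFun.symm (c • v)) = _ * absNorm p D _
    rw [map_smul, Algebra.smul_def, map_mul]
    congr 1
    change ‖Algebra.norm ℚ_[p] (algebraMap ℚ_[p] D c)‖ = _
    rw [Algebra.norm_algebraMap, norm_pow, hn]
  have hne : (Metric.sphere (0 : Fin n → ℚ_[p]) 1).Nonempty := by
    refine ⟨fun _ => 1, ?_⟩
    have : Nonempty (Fin n) := ⟨⟨0, Nat.pos_of_ne_zero hn0⟩⟩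
    rw [mem_sphere_zero_iff_norm, pi_norm_const, norm_one]
  obtain ⟨v0, hv0, hmin⟩ := (isCompact_sphere _ _).exists_isMinOn hne hg.continuousOn
  have hc : 0 < g v0 := by
    refine absNorm_pos p fun h => ?_
    rw [LinearEquiv.map_eq_zero_iff] at h
    simp [h] at hv0
  refine ⟨max 1 (g v0)⁻¹, fun x hx i => ?_⟩
  by_cases hx0 : b.equivFun x = 0
  · have : b.repr x i = 0 := congrFun hx0 i
    simp [this]
  have : Nonempty (Fin n) := ⟨i⟩
  obtain ⟨i0, hi0⟩ := exists_eq_ciSup_of_finite (f := fun i => ‖b.equivFun x i‖)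
  have hnorm : ‖b.equivFun x‖ = ‖b.equivFun x i0‖ := by
    refine le_antisymm ((pi_norm_le_iff_of_nonneg (norm_nonneg _)).2 fun j => ?_)
      (norm_le_pi_norm _ _)
    rw [hi0]
    exact le_ciSup (f := fun i => ‖b.equivFun x i‖) (Set.finite_range _).bddAbove j
  set c := b.equivFun x i0
  have hc0 : c ≠ 0 := fun h => by
    rw [h, norm_zero, norm_eq_zero] at hnorm; exact hx0 hnorm
  have hs : c⁻¹ • b.equivFun x ∈ Metric.sphere (0 : Fin n → ℚ_[p]) 1 := by
    rw [mem_sphere_zero_iff_norm, norm_smul, norm_inv, hnorm,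
      inv_mul_cancel₀ (norm_ne_zero_iff.2 hc0)]
  have h3 : g v0 ≤ g (c⁻¹ • b.equivFun x) := hmin hs
  rw [hgs, norm_inv, inv_pow] at h3
  have h4 : g (b.equivFun x) ≤ 1 := by
    change absNorm p D (b.equivFun.symm (b.equivFun x)) ≤ 1
    rw [LinearEquiv.symm_apply_apply]; exact hx
  have hcp : 0 < ‖c‖ ^ n := pow_pos (norm_pos_iff.2 hc0) _
  have h5 : ‖c‖ ^ n ≤ (g v0)⁻¹ := by
    rw [le_inv_comm₀ hcp hc]
    refine h3.trans ?_
    exact mul_le_of_le_one_right (inv_nonneg.2 hcp.le) h4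
  have h6 : ‖b.repr x i‖ ≤ ‖c‖ := hnorm ▸ norm_le_pi_norm (b.equivFun x) i
  refine h6.trans ?_
  rcases le_total ‖c‖ 1 with h | h
  · exact h.trans (le_max_left _ _)
  · exact ((le_self_pow₀ h hn0).trans h5).trans (le_max_right _ _)

/-- The `ℤ_p`-lattice spanned by a basis. -/
def coordLattice {n : ℕ} (b : Module.Basis (Fin n) ℚ_[p] D) : AddSubgroup D where
  carrier := {x | ∀ i, ‖b.repr x i‖ ≤ 1}
  add_mem' {x y} hx hy i := by
    rw [map_add, Finsupp.add_apply]
    exact (Padic.nonarchimedean _ _).trans (max_le (hx i) (hy i))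
  zero_mem' i := by simp
  neg_mem' {x} hx i := by
    rw [map_neg, Finsupp.neg_apply, norm_neg]; exact hx i

/-- A basis with small enough vectors spans a lattice that contains `𝒪_D`. -/
theorem exists_basis_integers_le {n : ℕ} (b : Module.Basis (Fin n) ℚ_[p] D) :
    ∃ b' : Module.Basis (Fin n) ℚ_[p] D, (integers p D).toAddSubgroup ≤ coordLattice b' := by
  obtain ⟨C, hC⟩ := exists_coord_bound b
  have hp1 : (1 : ℝ) < p := by exact_mod_cast (Fact.out : p.Prime).one_lt
  obtain ⟨N, hN⟩ := pow_unbounded_of_one_lt C hp1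
  have hp0 : (p : ℚ_[p]) ≠ 0 := by exact_mod_cast (Fact.out : p.Prime).ne_zero
  let u : ℚ_[p]ˣ := (Units.mk0 (p : ℚ_[p]) hp0 ^ N)⁻¹
  refine ⟨b.unitsSMul fun _ => u, fun x hx i => ?_⟩
  rw [Module.Basis.repr_unitsSMul]
  have : ((u⁻¹ : ℚ_[p]ˣ) • b.repr x i) = (p : ℚ_[p]) ^ N * b.repr x i := by
    simp [u, Units.smul_def]
  rw [this, norm_mul, Padic.norm_p_pow, _root_.zpow_neg, zpow_natCast,
    inv_mul_le_iff₀ (by positivity), mul_one]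
  exact (hC x hx i).trans hN.le

variable (p D) in
/-- Multiplication by `p`. -/
def mulP : D →+ D := AddMonoidHom.mulLeft (p : D)

theorem natCast_p_ne_zero : (p : D) ≠ 0 := by
  have hp0 : (p : ℚ_[p]) ≠ 0 := by exact_mod_cast (Fact.out : p.Prime).ne_zero
  rw [← map_natCast (algebraMap ℚ_[p] D)]
  exact (map_ne_zero _).2 hp0

theorem mulP_injective : Function.Injective (mulP p D) :=
  mul_right_injective₀ natCast_p_ne_zero

theorem relIndex_map_mulP (H K : AddSubgroup D) :
    (H.map (mulP p D)).relIndex (K.map (mulP p D)) = H.relIndex K :=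
  AddSubgroup.relIndex_map_map_of_injective (f := mulP p D) H K mulP_injective

theorem repr_mulP {n : ℕ} (b : Module.Basis (Fin n) ℚ_[p] D) (x : D) (i : Fin n) :
    b.repr (mulP p D x) i = p * b.repr x i := by
  have : mulP p D x = (p : ℚ_[p]) • x := by
    rw [Algebra.smul_def, map_natCast]; rfl
  rw [this, map_smul, Finsupp.smul_apply, smul_eq_mul]

theorem mulP_coordLattice_le {n : ℕ} (b : Module.Basis (Fin n) ℚ_[p] D) :
    (coordLattice b).map (mulP p D) ≤ coordLattice b := by
  rintro _ ⟨x, hx, rfl⟩ i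
  rw [repr_mulP, norm_mul]
  exact mul_le_one₀ Padic.norm_p_lt_one.le (norm_nonneg _) (hx i)

/-- Reduction of the coordinates modulo `p` identifies the quotient of a lattice of rank `n` by
its multiples of `p` with `𝔽_p^n`. -/
theorem relIndex_coordLattice {n : ℕ} (b : Module.Basis (Fin n) ℚ_[p] D) :
    ((coordLattice b).map (mulP p D)).relIndex (coordLattice b) = p ^ n := by
  let q : coordLattice b →+ (Fin n → ZMod p) :=
    { toFun := fun x i => PadicInt.toZMod ⟨b.repr (x : D) i, x.2 i⟩
      map_zero' := by
        funext i
        refine Eq.trans (congrArg PadicInt.toZMod ?_) (map_zero _)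
        exact Subtype.ext (by simp)
      map_add' := fun x y => by
        funext i
        refine Eq.trans (congrArg PadicInt.toZMod ?_) (map_add _ _ _)
        exact Subtype.ext (by simp; rfl) }
  have hp0 : (p : ℚ_[p]) ≠ 0 := by exact_mod_cast (Fact.out : p.Prime).ne_zero
  have hker : q.ker = ((coordLattice b).map (mulP p D)).addSubgroupOf (coordLattice b) := by
    ext x
    rw [AddMonoidHom.mem_ker, AddSubgroup.mem_addSubgroupOf]
    have h1 : q x = 0 ↔ ∀ i, ‖b.repr (x : D) i‖ < 1 := by
      rw [funext_iff]
      refine forall_congr' fun i => ?_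
      have h2 : ∀ z : ℤ_[p], PadicInt.toZMod z = 0 ↔ ‖z‖ < 1 := fun z => by
        rw [← RingHom.mem_ker, PadicInt.ker_toZMod, IsLocalRing.mem_maximalIdeal,
          PadicInt.mem_nonunits]
      exact h2 _
    rw [h1]
    constructor
    · intro h
      refine ⟨(p : ℚ_[p])⁻¹ • (x : D), fun i => ?_, ?_⟩
      · rw [map_smul, Finsupp.smul_apply, smul_eq_mul, norm_mul, norm_inv, Padic.norm_p, inv_inv]
        have h2 := (Padic.norm_lt_pow_iff_norm_le_pow_sub_one (b.repr (x : D) i) 0).1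
          (by simpa using h i)
        have hpp : (0 : ℝ) < p := by exact_mod_cast (Fact.out : p.Prime).pos
        rw [zero_sub, zpow_neg_one] at h2
        exact (mul_le_mul_of_nonneg_left h2 hpp.le).trans_eq (mul_inv_cancel₀ hpp.ne')
      · change (p : D) * _ = _
        rw [← map_natCast (algebraMap ℚ_[p] D), ← Algebra.smul_def, smul_smul,
          mul_inv_cancel₀ hp0, one_smul]
    · rintro ⟨y, hy, hyx⟩ i
      rw [← hyx, repr_mulP, norm_mul]
      exact mul_lt_one_of_nonneg_of_lt_one_left (norm_nonneg _) Padic.norm_p_lt_one (hy i)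
  have hsurj : Function.Surjective q := by
    intro v
    choose u hu using fun i => ZMod.ringHom_surjective (PadicInt.toZMod (p := p)) (v i)
    refine ⟨⟨b.equivFun.symm fun i => (u i : ℚ_[p]), fun i => ?_⟩, ?_⟩
    · rw [← Module.Basis.equivFun_apply, LinearEquiv.apply_symm_apply]; exact (u i).2
    · funext i
      rw [← hu i]
      refine congrArg PadicInt.toZMod (Subtype.ext ?_)
      change b.repr (b.equivFun.symm fun i => (u i : ℚ_[p])) i = _
      rw [← Module.Basis.equivFun_apply, LinearEquiv.apply_symm_apply]
  rw [AddSubgroup.relIndex, ← hker, AddSubgroup.index_ker, AddMonoidHom.range_eq_top.2 hsurj]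
  simp [Nat.card_eq_fintype_card, ZMod.card]

/-- The index of `p 𝒪_D` in `𝒪_D`: it agrees with the index for any lattice containing `𝒪_D`
because multiplication by `p` preserves relative indices. -/
theorem relIndex_integers :
    ((integers p D).toAddSubgroup.map (mulP p D)).relIndex (integers p D).toAddSubgroup
      = p ^ Module.finrank ℚ_[p] D := by
  obtain ⟨b, hb⟩ := exists_basis_integers_le (Module.finBasis ℚ_[p] D)
  set O := (integers p D).toAddSubgroup
  set L := coordLattice b
  have hOO : O.map (mulP p D) ≤ O := by
    rintro _ ⟨x, hx, rfl⟩
    exact (integers p D).mul_mem (natCast_mem _ _) hx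
  -- the sublattice `p^A L` has finite index in `L`
  have hpow : ∀ A : ℕ, ∃ M : AddSubgroup D, M ≤ L ∧ M.relIndex L ≠ 0 ∧
      ∀ x ∈ M, ∃ y ∈ L, x = (p : D) ^ A * y := by
    intro A
    induction A with
    | zero => exact ⟨L, le_rfl, by simp, fun x hx => ⟨x, hx, by simp⟩⟩
    | succ A ih =>
      obtain ⟨M, hM1, hM2, hM3⟩ := ih
      refine ⟨M.map (mulP p D), (AddSubgroup.map_mono hM1).trans (mulP_coordLattice_le b), ?_, ?_⟩
      · rw [← AddSubgroup.relIndex_mul_relIndex _ _ _ (AddSubgroup.map_mono hM1)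
          (mulP_coordLattice_le b), relIndex_map_mulP,
          relIndex_coordLattice]
        exact mul_ne_zero hM2 (pow_ne_zero _ (Fact.out : p.Prime).ne_zero)
      · rintro _ ⟨x, hx, rfl⟩
        obtain ⟨y, hy, rfl⟩ := hM3 x hx
        exact ⟨y, hy, by rw [pow_succ', mul_assoc]; rfl⟩
  have hfin : O.relIndex L ≠ 0 := by
    -- a bound for the norm of the lattice `L`, via the norms of the basis vectors
    have hbd : ∃ A : ℕ, ∀ y ∈ L, (p : D) ^ A * y ∈ O := by
      have hp : absNorm p D (p : D) < 1 := by
        change ‖Algebra.norm ℚ_[p] (p : D)‖ < 1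
        rw [← map_natCast (algebraMap ℚ_[p] D), Algebra.norm_algebraMap, norm_pow]
        exact pow_lt_one₀ (norm_nonneg _) Padic.norm_p_lt_one Module.finrank_pos.ne'
      have h1 : ∀ i, ∃ A : ℕ, absNorm p D ((p : D) ^ A * b i) ≤ 1 := by
        intro i
        have hb0 := absNorm_pos p (b.ne_zero i)
        obtain ⟨A, hA⟩ := exists_pow_lt_of_lt_one (inv_pos.2 hb0) hp
        refine ⟨A, ?_⟩
        rw [map_mul, map_pow]
        exact (mul_le_mul_of_nonneg_right hA.le hb0.le).trans_eq (inv_mul_cancel₀ hb0.ne')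
      choose A hA using h1
      refine ⟨∑ i, A i, fun y hy => ?_⟩
      rw [← b.sum_repr y, Finset.mul_sum]
      refine sum_mem fun i _ => ?_
      have e : (p : D) ^ (∑ i, A i) * (b.repr y i • b i)
          = ((p : D) ^ (∑ j ∈ Finset.univ.erase i, A j) * algebraMap ℚ_[p] D (b.repr y i)) *
            ((p : D) ^ A i * b i) := by
        rw [← Finset.add_sum_erase _ _ (Finset.mem_univ i), Algebra.smul_def, add_comm, pow_add]
        have hc := (Nat.cast_commute (p ^ A i) (algebraMap ℚ_[p] D (b.repr y i))).eq
        push_cast at hc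
        simp only [mul_assoc]
        rw [← mul_assoc ((p : D) ^ A i), hc, mul_assoc]
      rw [e]
      refine (integers p D).mul_mem (mul_mem (pow_mem (natCast_mem _ _) _) ?_) (hA i)
      change ‖Algebra.norm ℚ_[p] (algebraMap ℚ_[p] D (b.repr y i))‖ ≤ 1
      rw [Algebra.norm_algebraMap, norm_pow]
      exact pow_le_one₀ (norm_nonneg _) (hy i)
    obtain ⟨A, hA⟩ := hbd
    obtain ⟨M, hM1, hM2, hM3⟩ := hpow A
    have hMO : M ≤ O := fun x hx => by
      obtain ⟨y, hy, rfl⟩ := hM3 x hx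
      exact hA y hy
    rw [← AddSubgroup.relIndex_mul_relIndex _ _ _ hMO hb] at hM2
    exact right_ne_zero_of_mul hM2
  -- both chains `p 𝒪_D ≤ 𝒪_D ≤ L` and `p 𝒪_D ≤ p L ≤ L` compute the index of `p 𝒪_D` in `L`
  have h1 := AddSubgroup.relIndex_mul_relIndex _ _ _ hOO hb
  have h2 := AddSubgroup.relIndex_mul_relIndex _ _ _ (AddSubgroup.map_mono (f := mulP p D) hb)
    (mulP_coordLattice_le b)
  rw [relIndex_map_mulP, relIndex_coordLattice,
    ← h1, mul_comm] at h2
  exact (Nat.eq_of_mul_eq_mul_right (Nat.pos_of_ne_zero hfin) h2).symm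

end Lattices

/-! ### The cardinality of the residue field -/

section Ramification

variable (p : ℕ) [Fact p.Prime]
variable (D : Type*) [DivisionRing D] [Algebra ℚ_[p] D] [FiniteDimensional ℚ_[p] D]

theorem absNorm_natCast_lt_one : absNorm p D (p : D) < 1 := by
  change ‖Algebra.norm ℚ_[p] (p : D)‖ < 1
  rw [← map_natCast (algebraMap ℚ_[p] D), Algebra.norm_algebraMap, norm_pow]
  exact pow_lt_one₀ (norm_nonneg _) Padic.norm_p_lt_one Module.finrank_pos.ne'

/-- The norms of `D` are powers of `p`, so the largest norm smaller than `1` is attained. -/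
theorem exists_isUniformizer : ∃ ϖ : Dˣ, IsUniformizer p ϖ := by
  classical
  have hp1 : (1 : ℝ) < p := by exact_mod_cast (Fact.out : p.Prime).one_lt
  have hp0 : (0 : ℝ) < p := zero_lt_one.trans hp1
  have hval : ∀ x : D, x ≠ 0 → absNorm p D x < 1 →
      ∃ k : ℕ, absNorm p D x = (p : ℝ) ^ (-(k : ℤ)) := by
    intro x hx h1
    have hN : Algebra.norm ℚ_[p] x ≠ 0 := norm_ne_zero_iff.1 (absNorm_pos p hx).ne'
    have h2 : absNorm p D x = (p : ℝ) ^ (-(Algebra.norm ℚ_[p] x).valuation) :=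
      Padic.norm_eq_zpow_neg_valuation hN
    rw [h2] at h1 ⊢
    rw [← zpow_zero (p : ℝ), zpow_lt_zpow_iff_right₀ hp1] at h1
    exact ⟨(Algebra.norm ℚ_[p] x).valuation.toNat, by congr 2; omega⟩
  have hex : ∃ k : ℕ, ∃ x : D, x ≠ 0 ∧ absNorm p D x < 1 ∧
      absNorm p D x = (p : ℝ) ^ (-(k : ℤ)) := by
    obtain ⟨k, hk⟩ := hval _ natCast_p_ne_zero (absNorm_natCast_lt_one p D)
    exact ⟨k, p, natCast_p_ne_zero, absNorm_natCast_lt_one p D, hk⟩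
  obtain ⟨x, hx0, hx1, hx⟩ := Nat.find_spec hex
  refine ⟨Units.mk0 x hx0, isUniformizer_of_max hx1 fun y hy => ?_⟩
  by_cases hy0 : y = 0
  · rw [hy0, absNorm_zero]; exact absNorm_nonneg p D _
  obtain ⟨k, hk⟩ := hval y hy0 hy
  rw [hk, Units.val_mk0, hx, zpow_le_zpow_iff_right₀ hp1, neg_le_neg_iff]
  exact_mod_cast Nat.find_min' hex ⟨y, hy0, hy, hk⟩

variable {p D}

/-- The identity `e f = [D : ℚ_p]` for the ramification index and the residue degree. -/
theorem IsUniformizer.exists_ramification {ϖ : Dˣ} (hϖ : IsUniformizer p ϖ) :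
    ∃ e f : ℕ, 0 < e ∧ Nat.card (residueRing p D) = p ^ f ∧
      absNorm p D (p : D) = absNorm p D (ϖ : D) ^ e ∧ e * f = Module.finrank ℚ_[p] D := by
  obtain ⟨j, hj⟩ := hϖ.exists_zpow (natCast_p_ne_zero (p := p) (D := D))
  have hj0 : 0 < j := by
    have h := absNorm_natCast_lt_one p D
    rw [hj, ← zpow_zero (absNorm p D (ϖ : D)), hϖ.zpow_lt_zpow_iff] at h
    exact h
  obtain ⟨e, rfl⟩ : ∃ e : ℕ, j = e := ⟨j.toNat, by omega⟩
  have he : 0 < e := by exact_mod_cast hj0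
  rw [zpow_natCast] at hj
  -- the digit sums of length `e` represent `𝒪_D / ϖ^e = 𝒪_D / p`
  obtain ⟨s, hs⟩ := (red_surjective (D := D) p).hasRightInverse
  set O := (integers p D).toAddSubgroup
  have hmem : ∀ x : D, x ∈ O.map (mulP p D) ↔
      absNorm p D x ≤ absNorm p D (ϖ : D) ^ e := by
    intro x
    constructor
    · rintro ⟨y, hy, rfl⟩
      change absNorm p D ((p : D) * y) ≤ _
      rw [map_mul, hj]
      exact mul_le_of_le_one_right (pow_nonneg (absNorm_nonneg p D _) _) hy
    · intro hx
      refine ⟨(p : D)⁻¹ * x, ?_, ?_⟩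
      · change absNorm p D _ ≤ 1
        rw [map_mul, absNorm_inv, hj, inv_mul_le_iff₀ (pow_pos (uniformizer_pos ϖ) _), mul_one]
        exact hx
      · exact mul_inv_cancel_left₀ natCast_p_ne_zero x
  let q : (Fin e → residueRing p D) → O ⧸ (O.map (mulP p D)).addSubgroupOf O := fun μ =>
    QuotientAddGroup.mk ⟨digitSum ϖ s μ, absNorm_digitSum_le hϖ s μ⟩
  have hq : Function.Bijective q := by
    constructor
    · intro μ ν h
      rw [QuotientAddGroup.eq, AddSubgroup.mem_addSubgroupOf, hmem] at h
      refine (digitSum_unique hϖ hs (μ := ν) (ν := μ) ?_).symm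
      rw [sub_eq_neg_add]
      exact h
    · intro y
      obtain ⟨x, rfl⟩ := QuotientAddGroup.mk_surjective y
      obtain ⟨μ, hμ⟩ := digitSum_exists hϖ hs e x.2
      refine ⟨μ, ?_⟩
      rw [QuotientAddGroup.eq, AddSubgroup.mem_addSubgroupOf, hmem]
      rw [sub_eq_neg_add] at hμ
      exact hμ
  have hcard : Nat.card (residueRing p D) ^ e = p ^ Module.finrank ℚ_[p] D := by
    rw [← relIndex_integers (p := p) (D := D), AddSubgroup.relIndex, AddSubgroup.index,
      ← Nat.card_eq_of_bijective q hq, Nat.card_fun, Nat.card_eq_fintype_card (α := Fin e),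
      Fintype.card_fin]
  have hp := (Fact.out : p.Prime)
  obtain ⟨f, -, hf⟩ := (Nat.dvd_prime_pow hp).1 ((dvd_pow_self _ he.ne').trans hcard.dvd)
  refine ⟨e, f, he, hf, hj, ?_⟩
  rw [hf, ← pow_mul, mul_comm] at hcard
  exact Nat.pow_right_injective hp.two_le hcard

theorem finite_residueRing : Finite (residueRing p D) := by
  obtain ⟨ϖ, hϖ⟩ := exists_isUniformizer p D
  obtain ⟨e, f, -, hf, -⟩ := hϖ.exists_ramification
  exact Nat.finite_of_card_ne_zero (hf ▸ pow_ne_zero _ (Fact.out : p.Prime).ne_zero)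

section Compare

variable {E : Type*} [Field E] [Algebra ℚ_[p] E] [FiniteDimensional ℚ_[p] E]

theorem absNorm_algHom (φ : E →ₐ[ℚ_[p]] D) :
    ∃ k : ℕ, k ≠ 0 ∧ ∀ x, absNorm p D (φ x) = absNorm p E x ^ k := by
  obtain ⟨k, hk, h⟩ := norm_algHom p E D φ
  exact ⟨k, hk, fun x => by change ‖Algebra.norm ℚ_[p] (φ x)‖ = _; rw [h, norm_pow]; rfl⟩

theorem absNorm_algHom_le_one_iff (φ : E →ₐ[ℚ_[p]] D) (x : E) :
    absNorm p D (φ x) ≤ 1 ↔ absNorm p E x ≤ 1 := by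
  obtain ⟨k, hk, h⟩ := absNorm_algHom φ
  rw [h, pow_le_one_iff_of_nonneg (absNorm_nonneg p E x) hk]

theorem absNorm_algHom_lt_one_iff (φ : E →ₐ[ℚ_[p]] D) (x : E) :
    absNorm p D (φ x) < 1 ↔ absNorm p E x < 1 := by
  obtain ⟨k, hk, h⟩ := absNorm_algHom φ
  rw [h, pow_lt_one_iff_of_nonneg (absNorm_nonneg p E x) hk]

/-- The map of residue rings induced by an embedding. -/
def residueMap (φ : E →ₐ[ℚ_[p]] D) : residueRing p E →+* residueRing p D :=
  Ideal.Quotient.lift (maxIdeal p E)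
    ((red p D).comp ((φ.toRingHom.comp (integers p E).subtype).codRestrict (integers p D)
      fun x => (absNorm_algHom_le_one_iff φ x).2 x.2))
    fun x hx => (red_eq_zero_iff p).2 ((absNorm_algHom_lt_one_iff φ x).2 hx)

theorem residueMap_red (φ : E →ₐ[ℚ_[p]] D) (x : integers p E) (y : integers p D)
    (h : φ x = y) : residueMap φ (red p E x) = red p D y := by
  change red p D _ = red p D y
  congr 1
  exact Subtype.ext h

theorem residueDegree_le (φ : E →ₐ[ℚ_[p]] D) {fE fD : ℕ}
    (hE : Nat.card (residueRing p E) = p ^ fE) (hD : Nat.card (residueRing p D) = p ^ fD) :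
    fE ≤ fD := by
  have := finite_residueRing (p := p) (D := D)
  have h := Nat.card_le_card_of_injective _ (residue_hom_injective p (residueMap φ))
  rw [hE, hD] at h
  exact (Nat.pow_le_pow_iff_right (Fact.out : p.Prime).one_lt).1 h

theorem ramification_le (φ : E →ₐ[ℚ_[p]] D) {ϖE : Eˣ} {ϖD : Dˣ} (hϖE : IsUniformizer p ϖE)
    (hϖD : IsUniformizer p ϖD) {eE eD : ℕ}
    (hE : absNorm p E (p : E) = absNorm p E (ϖE : E) ^ eE)
    (hD : absNorm p D (p : D) = absNorm p D (ϖD : D) ^ eD) : eE ≤ eD := by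
  have h1 : absNorm p D (φ ϖE) < 1 := (absNorm_algHom_lt_one_iff φ _).2 hϖE.lt_one
  have h2 := hϖD.le_of_lt_one h1
  obtain ⟨k, hk, h⟩ := absNorm_algHom φ
  have h3 : absNorm p D (p : D) = absNorm p D (φ ϖE) ^ eE := by
    rw [← map_natCast φ, h, hE, h, ← pow_mul, ← pow_mul, mul_comm]
  have h4 : absNorm p D (ϖD : D) ^ eD ≤ absNorm p D (ϖD : D) ^ eE := by
    rw [← hD, h3]
    exact pow_le_pow_left₀ (absNorm_nonneg p D _) h2 _
  exact (pow_le_pow_iff_right_of_lt_one₀ (uniformizer_pos ϖD) hϖD.lt_one).1 h4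

end Compare

end Ramification

section Subfields

variable {F D : Type*} [Field F] [DivisionRing D] [Algebra F D] [Algebra.IsCentral F D]

/-- The operators `x ↦ d_i x` with `d_i` linearly independent over the center are linearly
independent over the right multiplications. A relation of minimal support, normalized so that one
coefficient is `1`, has central coefficients. -/
theorem mul_mul_linearIndependent {ι : Type*} {d : ι → D} (hd : LinearIndependent F d)
    (s : Finset ι) : ∀ c : ι → D, (∀ x, ∑ i ∈ s, d i * x * c i = 0) → ∀ i ∈ s, c i = 0 := by
  classical
  induction s using Finset.induction_on with
  | empty => simp
  | insert a s has ih =>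
    intro c hc
    by_cases ha : c a = 0
    · intro i hi
      rcases Finset.mem_insert.1 hi with rfl | hi
      · exact ha
      · refine ih c (fun x => ?_) i hi
        have := hc x
        rwa [Finset.sum_insert has, ha, mul_zero, zero_add] at this
    exfalso
    have hc' : ∀ x, ∑ i ∈ insert a s, d i * x * (c i * (c a)⁻¹) = 0 := fun x => by
      rw [← zero_mul (c a)⁻¹, ← hc x, Finset.sum_mul]
      exact Finset.sum_congr rfl fun i _ => (mul_assoc _ _ _).symm
    have hcomm : ∀ i ∈ insert a s, ∀ y, y * (c i * (c a)⁻¹) = (c i * (c a)⁻¹) * y := by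
      intro i hi y
      rcases Finset.mem_insert.1 hi with rfl | hi
      · rw [mul_inv_cancel₀ ha, mul_one, one_mul]
      refine sub_eq_zero.1
        (ih (fun i => y * (c i * (c a)⁻¹) - (c i * (c a)⁻¹) * y) (fun x => ?_) i hi)
      have h1 := hc' (x * y)
      have h2 := congrArg (· * y) (hc' x)
      simp only [zero_mul, Finset.sum_mul] at h2
      have h3 : ∑ i ∈ insert a s, d i * x * (y * (c i * (c a)⁻¹) - (c i * (c a)⁻¹) * y) = 0 := by
        rw [← sub_zero (0 : D)]
        nth_rewrite 1 [← h1]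
        rw [← h2, ← Finset.sum_sub_distrib]
        exact Finset.sum_congr rfl fun i _ => by simp only [mul_sub, mul_assoc]
      rwa [Finset.sum_insert has, mul_inv_cancel₀ ha, mul_one, one_mul, sub_self, mul_zero,
        zero_add] at h3
    have hcen : ∀ i ∈ insert a s, ∃ f : F, algebraMap F D f = c i * (c a)⁻¹ := fun i hi => by
      have : c i * (c a)⁻¹ ∈ Subalgebra.center F D :=
        Subalgebra.mem_center_iff.2 fun y => hcomm i hi y
      exact Algebra.mem_bot.1 (Algebra.IsCentral.out this)
    choose! g hg using hcen
    have h0 : ∑ i ∈ insert a s, g i • d i = 0 := by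
      rw [← hc' 1]
      refine Finset.sum_congr rfl fun i hi => ?_
      rw [← hg i hi, mul_one, Algebra.smul_def, Algebra.commutes]
    have := linearIndependent_iff'.1 hd _ g h0 a (Finset.mem_insert_self _ _)
    have h1 := hg a (Finset.mem_insert_self _ _)
    rw [this, map_zero, mul_inv_cancel₀ ha] at h1
    exact zero_ne_one h1

/-- A commutative subfield of a central division algebra of dimension `w²` has degree at
most `w`. -/
theorem finrank_le_of_central [FiniteDimensional F D] {w : ℕ} (hw : Module.finrank F D = w ^ 2)
    (L : Type*) [Field L] [Algebra F L] [FiniteDimensional F L] (φ : L →ₐ[F] D) :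
    Module.finrank F L ≤ w := by
  -- `D` is an `L`-vector space by right multiplication, on which the `b_i` act by left
  -- multiplication, so that `dim_F D ≤ dim_L End_L(D)`
  let _ : Module L D :=
    { smul := fun l x => x * φ l
      one_smul := fun x => by change x * φ 1 = x; rw [map_one, mul_one]
      mul_smul := fun a b x => by
        change x * φ (a * b) = x * φ b * φ a; rw [mul_comm, map_mul, mul_assoc]
      smul_zero := fun a => zero_mul _
      smul_add := fun a x y => add_mul _ _ _
      add_smul := fun a b x => by change x * φ (a + b) = _; rw [map_add, mul_add]; rfl
      zero_smul := fun x => by change x * φ 0 = 0; rw [map_zero, mul_zero] }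
  have hsm : ∀ (l : L) (x : D), l • x = x * φ l := fun _ _ => rfl
  have : IsScalarTower F L D := ⟨fun c l x => by rw [hsm, hsm, map_smul, mul_smul_comm]⟩
  have : FiniteDimensional L D := FiniteDimensional.right F L D
  let b := Module.finBasis F D
  let Ψ : (Fin (Module.finrank F D) → L) →ₗ[L] Module.End L D :=
    { toFun := fun c =>
        { toFun := fun x => ∑ i, b i * x * φ (c i)
          map_add' := fun x y => by simp [mul_add, add_mul, Finset.sum_add_distrib]
          map_smul' := fun l x => by
            simp only [hsm, RingHom.id_apply, Finset.sum_mul]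
            refine Finset.sum_congr rfl fun i _ => ?_
            rw [mul_assoc, mul_assoc, ← map_mul, mul_comm l, map_mul, mul_assoc, mul_assoc] }
      map_add' := fun c c' => by
        ext x; simp [mul_add, Finset.sum_add_distrib]
      map_smul' := fun l c => by
        ext x
        simp only [LinearMap.coe_mk, AddHom.coe_mk, RingHom.id_apply, LinearMap.smul_apply, hsm,
          Finset.sum_mul, Pi.smul_apply, smul_eq_mul]
        refine Finset.sum_congr rfl fun i _ => ?_
        rw [mul_comm l, map_mul, mul_assoc, mul_assoc, mul_assoc] }
  have hΨ : Function.Injective Ψ := by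
    refine (injective_iff_map_eq_zero Ψ).2 fun c hc => funext fun i => ?_
    have := mul_mul_linearIndependent b.linearIndependent Finset.univ (fun i => φ (c i))
      (fun x => LinearMap.congr_fun hc x) i (Finset.mem_univ i)
    exact (map_eq_zero φ).1 this
  have h1 := LinearMap.finrank_le_finrank_of_injective hΨ
  rw [Module.finrank_fin_fun, Module.finrank_linearMap, ← sq, hw,
    Nat.pow_le_pow_iff_left two_ne_zero] at h1
  have h2 := Module.finrank_mul_finrank F L D
  have hpos : 0 < Module.finrank L D := Module.finrank_pos
  rw [hw] at h2
  by_contra hlt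
  push Not at hlt
  nlinarith

end Subfields

section ResidueCard

variable (p : ℕ) [Fact p.Prime]
    (F : Type u) [Field F] [Algebra ℚ_[p] F] [FiniteDimensional ℚ_[p] F]
    (D : Type*) [DivisionRing D] [Algebra F D] [Algebra.IsCentral F D] [FiniteDimensional F D]
    [Algebra ℚ_[p] D] [IsScalarTower ℚ_[p] F D] [FiniteDimensional ℚ_[p] D]

/-- The subfield generated by an element of a division algebra. -/
theorem exists_subfield (t : D) : ∃ (L : Type u) (_ : Field L) (_ : Algebra F L)
    (_ : FiniteDimensional F L) (φ : L →ₐ[F] D), ∃ x, φ x = t := by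
  have hint : IsIntegral F t := Algebra.IsIntegral.isIntegral t
  have : Fact (Irreducible (minpoly F t)) := ⟨minpoly.irreducible hint⟩
  have : FiniteDimensional F (AdjoinRoot (minpoly F t)) :=
    (AdjoinRoot.powerBasis (minpoly.ne_zero hint)).finite
  let φ : AdjoinRoot (minpoly F t) →ₐ[F] D :=
    Ideal.Quotient.liftₐ (Ideal.span {minpoly F t}) (Polynomial.aeval t) (fun a ha => by
      obtain ⟨b, rfl⟩ := Ideal.mem_span_singleton.1 ha
      simp)
  refine ⟨AdjoinRoot (minpoly F t), inferInstance, inferInstance, this, φ,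
    AdjoinRoot.root (minpoly F t), ?_⟩
  change Polynomial.aeval t Polynomial.X = t
  simp

/-- The residue field of a central division algebra of dimension `w²` has degree `w` over that of
its center. Subfields generated by a lift of a generator of the residue field and by a uniformizer
bound both the residue degree and the ramification index by `w`. -/
theorem card_residueRing (w f : ℕ) (hw : Module.finrank F D = w ^ 2)
    (hf : Nat.card (residueRing p F) = p ^ f)
    {K : Type*} [Field K] (ι : residueRing p D →+* K) :
    Nat.card (residueRing p D) = p ^ (w * f) := by
  have hp := (Fact.out : p.Prime)
  obtain ⟨ϖ, hϖ⟩ := exists_isUniformizer p D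
  obtain ⟨e, g, he, hg, hpe, heg⟩ := hϖ.exists_ramification
  obtain ⟨ϖF, hϖF⟩ := exists_isUniformizer p F
  obtain ⟨eF, f', heF, hf', hpeF, hefF⟩ := hϖF.exists_ramification
  obtain rfl : f = f' := Nat.pow_right_injective hp.two_le (hf.symm.trans hf')
  have hFD : Module.finrank ℚ_[p] D = eF * f * w ^ 2 := by
    rw [hefF, ← hw, Module.finrank_mul_finrank]
  have key : ∀ t : D, ∃ (L : Type u) (_ : Field L) (_ : Algebra ℚ_[p] L)
      (_ : FiniteDimensional ℚ_[p] L) (φ : L →ₐ[ℚ_[p]] D) (ψ : F →ₐ[ℚ_[p]] L),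
      (∃ x, φ x = t) ∧ Module.finrank ℚ_[p] L ≤ eF * f * w := by
    intro t
    obtain ⟨L, _, _, _, φ, x, hx⟩ := exists_subfield F D t
    let _ : Algebra ℚ_[p] L := ((algebraMap F L).comp (algebraMap ℚ_[p] F)).toAlgebra
    have : IsScalarTower ℚ_[p] F L := IsScalarTower.of_algebraMap_eq fun _ => rfl
    have hfin : FiniteDimensional ℚ_[p] L := FiniteDimensional.trans ℚ_[p] F L
    refine ⟨L, inferInstance, inferInstance, hfin, φ.restrictScalars ℚ_[p],
      IsScalarTower.toAlgHom ℚ_[p] F L, ⟨x, hx⟩, ?_⟩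
    have hfree : Module.Free F L := Module.Free.of_divisionRing F L
    rw [← Module.finrank_mul_finrank ℚ_[p] F L, hefF]
    exact Nat.mul_le_mul_left _ (finrank_le_of_central hw L φ)
  -- the residue degree
  have hg1 : g ≤ w * f := by
    have := finite_residueRing (p := p) (D := D)
    have hcyc : IsCyclic (residueRing p D)ˣ :=
      isCyclic_of_injective_ringHom (R := K) (ι.toMonoidHom.comp (Units.coeHom _))
        ((residue_hom_injective p ι).comp Units.val_injective)
    obtain ⟨ζ, hζ⟩ := hcyc.exists_generator
    obtain ⟨t, ht⟩ := red_surjective p (ζ : residueRing p D)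
    obtain ⟨L, _, _, _, φ, ψ, ⟨x, hx⟩, hL⟩ := key t
    obtain ⟨ϖL, hϖL⟩ := exists_isUniformizer p L
    obtain ⟨eL, fL, heL, hfL, hpeL, hefL⟩ := hϖL.exists_ramification
    have h1 := ramification_le ψ hϖF hϖL hpeF hpeL
    have hx1 : x ∈ integers p L := (absNorm_algHom_le_one_iff φ x).1 (hx ▸ t.2)
    have hsurj : Function.Surjective (residueMap φ) := by
      intro y
      by_cases hy : y = 0
      · exact ⟨0, by rw [hy, map_zero]⟩
      obtain ⟨i, hi⟩ := mem_powers_iff_mem_zpowers.2 (hζ (isUnit_residue p hy).unit)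
      refine ⟨red p L ⟨x, hx1⟩ ^ i, ?_⟩
      rw [map_pow, residueMap_red φ _ t hx, ht]
      have := congrArg Units.val hi
      simpa using this
    have h2 : g = fL := Nat.pow_right_injective hp.two_le (hg.symm.trans
      ((Nat.card_eq_of_bijective _ ⟨residue_hom_injective p (residueMap φ), hsurj⟩).symm.trans hfL))
    rw [← hefL, ← h2] at hL
    have h3 : eF * g ≤ eF * (w * f) :=
      (Nat.mul_le_mul_right _ h1).trans (hL.trans_eq (by ring))
    exact Nat.le_of_mul_le_mul_left h3 heF
  -- the ramification index
  have he1 : e * f ≤ eF * f * w := by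
    obtain ⟨L, _, _, _, φ, ψ, ⟨x, hx⟩, hL⟩ := key ϖ
    obtain ⟨ϖL, hϖL⟩ := exists_isUniformizer p L
    obtain ⟨eL, fL, heL, hfL, hpeL, hefL⟩ := hϖL.exists_ramification
    have h1 := residueDegree_le ψ hf hfL
    obtain ⟨k, hk, h⟩ := absNorm_algHom φ
    have hx1 : absNorm p L x < 1 := (absNorm_algHom_lt_one_iff φ x).1 (hx ▸ hϖ.lt_one)
    have h2 : absNorm p L (ϖL : L) ^ eL ≤ absNorm p L (ϖL : L) ^ e := by
      have h3 : absNorm p L (p : L) = absNorm p L x ^ e := by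
        refine (pow_left_inj₀ (absNorm_nonneg p L _)
          (pow_nonneg (absNorm_nonneg p L _) _) hk).1 ?_
        rw [← h, map_natCast, hpe, ← hx, h, ← pow_mul, ← pow_mul, mul_comm]
      rw [← hpeL, h3]
      exact pow_le_pow_left₀ (absNorm_nonneg p L _) (hϖL.le_of_lt_one hx1) _
    have h3 := (pow_le_pow_iff_right_of_lt_one₀ (uniformizer_pos ϖL) hϖL.lt_one).1 h2
    rw [← hefL] at hL
    exact (Nat.mul_le_mul h3 h1).trans hL
  have hw0 : 0 < w := by
    have : 0 < Module.finrank F D := Module.finrank_pos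
    rw [hw] at this
    exact Nat.pos_of_ne_zero fun h => by simp [h] at this
  have hf0 : 0 < f := by
    refine Nat.pos_of_ne_zero fun h => ?_
    have : Finite (residueRing p F) := finite_residueRing
    have h1 := Finite.one_lt_card (α := residueRing p F)
    rw [hf, h, pow_zero] at h1
    exact lt_irrefl _ h1
  have hfin : g = w * f := by
    refine le_antisymm hg1 ?_
    have h1 : e ≤ eF * w := by
      refine Nat.le_of_mul_le_mul_right (he1.trans_eq ?_) hf0
      ring
    have h2 : (eF * w) * (w * f) ≤ (eF * w) * g := by
      calc (eF * w) * (w * f) = e * g := by rw [heg, hFD]; ring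
        _ ≤ _ := Nat.mul_le_mul_right _ h1
    exact Nat.le_of_mul_le_mul_left h2 (Nat.mul_pos heF hw0)
  rw [hg, hfin]

end ResidueCard

/-! ### Weights as spaces of polynomials -/

section WeightModel

open MvPolynomial

variable {p : ℕ} [Fact p.Prime] {m : ℕ}

theorem sum_digits_lt {i : Fin m → ℕ} (hi : ∀ j, i j ≤ p - 1) :
    ∑ j : Fin m, p ^ (j : ℕ) * i j < p ^ m := by
  have hp := (Fact.out : p.Prime).pos
  have h := (finFunctionFinEquiv fun j => (⟨i j, by have := hi j; omega⟩ : Fin p)).2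
  rw [finFunctionFinEquiv_apply] at h
  simpa [mul_comm] using h

theorem digit_sum_digits {i : Fin m → ℕ} (hi : ∀ j, i j ≤ p - 1) (l : Fin m) :
    (∑ j : Fin m, p ^ (j : ℕ) * i j) / p ^ (l : ℕ) % p = i l := by
  have hp := (Fact.out : p.Prime).pos
  let g : Fin m → Fin p := fun j => ⟨i j, by have := hi j; omega⟩
  have h := congrArg Fin.val (congrFun (finFunctionFinEquiv.symm_apply_apply g) l)
  change (finFunctionFinEquiv g : ℕ) / p ^ (l : ℕ) % p = i l at h
  rw [finFunctionFinEquiv_apply] at h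
  simpa [g, mul_comm] using h

/-- Lucas' theorem: the binomial coefficient is nonzero when the digits are dominated. -/
theorem choose_sum_digits_ne_zero {r i : Fin m → ℕ} (hr : ∀ j, r j ≤ p - 1)
    (hi : ∀ j, i j ≤ r j) :
    (((∑ j : Fin m, p ^ (j : ℕ) * r j).choose (∑ j : Fin m, p ^ (j : ℕ) * i j) : ℕ) : Coef p)
      ≠ 0 := by
  have hp := (Fact.out : p.Prime)
  have hi' : ∀ j, i j ≤ p - 1 := fun j => (hi j).trans (hr j)
  have h := Choose.choose_modEq_prod_range_choose_nat (sum_digits_lt hr) (sum_digits_lt hi')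
  rw [Ne, CharP.cast_eq_zero_iff (Coef p) p, h.dvd_iff dvd_rfl, ← Fin.prod_univ_eq_prod_range
    (fun j => Nat.choose (_ / p ^ j % p) (_ / p ^ j % p))]
  intro hd
  obtain ⟨j, -, hj⟩ := (hp.prime.dvd_finsetProd_iff _).1 hd
  rw [digit_sum_digits hr, digit_sum_digits hi'] at hj
  have h1 : p ∣ (r j).factorial := hj.trans
    ⟨(i j).factorial * (r j - i j).factorial, by
      rw [← mul_assoc, Nat.choose_mul_factorial_mul_factorial (hi j)]⟩
  have h2 := (hp.dvd_factorial).1 h1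
  have := hr j
  have := hp.pos
  omega

/-- Vandermonde: a subspace that contains the values of a polynomial curve at sufficiently many
points contains its coefficients. -/
theorem coeff_mem_of_forall_sum_mem {k M κ : Type*} [Field k] [AddCommGroup M] [Module k M]
    [Fintype κ] {e : κ → k} (he : Function.Injective e) {N : ℕ} (hN : N ≤ Fintype.card κ)
    (W : Submodule k M) (A : ℕ → M)
    (h : ∀ x, ∑ n ∈ Finset.range N, e x ^ n • A n ∈ W) {n : ℕ} (hn : n < N) : A n ∈ W := by
  by_contra hA
  obtain ⟨l, hl, hW⟩ := Submodule.exists_le_ker_of_notMem hA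
  let Q : Polynomial k := ∑ n ∈ Finset.range N, Polynomial.C (l (A n)) * Polynomial.X ^ n
  have hcoeff : ∀ n < N, Q.coeff n = l (A n) := by
    intro n hn
    simp [Q, Polynomial.finsetSum_coeff, Polynomial.coeff_C_mul, Polynomial.coeff_X_pow, hn]
  have hQ : Q = 0 := by
    refine Polynomial.eq_zero_of_natDegree_lt_card_of_eval_eq_zero Q he (fun x => ?_) ?_
    · have h1 : l (∑ n ∈ Finset.range N, e x ^ n • A n) = 0 := hW (h x)
      rw [map_sum] at h1
      rw [Polynomial.eval_finsetSum, ← h1]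
      exact Finset.sum_congr rfl fun n _ => by
        rw [map_smul, Polynomial.eval_mul, Polynomial.eval_C, Polynomial.eval_pow,
          Polynomial.eval_X, smul_eq_mul, mul_comm]
    · have h1 : Q.natDegree ≤ N - 1 := Polynomial.natDegree_sum_le_of_forall_le _ _ fun i hi =>
        (Polynomial.natDegree_C_mul_X_pow_le _ _).trans
          (Nat.le_sub_one_of_lt (Finset.mem_range.1 hi))
      omega
  rw [← hcoeff n hn, hQ, Polynomial.coeff_zero] at hl
  exact hl rfl

variable (p m) in
/-- The evaluation `x_j ↦ a^{p^j}`, `y_j ↦ c^{p^j}` in a `Coef p`-algebra. -/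
def evalPair {A : Type*} [CommRing A] [Algebra (Coef p) A] (a c : A) :
    MvPolynomial (Fin m × Fin 2) (Coef p) →ₐ[Coef p] A :=
  aeval fun v => if v.2 = 0 then a ^ p ^ (v.1 : ℕ) else c ^ p ^ (v.1 : ℕ)

theorem evalPair_X_zero {A : Type*} [CommRing A] [Algebra (Coef p) A] (a c : A) (j : Fin m) :
    evalPair p m a c (X (j, 0)) = a ^ p ^ (j : ℕ) := by
  simp [evalPair]

theorem evalPair_X_one {A : Type*} [CommRing A] [Algebra (Coef p) A] (a c : A) (j : Fin m) :
    evalPair p m a c (X (j, 1)) = c ^ p ^ (j : ℕ) := by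
  simp [evalPair]

theorem evalPair_subst {A : Type*} [CommRing A] [Algebra (Coef p) A] [CharP A p] (a c : A)
    (B : Matrix (Fin 2) (Fin 2) (Coef p)) (P : MvPolynomial (Fin m × Fin 2) (Coef p)) :
    evalPair p m a c (subst p m B P) =
      evalPair p m (a * algebraMap _ A (B 0 0) + c * algebraMap _ A (B 1 0))
        (a * algebraMap _ A (B 0 1) + c * algebraMap _ A (B 1 1)) P := by
  have hX : ∀ v, evalPair p m a c (subst p m B (X v)) =
      evalPair p m (a * algebraMap _ A (B 0 0) + c * algebraMap _ A (B 1 0))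
        (a * algebraMap _ A (B 0 1) + c * algebraMap _ A (B 1 1)) (X v) := by
    rintro ⟨j, i⟩
    have h0 : ∀ b : Coef p, evalPair p m a c (C b) = algebraMap _ A b := fun b =>
      (evalPair p m a c).commutes b
    simp only [subst, aeval_X, map_add, map_mul, evalPair_X_zero, evalPair_X_one, h0]
    fin_cases i
    · simp only [Fin.zero_eta, evalPair_X_zero, add_pow_char_pow, mul_pow, map_pow]; ring
    · simp only [Fin.mk_one, evalPair_X_one, add_pow_char_pow, mul_pow, map_pow]; ring
  have : (evalPair p m a c).comp (subst p m B) = evalPair p m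
      (a * algebraMap _ A (B 0 0) + c * algebraMap _ A (B 1 0))
        (a * algebraMap _ A (B 0 1) + c * algebraMap _ A (B 1 1)) :=
    MvPolynomial.algHom_ext hX
  exact DFunLike.congr_fun this P

theorem evalPair_monomial {A : Type*} [CommRing A] [Algebra (Coef p) A] (a c : A)
    (d : Fin m × Fin 2 →₀ ℕ) (b : Coef p) :
    evalPair p m a c (monomial d b) = algebraMap _ A b *
      (a ^ (∑ j : Fin m, p ^ (j : ℕ) * d (j, 0)) * c ^ (∑ j : Fin m, p ^ (j : ℕ) * d (j, 1))) := by
  rw [evalPair, aeval_monomial, Finsupp.prod_fintype _ _ (fun _ => pow_zero _),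
    Fintype.prod_prod_type]
  simp only [Fin.prod_univ_two, if_true, one_ne_zero, if_false, Finset.prod_mul_distrib,
    ← pow_mul, Finset.prod_pow_eq_pow_sum]

theorem degree_of_mem_Wt {r : Fin m → ℕ} {P : MvPolynomial (Fin m × Fin 2) (Coef p)}
    (hP : P ∈ Wt p r) {d : Fin m × Fin 2 →₀ ℕ} (hd : d ∈ P.support) (j : Fin m) :
    d (j, 0) + d (j, 1) = r j := by
  have h := congrFun (hP (mem_support_iff.1 hd)) j
  rw [Finsupp.weight_apply, Finsupp.sum_fintype _ _ (by intro; exact zero_smul _ _),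
    Finset.sum_apply, Fintype.sum_prod_type] at h
  simp only [Fin.sum_univ_two, Pi.smul_apply, Pi.single_apply, smul_eq_mul, mul_ite, mul_one,
    mul_zero] at h
  rw [← h, Finset.sum_eq_single j (fun b _ hb => by simp [hb.symm]) (by simp)]
  simp

/-- The weight is homogeneous of degree `r = ∑ p^j r_j` for `x_j ↦ a^{p^j}`, `y_j ↦ c^{p^j}`. -/
theorem evalPair_smul {A : Type*} [CommRing A] [Algebra (Coef p) A] (a c s : A)
    {r : Fin m → ℕ} {P : MvPolynomial (Fin m × Fin 2) (Coef p)} (hP : P ∈ Wt p r) :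
    evalPair p m (s * a) (s * c) P =
      s ^ (∑ j : Fin m, p ^ (j : ℕ) * r j) * evalPair p m a c P := by
  rw [P.as_sum, map_sum, map_sum, Finset.mul_sum]
  refine Finset.sum_congr rfl fun d hd => ?_
  rw [evalPair_monomial, evalPair_monomial]
  have h : ∑ j : Fin m, p ^ (j : ℕ) * r j = (∑ j : Fin m, p ^ (j : ℕ) * d (j, 0)) +
      ∑ j : Fin m, p ^ (j : ℕ) * d (j, 1) := by
    rw [← Finset.sum_add_distrib]
    exact Finset.sum_congr rfl fun j _ => by rw [← mul_add, degree_of_mem_Wt hP hd]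
  rw [h, pow_add, mul_pow, mul_pow]
  ring

variable (p) in
/-- The dehomogenization `x_j ↦ 1`, `y_j ↦ T^{p^j}` of a weight. -/
def dehom (r : Fin m → ℕ) : Wt p r →ₗ[Coef p] Polynomial (Coef p) :=
  (evalPair p m (1 : Polynomial (Coef p)) Polynomial.X).toLinearMap.comp (Wt p r).subtype

theorem dehom_apply {r : Fin m → ℕ} (P : Wt p r) :
    dehom p r P = ∑ d ∈ P.1.support, Polynomial.C (P.1.coeff d) *
      Polynomial.X ^ (∑ j : Fin m, p ^ (j : ℕ) * d (j, 1)) := by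
  change evalPair p m (1 : Polynomial (Coef p)) Polynomial.X P.1 = _
  conv_lhs => rw [P.1.as_sum, map_sum]
  refine Finset.sum_congr rfl fun d _ => ?_
  rw [evalPair_monomial, one_pow, one_mul]
  rfl

variable {r : Fin m → ℕ}

theorem natDegree_dehom_le (P : Wt p r) :
    (dehom p r P).natDegree ≤ ∑ j : Fin m, p ^ (j : ℕ) * r j := by
  rw [dehom_apply]
  refine Polynomial.natDegree_sum_le_of_forall_le _ _ fun d hd => ?_
  refine (Polynomial.natDegree_C_mul_X_pow_le _ _).trans (Finset.sum_le_sum fun j _ => ?_)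
  refine Nat.mul_le_mul_left _ ?_
  rw [← degree_of_mem_Wt P.2 hd j]
  exact Nat.le_add_left _ _

theorem dehom_highest : dehom p r (highest p r) = 1 := by
  change evalPair p m (1 : Polynomial (Coef p)) Polynomial.X (∏ j, X (j, 0) ^ r j) = 1
  rw [map_prod]
  exact Finset.prod_eq_one fun j _ => by rw [map_pow, evalPair_X_zero, one_pow, one_pow]

theorem evalPair_highest {A : Type*} [CommRing A] [Algebra (Coef p) A] (a c : A) :
    evalPair p m a c (highest p r).1 = a ^ (∑ j : Fin m, p ^ (j : ℕ) * r j) := by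
  change evalPair p m a c (∏ j, X (j, 0) ^ r j) = _
  rw [map_prod, ← Finset.prod_pow_eq_pow_sum]
  exact Finset.prod_congr rfl fun j _ => by rw [map_pow, evalPair_X_zero, pow_mul]

theorem highest_ne_zero : highest p r ≠ 0 := fun h => by
  have := dehom_highest (p := p) (r := r)
  rw [h, map_zero] at this
  exact zero_ne_one this

variable (hr : ∀ j, r j ≤ p - 1)
include hr

/-- The exponents `∑ p^j i_j` of different monomials are different by the uniqueness of base `p`
expansions. -/
theorem dehom_injective : Function.Injective (dehom p r) := by
  refine (injective_iff_map_eq_zero _).2 fun P hP => Subtype.ext ?_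
  rw [dehom_apply] at hP
  refine MvPolynomial.ext _ _ fun d => ?_
  rw [Submodule.coe_zero, coeff_zero]
  by_contra hd
  have hd' : d ∈ P.1.support := mem_support_iff.2 hd
  have h := congrArg (fun Q => Polynomial.coeff Q (∑ j : Fin m, p ^ (j : ℕ) * d (j, 1))) hP
  simp only [Polynomial.finsetSum_coeff, Polynomial.coeff_zero, Polynomial.coeff_C_mul,
    Polynomial.coeff_X_pow] at h
  rw [Finset.sum_eq_single d] at h
  · simp only [if_true, mul_one] at h
    exact hd h
  · intro d' hd1 hne
    rw [if_neg, mul_zero]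
    intro he
    refine hne ?_
    have hle : ∀ d ∈ P.1.support, ∀ j, d (j, 1) ≤ p - 1 := fun d hd j =>
      ((degree_of_mem_Wt P.2 hd j) ▸ Nat.le_add_left _ _ : d (j, 1) ≤ r j).trans (hr j)
    have h1 : ∀ j, d' (j, 1) = d (j, 1) := fun j => by
      rw [← digit_sum_digits (hle d' hd1) j, ← he, digit_sum_digits (hle d hd') j]
    ext ⟨j, i⟩
    fin_cases i
    · have e1 := degree_of_mem_Wt P.2 hd1 j
      have e2 := degree_of_mem_Wt P.2 hd' j
      have := h1 j
      change d' (j, 0) = d (j, 0)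
      omega
    · exact h1 j
  · exact fun h => absurd hd' h

theorem finite_Wt : FiniteDimensional (Coef p) (Wt p r) ∧
    Module.finrank (Coef p) (Wt p r) ≤ p ^ m := by
  let g : Wt p r →ₗ[Coef p] Polynomial.degreeLT (Coef p) (p ^ m) :=
    (dehom p r).codRestrict _ fun P => by
      rw [Polynomial.mem_degreeLT]
      refine Polynomial.degree_le_natDegree.trans_lt ?_
      exact_mod_cast (natDegree_dehom_le P).trans_lt (sum_digits_lt hr)
  have hg : Function.Injective g := fun P Q h =>
    dehom_injective hr (congrArg Subtype.val h)
  let e := Polynomial.degreeLTEquiv (Coef p) (p ^ m)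
  have hfin : FiniteDimensional (Coef p) (Polynomial.degreeLT (Coef p) (p ^ m)) :=
    Module.Finite.equiv e.symm
  refine ⟨Module.Finite.of_injective g hg, (LinearMap.finrank_le_finrank_of_injective hg).trans ?_⟩
  rw [e.finrank_eq, Module.finrank_fin_fun]

theorem eq_smul_highest_of_dehom_eq_C {P : Wt p r} {c : Coef p}
    (h : dehom p r P = Polynomial.C c) : P = c • highest p r := by
  refine dehom_injective hr ?_
  rw [h, map_smul, dehom_highest, Polynomial.smul_eq_C_mul, mul_one]

theorem eq_smul_highest_of_sum_eq_zero (h0 : ∑ j : Fin m, p ^ (j : ℕ) * r j = 0) (P : Wt p r) :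
    ∃ c : Coef p, P = c • highest p r := by
  refine ⟨_, eq_smul_highest_of_dehom_eq_C hr (Polynomial.eq_C_of_natDegree_le_zero ?_)⟩
  exact h0 ▸ natDegree_dehom_le P

omit hr in
theorem dehom_upper (b : Coef p) (P : Wt p r) :
    dehom p r (wtAction p r !![1, b; 0, 1] P) =
      (dehom p r P).comp (Polynomial.X + Polynomial.C b) := by
  change evalPair p m (1 : Polynomial (Coef p)) Polynomial.X (subst p m _ P.1) = _
  rw [evalPair_subst, dehom_apply]
  conv_lhs => rw [P.1.as_sum, map_sum]
  rw [← Polynomial.coe_compRingHom_apply, map_sum]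
  refine Finset.sum_congr rfl fun d _ => ?_
  rw [evalPair_monomial]
  simp [Polynomial.algebraMap_eq, Polynomial.coe_compRingHom_apply, add_comm]

variable {κ : Type*} [Fintype κ] {e : κ → Coef p} (he : Function.Injective e)
  (hκ : Fintype.card κ = p ^ m)
include he hκ

/-- The vectors fixed by the upper triangular unipotent matrices are the multiples of
`⊗ x_j^{r_j}`: the dehomogenization of such a vector takes its value at `0` at `p^m` points, more
than its degree. -/
theorem eq_smul_highest_of_fixed {P : Wt p r}
    (h : ∀ x, wtAction p r !![1, e x; 0, 1] P = P) : ∃ c : Coef p, P = c • highest p r := by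
  refine ⟨(dehom p r P).eval 0, eq_smul_highest_of_dehom_eq_C hr ?_⟩
  rw [← sub_eq_zero]
  refine Polynomial.eq_zero_of_natDegree_lt_card_of_eval_eq_zero _ he (fun x => ?_) ?_
  · have h1 := congrArg (Polynomial.eval 0) (dehom_upper (e x) P)
    rw [h x] at h1
    simp only [Polynomial.eval_comp, Polynomial.eval_add, Polynomial.eval_X, Polynomial.eval_C,
      zero_add] at h1
    rw [Polynomial.eval_sub, Polynomial.eval_C, ← h1, sub_self]
  · rw [Polynomial.natDegree_sub_C, hκ]
    exact (natDegree_dehom_le P).trans_lt (sum_digits_lt hr)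

/-- A subspace containing all lower triangular unipotent translates of `⊗ x_j^{r_j}` is
everything: the dehomogenizations of the translates are the powers `(1 + e(x) T)^r`, which
span the monomials `T^n` whose binomial coefficient `r.choose n` is nonzero. -/
theorem eq_top_of_lower_mem {W : Submodule (Coef p) (Wt p r)}
    (h : ∀ x, wtAction p r !![1, 0; e x, 1] (highest p r) ∈ W) : W = ⊤ := by
  set R := ∑ j : Fin m, p ^ (j : ℕ) * r j
  have hT : ∀ n < R + 1, (R.choose n : Coef p) • (Polynomial.X ^ n : Polynomial (Coef p)) ∈
      W.map (dehom p r) := by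
    intro n hn
    refine coeff_mem_of_forall_sum_mem he (N := R + 1) (hκ ▸ sum_digits_lt hr) _
      (fun n => (R.choose n : Coef p) • (Polynomial.X ^ n : Polynomial (Coef p))) (fun x => ?_) hn
    refine ⟨_, h x, ?_⟩
    change evalPair p m (1 : Polynomial (Coef p)) Polynomial.X (subst p m _ (highest p r).1) = _
    rw [evalPair_subst, evalPair_highest]
    simp only [Matrix.of_apply, Matrix.cons_val', Matrix.cons_val_zero, Matrix.cons_val_one,
      Matrix.cons_val_fin_one, map_one, mul_one, Polynomial.algebraMap_eq]
    rw [add_comm, add_pow]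
    refine Finset.sum_congr rfl fun n _ => ?_
    rw [one_pow, mul_one, mul_pow, ← Polynomial.C_pow, Polynomial.smul_eq_C_mul,
      Polynomial.smul_eq_C_mul, Polynomial.C_eq_natCast]
    ring
  refine eq_top_iff.2 fun P _ => ?_
  have hP : dehom p r P ∈ W.map (dehom p r) := by
    rw [dehom_apply]
    refine sum_mem fun d hd => ?_
    have hle : ∀ j, d (j, 1) ≤ r j := fun j =>
      (degree_of_mem_Wt P.2 hd j) ▸ Nat.le_add_left _ _
    have hne := choose_sum_digits_ne_zero hr hle
    have h1 := hT (∑ j : Fin m, p ^ (j : ℕ) * d (j, 1))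
      (Nat.lt_succ_of_le (Finset.sum_le_sum fun j _ => Nat.mul_le_mul_left _ (hle j)))
    have h2 := Submodule.smul_mem _ (P.1.coeff d) (((Submodule.smul_mem_iff _ hne).1 h1))
    rwa [Polynomial.smul_eq_C_mul] at h2
  obtain ⟨Q, hQ, hQP⟩ := hP
  exact dehom_injective hr hQP ▸ hQ

/-- A nonzero subspace stable under the upper triangular unipotent matrices contains
`⊗ x_j^{r_j}`: the translates of a polynomial span its Hasse derivatives, the last of which is a
nonzero constant. -/
theorem highest_mem_of_upper_stable {W : Submodule (Coef p) (Wt p r)} (hW : W ≠ ⊥)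
    (h : ∀ x, ∀ P ∈ W, wtAction p r !![1, e x; 0, 1] P ∈ W) : highest p r ∈ W := by
  obtain ⟨P, hP, hP0⟩ := Submodule.exists_mem_ne_zero_of_ne_bot hW
  set Q := dehom p r P
  have hQ0 : Q ≠ 0 := fun h0 => hP0 (dehom_injective hr (h0.trans (map_zero _).symm))
  have hd : Q.natDegree + 1 ≤ p ^ m := (natDegree_dehom_le P).trans_lt (sum_digits_lt hr)
  have h1 : Polynomial.hasseDeriv Q.natDegree Q ∈ W.map (dehom p r) := by
    refine coeff_mem_of_forall_sum_mem he (hκ ▸ hd) _ (fun n => Polynomial.hasseDeriv n Q)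
      (fun x => Submodule.mem_map.2 ⟨_, h x P hP, ?_⟩) (Nat.lt_succ_self _)
    rw [dehom_upper, ← Polynomial.taylor_apply]
    ext n
    rw [Polynomial.taylor_coeff, Polynomial.eval_eq_sum_range' (n := Q.natDegree + 1),
      Polynomial.finsetSum_coeff]
    · refine Finset.sum_congr rfl fun i _ => ?_
      rw [Polynomial.coeff_smul, Polynomial.hasseDeriv_coeff, Polynomial.hasseDeriv_coeff,
        smul_eq_mul, add_comm i n, mul_comm, ← Nat.choose_symm_add]
    · exact Nat.lt_succ_of_le ((Polynomial.natDegree_hasseDeriv_le _ _).trans (Nat.sub_le _ _))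
  rw [Polynomial.hasseDeriv_natDegree_eq_C, Submodule.mem_map] at h1
  obtain ⟨P', hP', he'⟩ := h1
  have h2 := eq_smul_highest_of_dehom_eq_C hr he'
  rw [h2, Submodule.smul_mem_iff _ (Polynomial.leadingCoeff_ne_zero.2 hQ0)] at hP'
  exact hP'

/-- A functional that is invariant under the upper triangular unipotent matrices and kills
`⊗ y_j^{r_j}` is zero. -/
theorem functional_eq_zero {l : Wt p r →ₗ[Coef p] Coef p}
    (hl : ∀ x P, l (wtAction p r !![1, e x; 0, 1] P) = l P)
    (h0 : l (wtAction p r !![0, 1; 1, 0] (highest p r)) = 0) : l = 0 := by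
  have hw : ∀ P, wtAction p r !![0, 1; 1, 0] (wtAction p r !![0, 1; 1, 0] P) = P := fun P => by
    rw [← Module.End.mul_apply, ← map_mul]
    simp [← Matrix.one_fin_two]
  have h1 : LinearMap.ker (l.comp (wtAction p r !![0, 1; 1, 0])) = ⊤ := by
    refine eq_top_of_lower_mem hr he hκ fun x => ?_
    refine Eq.trans ?_ h0
    have hm : (!![0, 1; 1, 0] : Matrix (Fin 2) (Fin 2) (Coef p)) * !![1, 0; e x, 1] =
        !![1, e x; 0, 1] * !![0, 1; 1, 0] := by simp
    rw [LinearMap.comp_apply, ← Module.End.mul_apply, ← map_mul (wtAction p r), hm, map_mul,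
      Module.End.mul_apply, hl]
  refine LinearMap.ext fun P => ?_
  have h2 : wtAction p r !![0, 1; 1, 0] P ∈ LinearMap.ker (l.comp (wtAction p r !![0, 1; 1, 0])) :=
    h1 ▸ Submodule.mem_top
  rw [LinearMap.mem_ker, LinearMap.comp_apply, hw] at h2
  exact h2

end WeightModel

/-! ### Subgroups of `GL₂(D)` -/

section Matrices

variable {p : ℕ} [Fact p.Prime]
variable {D : Type*} [DivisionRing D] [Algebra ℚ_[p] D] [FiniteDimensional ℚ_[p] D]

theorem GL2_ext {R : Type*} [Ring R] {g h : GL (Fin 2) R} (h00 : g.1 0 0 = h.1 0 0)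
    (h01 : g.1 0 1 = h.1 0 1) (h10 : g.1 1 0 = h.1 1 0) (h11 : g.1 1 1 = h.1 1 1) : g = h := by
  refine Units.ext (Matrix.ext fun i j => ?_)
  fin_cases i <;> fin_cases j <;> assumption

theorem GL2_mul_apply {R : Type*} [Ring R] (g h : GL (Fin 2) R) (i j : Fin 2) :
    (g * h).1 i j = g.1 i 0 * h.1 0 j + g.1 i 1 * h.1 1 j := by
  rw [Units.val_mul, Matrix.mul_apply, Fin.sum_univ_two]

theorem affineUnit_val (a : Dˣ) (b : D) : (affineUnit a b).1 = !![(a : D), b; 0, 1] := rfl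

theorem affineUnit_inv_val (a : Dˣ) (b : D) : ((affineUnit a b)⁻¹).1 =
    !![((a⁻¹ : Dˣ) : D), -(((a⁻¹ : Dˣ) : D) * b); 0, 1] := rfl

theorem betaUnit_val (ϖ : Dˣ) : (betaUnit ϖ).1 = !![0, 1; (ϖ : D), 0] := rfl

theorem betaUnit_inv_val (ϖ : Dˣ) :
    ((betaUnit ϖ)⁻¹).1 = !![0, ((ϖ⁻¹ : Dˣ) : D); 1, 0] := rfl

theorem scalarUnit_val (ϖ : Dˣ) : (scalarUnit ϖ).1 = !![(ϖ : D), 0; 0, (ϖ : D)] := rfl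

theorem scalarUnit_inv_val (ϖ : Dˣ) :
    ((scalarUnit ϖ)⁻¹).1 = !![((ϖ⁻¹ : Dˣ) : D), 0; 0, ((ϖ⁻¹ : Dˣ) : D)] := rfl

/-- The matrix `(a 0; c d)`. -/
def lowerUnit (a : Dˣ) (c : D) (d : Dˣ) : GL (Fin 2) D where
  val := !![(a : D), 0; c, (d : D)]
  inv := !![((a⁻¹ : Dˣ) : D), 0; -(((d⁻¹ : Dˣ) : D) * c * ((a⁻¹ : Dˣ) : D)), ((d⁻¹ : Dˣ) : D)]
  val_inv := by simp [Matrix.one_fin_two, ← mul_assoc]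
  inv_val := by simp [Matrix.one_fin_two, mul_assoc]

theorem lowerUnit_val (a : Dˣ) (c : D) (d : Dˣ) :
    (lowerUnit a c d).1 = !![(a : D), 0; c, (d : D)] := rfl

theorem lowerUnit_inv_val (a : Dˣ) (c : D) (d : Dˣ) : ((lowerUnit a c d)⁻¹).1 =
    !![((a⁻¹ : Dˣ) : D), 0; -(((d⁻¹ : Dˣ) : D) * c * ((a⁻¹ : Dˣ) : D)), ((d⁻¹ : Dˣ) : D)] := rfl

/-- The matrix `(x 1; 1 0)`. -/
def weylUnit (x : D) : GL (Fin 2) D where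
  val := !![x, 1; 1, 0]
  inv := !![0, 1; 1, -x]
  val_inv := by simp [Matrix.one_fin_two]
  inv_val := by simp [Matrix.one_fin_two]

theorem weylUnit_val (x : D) : (weylUnit x).1 = !![x, 1; 1, 0] := rfl

theorem weylUnit_inv_val (x : D) : ((weylUnit x)⁻¹).1 = !![0, 1; 1, -x] := rfl

theorem scalarUnit_mul (a b : Dˣ) : scalarUnit (a * b) = scalarUnit a * scalarUnit b := by
  apply GL2_ext <;> simp [GL2_mul_apply, scalarUnit_val]

/-- The scalar matrices as a homomorphism. -/
def scalarHom : Dˣ →* GL (Fin 2) D where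
  toFun := scalarUnit
  map_one' := by apply GL2_ext <;> simp [scalarUnit_val]
  map_mul' := scalarUnit_mul

theorem scalarUnit_zpow (a : Dˣ) (j : ℤ) : scalarUnit a ^ j = scalarUnit (a ^ j) :=
  (map_zpow scalarHom a j).symm

end Matrices

section Scaled

variable {p : ℕ} [Fact p.Prime]
variable {D : Type*} [DivisionRing D] [Algebra ℚ_[p] D] [FiniteDimensional ℚ_[p] D]

variable (p) in
/-- The matrix `g` is `ϖ^j` times an element of `GL₂(𝒪_D)`. -/
def IsScaled (ϖ : Dˣ) (j : ℤ) (g : GL (Fin 2) D) : Prop :=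
  (∀ i k, absNorm p D (g.1 i k) ≤ absNorm p D (ϖ : D) ^ j) ∧
    ∀ i k, absNorm p D ((g⁻¹).1 i k) ≤ absNorm p D (ϖ : D) ^ (-j)

variable {ϖ : Dˣ} {j l : ℤ} {g h : GL (Fin 2) D}

theorem IsScaled.inv (hg : IsScaled p ϖ j g) : IsScaled p ϖ (-j) g⁻¹ :=
  ⟨hg.2, by rw [inv_inv, neg_neg]; exact hg.1⟩

theorem absNorm_val_zpow (ϖ : Dˣ) (j : ℤ) :
    absNorm p D ((ϖ ^ j : Dˣ) : D) = absNorm p D (ϖ : D) ^ j := by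
  rw [Units.val_zpow_eq_zpow_val, absNorm_zpow]

theorem absNorm_val_inv (a : Dˣ) : absNorm p D ((a⁻¹ : Dˣ) : D) = (absNorm p D (a : D))⁻¹ := by
  rw [Units.val_inv_eq_inv_val, absNorm_inv]

theorem absNorm_mul_le {x y : D} {j l : ℤ} (hx : absNorm p D x ≤ absNorm p D (ϖ : D) ^ j)
    (hy : absNorm p D y ≤ absNorm p D (ϖ : D) ^ l) :
    absNorm p D (x * y) ≤ absNorm p D (ϖ : D) ^ (j + l) := by
  rw [map_mul, zpow_add₀ (uniformizer_pos ϖ).ne']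
  exact mul_le_mul hx hy (absNorm_nonneg p D _) (zpow_nonneg (absNorm_nonneg p D _) _)

theorem IsScaled.mul (hg : IsScaled p ϖ j g) (hh : IsScaled p ϖ l h) :
    IsScaled p ϖ (j + l) (g * h) := by
  refine ⟨fun i k => ?_, fun i k => ?_⟩
  · rw [GL2_mul_apply]
    exact absNorm_add_le_of_le p (absNorm_mul_le (hg.1 _ _) (hh.1 _ _))
      (absNorm_mul_le (hg.1 _ _) (hh.1 _ _))
  · rw [mul_inv_rev, GL2_mul_apply, neg_add_rev]
    exact absNorm_add_le_of_le p (absNorm_mul_le (hh.2 _ _) (hg.2 _ _))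
      (absNorm_mul_le (hh.2 _ _) (hg.2 _ _))

theorem isScaled_incl (ϖ : Dˣ) (k : GL (Fin 2) (integers p D)) : IsScaled p ϖ 0 (incl p D k) := by
  refine ⟨fun i j => ?_, fun i j => ?_⟩
  · rw [zpow_zero]; exact (k.1 i j).2
  · rw [neg_zero, zpow_zero, ← map_inv]; exact ((k⁻¹).1 i j).2

theorem IsScaled.exists_incl (hg : IsScaled p ϖ 0 g) : ∃ k, incl p D k = g := by
  have h1 : ∀ i j, absNorm p D (g.1 i j) ≤ 1 := by simpa using hg.1
  have h2 : ∀ i j, absNorm p D ((g⁻¹).1 i j) ≤ 1 := by simpa using hg.2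
  have hinj : Function.Injective ((integers p D).subtype.mapMatrix (m := Fin 2)) :=
    fun A B hAB => Matrix.ext fun i j => Subtype.ext (congrFun (congrFun hAB i) j)
  let A : Matrix (Fin 2) (Fin 2) (integers p D) := Matrix.of fun i j => ⟨g.1 i j, h1 i j⟩
  let B : Matrix (Fin 2) (Fin 2) (integers p D) := Matrix.of fun i j => ⟨(g⁻¹).1 i j, h2 i j⟩
  have hA : (integers p D).subtype.mapMatrix A = g.1 := rfl
  have hB : (integers p D).subtype.mapMatrix B = (g⁻¹).1 := rfl
  refine ⟨⟨A, B, hinj ?_, hinj ?_⟩, Units.ext rfl⟩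
  · rw [map_mul, hA, hB, map_one]; exact g.mul_inv
  · rw [map_mul, hA, hB, map_one]; exact g.inv_mul

theorem mem_maxCompact_iff : g ∈ maxCompact p D ↔ IsScaled p ϖ 0 g :=
  ⟨by rintro ⟨k, rfl⟩; exact isScaled_incl ϖ k, fun h => h.exists_incl⟩

theorem isScaled_scalarUnit (ϖ : Dˣ) (j : ℤ) : IsScaled p ϖ j (scalarUnit (ϖ ^ j)) := by
  have hpos := uniformizer_pos (p := p) ϖ
  refine ⟨fun i k => ?_, fun i k => ?_⟩
  · rw [scalarUnit_val]
    fin_cases i <;> fin_cases k <;>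
      simp [absNorm_zero, absNorm_zpow, (zpow_pos hpos j).le]
  · rw [scalarUnit_inv_val, ← _root_.zpow_neg]
    fin_cases i <;> fin_cases k <;>
      simp [absNorm_zero, absNorm_inv, absNorm_zpow, (zpow_pos hpos j).le]

/-- A lower triangular matrix is `ϖ^j` times an integral one as soon as its diagonal entries have
the norm of `ϖ^j` and the entry below the diagonal is not larger. -/
theorem isScaled_of_lower (h01 : g.1 0 1 = 0)
    (h00 : absNorm p D (g.1 0 0) = absNorm p D (ϖ : D) ^ j)
    (h11 : absNorm p D (g.1 1 1) = absNorm p D (ϖ : D) ^ j)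
    (h10 : absNorm p D (g.1 1 0) ≤ absNorm p D (ϖ : D) ^ j) : IsScaled p ϖ j g := by
  have hpos := zpow_pos (uniformizer_pos (p := p) ϖ) j
  have hne : ∀ x : D, absNorm p D x = absNorm p D (ϖ : D) ^ j → x ≠ 0 := fun x hx h => by
    rw [h, absNorm_zero] at hx; exact hpos.ne hx
  obtain ⟨a, c, d, rfl⟩ : ∃ (a : Dˣ) (c : D) (d : Dˣ), g = lowerUnit a c d :=
    ⟨Units.mk0 _ (hne _ h00), g.1 1 0, Units.mk0 _ (hne _ h11), by
      apply GL2_ext <;> simp [lowerUnit_val, h01]⟩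
  simp only [lowerUnit_val, Matrix.of_apply, Matrix.cons_val', Matrix.cons_val_zero,
    Matrix.cons_val_one, Matrix.cons_val_fin_one] at h00 h11 h10
  refine ⟨fun i k => ?_, fun i k => ?_⟩
  · rw [lowerUnit_val]
    fin_cases i <;> fin_cases k
    · exact h00.le
    · simpa [absNorm_zero] using hpos.le
    · exact h10
    · exact h11.le
  · rw [lowerUnit_inv_val, _root_.zpow_neg]
    fin_cases i <;> fin_cases k
    · exact ((absNorm_val_inv a).trans (congrArg _ h00)).le
    · simpa [absNorm_zero] using hpos.le
    · change absNorm p D (-(_ * _ * _)) ≤ _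
      rw [absNorm_neg, map_mul, map_mul, absNorm_val_inv, absNorm_val_inv, h00, h11]
      refine mul_le_of_le_one_left (inv_nonneg.2 hpos.le) ?_
      rw [inv_mul_le_iff₀ hpos, mul_one]; exact h10
    · exact ((absNorm_val_inv d).trans (congrArg _ h11)).le

theorem isScaled_weylUnit (ϖ : Dˣ) {x : D} (hx : absNorm p D x ≤ 1) :
    IsScaled p ϖ 0 (weylUnit x) := by
  refine ⟨fun i k => ?_, fun i k => ?_⟩
  · rw [weylUnit_val, zpow_zero]
    fin_cases i <;> fin_cases k <;> simp [absNorm_zero, hx]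
  · rw [weylUnit_inv_val, neg_zero, zpow_zero]
    fin_cases i <;> fin_cases k <;> simp [absNorm_zero, absNorm_neg, hx]

theorem isScaled_upper (ϖ : Dˣ) {x : D} (hx : absNorm p D x ≤ 1) :
    IsScaled p ϖ 0 (affineUnit 1 x) := by
  refine ⟨fun i k => ?_, fun i k => ?_⟩
  · rw [affineUnit_val, zpow_zero]
    fin_cases i <;> fin_cases k <;> simp [absNorm_zero, hx]
  · rw [affineUnit_inv_val, neg_zero, zpow_zero]
    fin_cases i <;> fin_cases k <;> simp [absNorm_zero, absNorm_neg, hx]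

/-- A central matrix is scalar. -/
theorem center_entries {z : GL (Fin 2) D} (hz : z ∈ Subgroup.center (GL (Fin 2) D)) :
    z.1 0 1 = 0 ∧ z.1 1 0 = 0 ∧ z.1 0 0 = z.1 1 1 := by
  have h1 := congrArg Units.val (Subgroup.mem_center_iff.1 hz (weylUnit 0))
  have h2 := congrArg Units.val (Subgroup.mem_center_iff.1 hz (affineUnit 1 1))
  have e1 := congrFun (congrFun h1 0) 0
  have e2 := congrFun (congrFun h1 0) 1
  have e3 := congrFun (congrFun h2 0) 0
  rw [GL2_mul_apply, GL2_mul_apply] at e1 e2 e3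
  simp [weylUnit_val, affineUnit_val] at e1 e2 e3
  exact ⟨e1 ▸ e3, e3, e2.symm⟩

section KZZ

variable (hϖ : IsUniformizer p ϖ)
include hϖ

theorem isScaled_of_center {z : GL (Fin 2) D} (hz : z ∈ Subgroup.center (GL (Fin 2) D)) :
    ∃ j, IsScaled p ϖ j z := by
  obtain ⟨h01, h10, h00⟩ := center_entries hz
  have h : z.1 0 0 ≠ 0 := fun h => by
    have := congrFun (congrFun z.mul_inv 0) 0
    simp [Matrix.mul_apply, h, h01] at this
  obtain ⟨j, hj⟩ := hϖ.exists_zpow h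
  exact ⟨j, isScaled_of_lower h01 hj (h00 ▸ hj)
    (by rw [h10, absNorm_zero]; exact (zpow_pos (uniformizer_pos ϖ) j).le)⟩

/-- The center is contained in the product of `K` and the powers of `ϖ`, so it adds nothing to
`KZZ'`. -/
theorem mem_KZZ_iff : g ∈ KZZ p ϖ ↔ ∃ j, IsScaled p ϖ j g := by
  constructor
  · intro hg
    let S : Subgroup (GL (Fin 2) D) :=
      { carrier := {g | ∃ j, IsScaled p ϖ j g}
        mul_mem' := fun ⟨j, hj⟩ ⟨l, hl⟩ => ⟨j + l, hj.mul hl⟩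
        one_mem' := ⟨0, by rw [← map_one (incl p D)]; exact isScaled_incl ϖ 1⟩
        inv_mem' := fun ⟨j, hj⟩ => ⟨-j, hj.inv⟩ }
    have hS : KZZ p ϖ ≤ S := by
      refine sup_le (sup_le ?_ fun z hz => isScaled_of_center hϖ hz) ?_
      · rintro _ ⟨k, rfl⟩; exact ⟨0, isScaled_incl ϖ k⟩
      · rw [Subgroup.zpowers_le]
        exact ⟨1, by simpa using isScaled_scalarUnit ϖ 1⟩
    exact hS hg
  · rintro ⟨j, hj⟩
    have h1 : (scalarUnit (ϖ ^ j))⁻¹ * g ∈ maxCompact p D := by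
      rw [mem_maxCompact_iff (ϖ := ϖ)]
      simpa using (isScaled_scalarUnit ϖ j).inv.mul hj
    rw [← mul_inv_cancel_left (scalarUnit (ϖ ^ j)) g]
    refine mul_mem (Subgroup.mem_sup_right ⟨j, scalarUnit_zpow ϖ j⟩)
      (Subgroup.mem_sup_left (Subgroup.mem_sup_left h1))

theorem IsScaled.mem_KZZ (hg : IsScaled p ϖ j g) : g ∈ KZZ p ϖ := (mem_KZZ_iff hϖ).2 ⟨j, hg⟩

omit hϖ in
theorem scalarUnit_inv_mul_entry (x : Dˣ) (g : GL (Fin 2) D) (i k : Fin 2) :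
    ((scalarUnit x)⁻¹ * g).1 i k = ((x⁻¹ : Dˣ) : D) * g.1 i k := by
  rw [GL2_mul_apply, scalarUnit_inv_val]
  fin_cases i <;> simp

omit hϖ in
theorem mem_iwahori_iff :
    g ∈ iwahori p D ↔ IsScaled p ϖ 0 g ∧ absNorm p D (g.1 1 0) < 1 := by
  constructor
  · rintro ⟨k, hk, rfl⟩
    exact ⟨isScaled_incl ϖ k, hk⟩
  · rintro ⟨h1, h2⟩
    obtain ⟨k, rfl⟩ := h1.exists_incl
    exact ⟨k, h2, rfl⟩

omit hϖ in
theorem mem_proPIwahori_iff :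
    g ∈ proPIwahori p D ↔ IsScaled p ϖ 0 g ∧ absNorm p D (g.1 1 0) < 1 ∧
      absNorm p D (g.1 0 0 - 1) < 1 ∧ absNorm p D (g.1 1 1 - 1) < 1 := by
  constructor
  · rintro ⟨k, hk, rfl⟩
    exact ⟨isScaled_incl ϖ k, hk⟩
  · rintro ⟨h1, h2⟩
    obtain ⟨k, rfl⟩ := h1.exists_incl
    exact ⟨k, h2, rfl⟩

omit hϖ in
theorem IsScaled.mem_IZZ (hg : IsScaled p ϖ j g)
    (h : absNorm p D (g.1 1 0) < absNorm p D (ϖ : D) ^ j) : g ∈ IZZ p ϖ := by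
  have hpos := zpow_pos (uniformizer_pos (p := p) ϖ) j
  have h1 : (scalarUnit (ϖ ^ j))⁻¹ * g ∈ iwahori p D := by
    rw [mem_iwahori_iff (ϖ := ϖ)]
    refine ⟨by simpa using (isScaled_scalarUnit ϖ j).inv.mul hg, ?_⟩
    rw [scalarUnit_inv_mul_entry, map_mul, absNorm_val_inv, absNorm_val_zpow,
      inv_mul_lt_iff₀ hpos, mul_one]
    exact h
  rw [← mul_inv_cancel_left (scalarUnit (ϖ ^ j)) g]
  exact mul_mem (Subgroup.mem_sup_right ⟨j, scalarUnit_zpow ϖ j⟩)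
    (Subgroup.mem_sup_left (Subgroup.mem_sup_left h1))

theorem mem_IZZ_iff : g ∈ IZZ p ϖ ↔
    ∃ j, IsScaled p ϖ j g ∧ absNorm p D (g.1 1 0) < absNorm p D (ϖ : D) ^ j := by
  constructor
  · intro hg
    let S : Subgroup (GL (Fin 2) D) :=
      { carrier := {g | ∃ j, IsScaled p ϖ j g ∧
          absNorm p D (g.1 1 0) ≤ absNorm p D (ϖ : D) ^ (j + 1) ∧
          absNorm p D ((g⁻¹).1 1 0) ≤ absNorm p D (ϖ : D) ^ (-j + 1)}
        mul_mem' := by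
          rintro a b ⟨j, hj, ha1, ha2⟩ ⟨l, hl, hb1, hb2⟩
          refine ⟨j + l, hj.mul hl, ?_, ?_⟩
          · rw [GL2_mul_apply]
            refine absNorm_add_le_of_le p ((absNorm_mul_le ha1 (hl.1 0 0)).trans_eq ?_)
              ((absNorm_mul_le (hj.1 1 1) hb1).trans_eq ?_) <;> congr 1 <;> ring
          · rw [mul_inv_rev, GL2_mul_apply]
            refine absNorm_add_le_of_le p ((absNorm_mul_le hb2 (hj.2 0 0)).trans_eq ?_)
              ((absNorm_mul_le (hl.2 1 1) ha2).trans_eq ?_) <;> congr 1 <;> ring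
        one_mem' := by
          refine ⟨0, by rw [← map_one (incl p D)]; exact isScaled_incl ϖ 1, ?_, ?_⟩ <;>
            simp [absNorm_zero, absNorm_nonneg]
        inv_mem' := by
          rintro a ⟨j, hj, h1, h2⟩
          exact ⟨-j, hj.inv, h2, by rw [inv_inv, neg_neg]; exact h1⟩ }
    have hS : IZZ p ϖ ≤ S := by
      refine sup_le (sup_le ?_ fun z hz => ?_) ?_
      · rintro _ ⟨k, hk, rfl⟩
        refine ⟨0, isScaled_incl ϖ k, ?_, ?_⟩
        · rw [zero_add, zpow_one]; exact hϖ.le_of_lt_one hk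
        · rw [neg_zero, zero_add, zpow_one, ← map_inv]; exact hϖ.le_of_lt_one (lower_mem hk)
      · obtain ⟨j, hj⟩ := isScaled_of_center hϖ hz
        refine ⟨j, hj, ?_, ?_⟩
        · rw [(center_entries hz).2.1, absNorm_zero]
          exact (zpow_pos (uniformizer_pos ϖ) _).le
        · rw [(center_entries (inv_mem hz)).2.1, absNorm_zero]
          exact (zpow_pos (uniformizer_pos ϖ) _).le
      · rw [Subgroup.zpowers_le]
        refine ⟨1, by simpa using isScaled_scalarUnit ϖ 1, ?_, ?_⟩
        · rw [scalarUnit_val]; simp [absNorm_zero, absNorm_nonneg]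
        · rw [scalarUnit_inv_val]; simp [absNorm_zero]
    obtain ⟨j, h1, h2, -⟩ := hS hg
    exact ⟨j, h1, (hϖ.lt_zpow_iff).2 h2⟩
  · rintro ⟨j, h1, h2⟩
    exact h1.mem_IZZ h2

/-- `IZZ'` is the product of `I` and the powers of `ϖ`. -/
theorem exists_of_mem_IZZ (hg : g ∈ IZZ p ϖ) :
    ∃ (j : ℤ) (k : GL (Fin 2) D), k ∈ iwahori p D ∧ g = scalarUnit (ϖ ^ j) * k := by
  obtain ⟨j, hj, h⟩ := (mem_IZZ_iff hϖ).1 hg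
  refine ⟨j, (scalarUnit (ϖ ^ j))⁻¹ * g, ?_, (mul_inv_cancel_left _ _).symm⟩
  rw [mem_iwahori_iff (ϖ := ϖ)]
  refine ⟨by simpa using (isScaled_scalarUnit ϖ j).inv.mul hj, ?_⟩
  rw [scalarUnit_inv_mul_entry, map_mul, absNorm_val_inv, absNorm_val_zpow,
    inv_mul_lt_iff₀ (zpow_pos (uniformizer_pos (p := p) ϖ) j), mul_one]
  exact h

end KZZ

theorem absNorm_eq_one_of_absNorm_mul {x y : D} (hx : absNorm p D x ≤ 1) (hy : absNorm p D y ≤ 1)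
    (h : absNorm p D (x * y) = 1) : absNorm p D x = 1 := by
  refine le_antisymm hx (not_lt.1 fun hlt => ?_)
  rw [map_mul] at h
  exact (mul_lt_one_of_nonneg_of_lt_one_left (absNorm_nonneg p D _) hlt hy).ne h

theorem absNorm_eq_one_of_add_eq_one {x y : D} (hy : absNorm p D y < 1) (h : x + y = 1) :
    absNorm p D x = 1 := by
  rw [eq_sub_of_add_eq h, sub_eq_neg_add, absNorm_add_eq_of_lt p, map_one]
  rwa [absNorm_neg, map_one]

/-- The diagonal entries of an element of the Iwahori subgroup are units. -/
theorem iwahori_diag (hg : g ∈ iwahori p D) :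
    absNorm p D (g.1 0 0) = 1 ∧ absNorm p D (g.1 1 1) = 1 := by
  have h := (mem_iwahori_iff (ϖ := 1)).1 hg
  have h1 : ∀ i j, absNorm p D (g.1 i j) ≤ 1 := by simpa using h.1.1
  have h2 : ∀ i j, absNorm p D ((g⁻¹).1 i j) ≤ 1 := by simpa using h.1.2
  have hs : ∀ i j, absNorm p D ((g⁻¹).1 i j * g.1 1 0) < 1 := fun i j => by
    rw [map_mul]; exact mul_lt_one_of_nonneg_of_lt_one_right (h2 i j) (absNorm_nonneg p D _) h.2
  have hs' : ∀ i j, absNorm p D (g.1 1 0 * (g⁻¹).1 i j) < 1 := fun i j => by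
    rw [map_mul, mul_comm, ← map_mul]; exact hs i j
  have e0 := congrFun (congrFun g.inv_mul 0) 0
  have e1 := congrFun (congrFun g.mul_inv 1) 1
  simp only [Matrix.mul_apply, Fin.sum_univ_two, Matrix.one_apply_eq] at e0 e1
  have n0 := absNorm_eq_one_of_add_eq_one (hs _ _) e0
  rw [add_comm] at e1
  have n1 := absNorm_eq_one_of_add_eq_one (hs' _ _) e1
  refine ⟨?_, absNorm_eq_one_of_absNorm_mul (h1 _ _) (h2 _ _) n1⟩
  rw [map_mul, mul_comm, ← map_mul] at n0
  exact absNorm_eq_one_of_absNorm_mul (h1 _ _) (h2 _ _) n0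

end Scaled

/-! ### Coset decompositions -/

section Decomposition

variable {p : ℕ} [Fact p.Prime]
variable {D : Type*} [DivisionRing D] [Algebra ℚ_[p] D] [FiniteDimensional ℚ_[p] D]
variable {ϖ : Dˣ} {g : GL (Fin 2) D}

theorem affineUnit_inv_mul_entries (a : Dˣ) (b : D) (g : GL (Fin 2) D) :
    ((affineUnit a b)⁻¹ * g).1 =
      !![((a⁻¹ : Dˣ) : D) * (g.1 0 0 - b * g.1 1 0), ((a⁻¹ : Dˣ) : D) * (g.1 0 1 - b * g.1 1 1);
        g.1 1 0, g.1 1 1] := by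
  ext i k
  rw [GL2_mul_apply, affineUnit_inv_val]
  fin_cases i <;> fin_cases k <;> simp [mul_add, mul_assoc, sub_eq_add_neg]

theorem betaUnit_inv_mul_entries (ϖ : Dˣ) (g : GL (Fin 2) D) :
    ((betaUnit ϖ)⁻¹ * g).1 =
      !![((ϖ⁻¹ : Dˣ) : D) * g.1 1 0, ((ϖ⁻¹ : Dˣ) : D) * g.1 1 1; g.1 0 0, g.1 0 1] := by
  ext i k
  rw [GL2_mul_apply, betaUnit_inv_val]
  fin_cases i <;> fin_cases k <;> simp

theorem upper_mul_affineUnit (x : D) (a : Dˣ) (b : D) :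
    affineUnit 1 x * affineUnit a b = affineUnit a (b + x) := by
  apply GL2_ext <;> simp [GL2_mul_apply, affineUnit_val]

theorem affineUnit_mul_upper (a : Dˣ) (b x : D) :
    affineUnit a b * affineUnit 1 x = affineUnit a (a * x + b) := by
  apply GL2_ext <;> simp [GL2_mul_apply, affineUnit_val]

theorem betaUnit_mul_affineUnit (ϖ a : Dˣ) (b : D) :
    betaUnit ϖ * affineUnit a b = lowerUnit 1 (ϖ * b) 1 * (betaUnit ϖ * affineUnit a 0) := by
  apply GL2_ext <;> simp [GL2_mul_apply, affineUnit_val, betaUnit_val, lowerUnit_val]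

theorem weylUnit_mul_beta_affineUnit (x : D) (ϖ : Dˣ) (n : ℕ) (b : D) :
    weylUnit x * (betaUnit ϖ * affineUnit (ϖ ^ n) b) = affineUnit (ϖ ^ (n + 1)) (x + ϖ * b) := by
  apply GL2_ext <;> simp [GL2_mul_apply, affineUnit_val, betaUnit_val, weylUnit_val, pow_succ']

theorem scalarUnit_mul_affineUnit (ϖ : Dˣ) (n : ℕ) (b : D) :
    scalarUnit ϖ * affineUnit (ϖ ^ n) b =
      affineUnit (ϖ ^ n) (ϖ * b * ((ϖ⁻¹ : Dˣ) : D)) * scalarUnit ϖ := by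
  apply GL2_ext <;>
    simp [GL2_mul_apply, affineUnit_val, scalarUnit_val, ← pow_succ, ← pow_succ']

theorem scalarUnit_mul_betaUnit (ϖ : Dˣ) :
    scalarUnit ϖ * betaUnit ϖ = betaUnit ϖ * scalarUnit ϖ := by
  apply GL2_ext <;> simp [GL2_mul_apply, betaUnit_val, scalarUnit_val]

variable (hϖ : IsUniformizer p ϖ)
include hϖ

/-- The vertices `(ϖ^m b; 0 1)` of the tree lie in one of the two halves of the tree. -/
theorem affineUnit_decomposition (m : ℤ) (b : D) :
    ∃ (n : ℕ) (μ : D), absNorm p D μ ≤ 1 ∧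
      ((affineUnit (ϖ ^ n) μ)⁻¹ * affineUnit (ϖ ^ m) b ∈ KZZ p ϖ ∨
        (affineUnit (ϖ ^ n) μ)⁻¹ * ((betaUnit ϖ)⁻¹ * affineUnit (ϖ ^ m) b) ∈ KZZ p ϖ) := by
  have hpos := uniformizer_pos (p := p) ϖ
  by_cases h1 : 0 ≤ m ∧ absNorm p D b ≤ 1
  · obtain ⟨n, rfl⟩ : ∃ n : ℕ, m = n := ⟨m.toNat, by omega⟩
    exact ⟨n, b, h1.2, Or.inl (by rw [zpow_natCast, inv_mul_cancel]; exact one_mem _)⟩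
  -- if `ϖ^m` divides `b` then `b` may be replaced by `0`, and `m < 0`
  by_cases h2 : absNorm p D b ≤ absNorm p D (ϖ : D) ^ m
  · have hm : m < 0 := by
      by_contra hm
      push Not at hm
      refine h1 ⟨hm, h2.trans ?_⟩
      rw [← zpow_zero (absNorm p D (ϖ : D)), hϖ.zpow_le_zpow_iff]
      exact hm
    obtain ⟨n, rfl⟩ : ∃ n : ℕ, m = -(n + 1 : ℕ) := ⟨(-m - 1).toNat, by omega⟩
    refine ⟨n, 0, by simp [absNorm_zero], Or.inr ?_⟩
    have h3 : IsScaled p ϖ (-(n + 1 : ℕ)) ((affineUnit (ϖ ^ n) 0)⁻¹ *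
        ((betaUnit ϖ)⁻¹ * affineUnit (ϖ ^ (-((n + 1 : ℕ) : ℤ))) b) * weylUnit 0) := by
      refine isScaled_of_lower ?_ ?_ ?_ ?_
      · rw [GL2_mul_apply, affineUnit_inv_mul_entries, betaUnit_inv_mul_entries]
        simp [weylUnit_val, affineUnit_val]
      · rw [GL2_mul_apply, affineUnit_inv_mul_entries, betaUnit_inv_mul_entries]
        simp only [weylUnit_val, affineUnit_val, Matrix.of_apply, Matrix.cons_val',
          Matrix.cons_val_zero, Matrix.cons_val_one, Matrix.cons_val_fin_one, mul_one, zero_mul,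
          mul_zero, sub_zero, zero_add, map_mul, absNorm_val_inv, Units.val_pow_eq_pow_val, map_pow]
        rw [_root_.zpow_neg, zpow_natCast, pow_succ, mul_inv]
      · rw [GL2_mul_apply, affineUnit_inv_mul_entries, betaUnit_inv_mul_entries]
        simpa [weylUnit_val, affineUnit_val] using absNorm_zpow p (ϖ : D) _
      · rw [GL2_mul_apply, affineUnit_inv_mul_entries, betaUnit_inv_mul_entries]
        simpa [weylUnit_val, affineUnit_val] using h2
    have h4 : weylUnit 0 ∈ KZZ p ϖ :=
      (isScaled_weylUnit ϖ (x := (0 : D)) (by simp [absNorm_zero])).mem_KZZ hϖ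
    exact (Subgroup.mul_mem_cancel_right _ h4).1 (h3.mem_KZZ hϖ)
  · have hb : b ≠ 0 := fun hb => h2 (by rw [hb, absNorm_zero]; exact (zpow_pos hpos m).le)
    obtain ⟨l, hl⟩ := hϖ.exists_zpow hb
    have hlm : l < m := by
      rwa [hl, hϖ.zpow_le_zpow_iff, not_le] at h2
    have hl0 : l < 0 := by
      by_contra hl0
      push Not at hl0
      refine h1 ⟨by omega, ?_⟩
      rw [hl, ← zpow_zero (absNorm p D (ϖ : D)), hϖ.zpow_le_zpow_iff]
      exact hl0
    -- `β⁻¹` acts on the boundary of the tree by `b ↦ ϖ⁻¹ b⁻¹`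
    obtain ⟨n, hn⟩ : ∃ n : ℕ, (n : ℤ) = m - 2 * l - 1 := ⟨(m - 2 * l - 1).toNat, by omega⟩
    refine ⟨n, ((ϖ⁻¹ : Dˣ) : D) * b⁻¹, ?_, Or.inr ?_⟩
    · rw [map_mul, absNorm_val_inv, absNorm_inv, hl, ← zpow_neg_one, ← _root_.zpow_neg,
        ← zpow_add₀ hpos.ne', ← zpow_zero (absNorm p D (ϖ : D)), hϖ.zpow_le_zpow_iff]
      omega
    · refine IsScaled.mem_KZZ hϖ (j := l) (isScaled_of_lower ?_ ?_ ?_ ?_)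
      · rw [affineUnit_inv_mul_entries, betaUnit_inv_mul_entries]
        simp [affineUnit_val, hb, mul_assoc]
      · rw [affineUnit_inv_mul_entries, betaUnit_inv_mul_entries]
        simp only [affineUnit_val, Matrix.of_apply, Matrix.cons_val', Matrix.cons_val_zero,
          Matrix.cons_val_one, Matrix.cons_val_fin_one, mul_zero, zero_sub, map_mul, absNorm_neg,
          absNorm_val_inv, absNorm_inv, hl, absNorm_val_zpow, Units.val_pow_eq_pow_val, map_pow]
        rw [← zpow_natCast, ← zpow_neg_one (absNorm p D (ϖ : D)), ← _root_.zpow_neg,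
          ← _root_.zpow_neg, ← zpow_add₀ hpos.ne', ← zpow_add₀ hpos.ne', ← zpow_add₀ hpos.ne']
        congr 1
        omega
      · rw [affineUnit_inv_mul_entries, betaUnit_inv_mul_entries]
        simpa [affineUnit_val] using hl
      · rw [affineUnit_inv_mul_entries, betaUnit_inv_mul_entries]
        simp only [affineUnit_val, Matrix.of_apply, Matrix.cons_val', Matrix.cons_val_zero,
          Matrix.cons_val_one, Matrix.cons_val_fin_one, absNorm_val_zpow]
        exact (hϖ.zpow_le_zpow_iff).2 hlm.le

/-- The decomposition of `GL₂(D)` into cosets of `KZZ'`: up to `KZZ'`, every matrix is of the form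
`(ϖ^n μ; 0 1)` or `β (ϖ^n μ; 0 1)` with `n ≥ 0` and `μ` integral. -/
theorem exists_decomposition (g : GL (Fin 2) D) :
    ∃ (n : ℕ) (μ : D), absNorm p D μ ≤ 1 ∧ ∃ k ∈ KZZ p ϖ,
      (g = affineUnit (ϖ ^ n) μ * k ∨ g = betaUnit ϖ * affineUnit (ϖ ^ n) μ * k) := by
  have hpos := uniformizer_pos (p := p) ϖ
  -- column operations make `g` upper triangular
  have h1 : ∃ k ∈ KZZ p ϖ, (g * k).1 1 0 = 0 := by
    rcases le_or_gt (absNorm p D (g.1 1 0)) (absNorm p D (g.1 1 1)) with hle | hlt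
    · have hne : g.1 1 1 ≠ 0 := fun h0 => by
        rw [h0, absNorm_zero] at hle
        have h10 := (absNorm_eq_zero p).1 (le_antisymm hle (absNorm_nonneg p D _))
        have := congrFun (congrFun g.mul_inv 1) 1
        simp [Matrix.mul_apply, h0, h10] at this
      refine ⟨lowerUnit 1 (-((g.1 1 1)⁻¹ * g.1 1 0)) 1, (IsScaled.mem_KZZ hϖ (j := 0) ?_), ?_⟩
      · refine isScaled_of_lower rfl (by simp [lowerUnit_val]) (by simp [lowerUnit_val]) ?_
        rw [zpow_zero]
        change absNorm p D (-_) ≤ 1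
        rw [absNorm_neg, map_mul, absNorm_inv, inv_mul_le_iff₀ (absNorm_pos p hne), mul_one]
        exact hle
      · rw [GL2_mul_apply]
        simp [lowerUnit_val, hne]
    · have hne : g.1 1 0 ≠ 0 := fun h0 => by
        rw [h0, absNorm_zero] at hlt
        exact (absNorm_nonneg p D _).not_gt hlt
      refine ⟨weylUnit (-((g.1 1 0)⁻¹ * g.1 1 1)), (IsScaled.mem_KZZ hϖ (j := 0)
        (isScaled_weylUnit ϖ ?_)), ?_⟩
      · rw [absNorm_neg, map_mul, absNorm_inv, inv_mul_le_iff₀ (absNorm_pos p hne), mul_one]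
        exact hlt.le
      · rw [GL2_mul_apply]
        simp [weylUnit_val, hne]
  obtain ⟨k, hk, hu⟩ := h1
  set u := g * k
  have hg : g = u * k⁻¹ := (mul_inv_cancel_right g k).symm
  have h00 : u.1 0 0 ≠ 0 := fun h0 => by
    have := congrFun (congrFun u.inv_mul 0) 0
    simp [Matrix.mul_apply, h0, hu] at this
  have h11 : u.1 1 1 ≠ 0 := fun h0 => by
    have := congrFun (congrFun u.mul_inv 1) 1
    simp [Matrix.mul_apply, h0, hu] at this
  obtain ⟨i, hi⟩ := hϖ.exists_zpow h00
  obtain ⟨j, hj⟩ := hϖ.exists_zpow h11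
  -- divide by the lower right entry
  have h2 : (affineUnit (ϖ ^ (i - j)) (u.1 0 1 * (u.1 1 1)⁻¹))⁻¹ * u ∈ KZZ p ϖ := by
    refine IsScaled.mem_KZZ hϖ (j := j) (isScaled_of_lower ?_ ?_ ?_ ?_)
    · rw [affineUnit_inv_mul_entries]
      simp [h11]
    · rw [affineUnit_inv_mul_entries]
      simp only [hu, Matrix.of_apply, Matrix.cons_val', Matrix.cons_val_zero, mul_zero, sub_zero,
        Matrix.cons_val_fin_one]
      rw [map_mul, hi, absNorm_val_inv, absNorm_val_zpow, ← _root_.zpow_neg, ← zpow_add₀ hpos.ne']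
      congr 1; omega
    · rw [affineUnit_inv_mul_entries]; exact hj
    · rw [affineUnit_inv_mul_entries]
      simpa [hu, absNorm_zero] using (zpow_pos hpos j).le
  obtain ⟨n, μ, hμ, h | h⟩ := affineUnit_decomposition hϖ (i - j) (u.1 0 1 * (u.1 1 1)⁻¹)
  · refine ⟨n, μ, hμ, (affineUnit (ϖ ^ n) μ)⁻¹ * g, ?_, Or.inl (mul_inv_cancel_left _ _).symm⟩
    have := mul_mem (mul_mem h h2) (inv_mem hk)
    rw [hg]
    simpa [mul_assoc] using this
  · refine ⟨n, μ, hμ, (affineUnit (ϖ ^ n) μ)⁻¹ * ((betaUnit ϖ)⁻¹ * g), ?_, Or.inr (by group)⟩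
    have := mul_mem (mul_mem h h2) (inv_mem hk)
    rw [hg]
    simpa [mul_assoc] using this

/-- The cosets `(ϖ^n μ; 0 1) KZZ'` are determined by `n` and the class of `μ` modulo `ϖ^n`. -/
theorem affineUnit_coset_eq {n m : ℕ} {μ ν : D}
    (h : (affineUnit (ϖ ^ m) ν)⁻¹ * affineUnit (ϖ ^ n) μ ∈ KZZ p ϖ) :
    m = n ∧ absNorm p D (μ - ν) ≤ absNorm p D (ϖ : D) ^ m := by
  have hpos := uniformizer_pos (p := p) ϖ
  obtain ⟨j, hj⟩ := (mem_KZZ_iff hϖ).1 h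
  have h0 := hj.1 1 1
  have h1 := hj.1 0 0
  have h2 := hj.1 0 1
  have h3 := hj.2 1 1
  have h4 := hj.2 0 0
  rw [mul_inv_rev, inv_inv] at h3 h4
  rw [affineUnit_inv_mul_entries] at h0 h1 h2 h3 h4
  simp only [affineUnit_val, Matrix.of_apply, Matrix.cons_val', Matrix.cons_val_zero,
    Matrix.cons_val_one, Matrix.cons_val_fin_one, map_one, mul_zero, sub_zero, mul_one, map_mul,
    absNorm_val_inv, Units.val_pow_eq_pow_val, map_pow] at h0 h1 h2 h3 h4
  rw [← zpow_zero (absNorm p D (ϖ : D)), hϖ.zpow_le_zpow_iff] at h0 h3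
  obtain rfl : j = 0 := by omega
  rw [← zpow_natCast, ← zpow_natCast, ← _root_.zpow_neg, ← zpow_add₀ hpos.ne',
    hϖ.zpow_le_zpow_iff] at h1 h4
  refine ⟨by omega, ?_⟩
  rwa [zpow_zero, inv_mul_le_iff₀ (pow_pos hpos m), mul_one] at h2

/-- The two halves of the tree are disjoint. -/
theorem affineUnit_beta_notMem {n m : ℕ} {μ ν : D} (hμ : absNorm p D μ ≤ 1)
    (hν : absNorm p D ν ≤ 1) :
    (affineUnit (ϖ ^ m) ν)⁻¹ * (betaUnit ϖ * affineUnit (ϖ ^ n) μ) ∉ KZZ p ϖ := by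
  intro h
  have hpos := uniformizer_pos (p := p) ϖ
  obtain ⟨j, hj⟩ := (mem_KZZ_iff hϖ).1 h
  have h1 := hj.1 0 1
  have h2 := hj.2 0 1
  have hu : ∀ x y : D, absNorm p D x ≤ 1 → absNorm p D y ≤ 1 →
      absNorm p D (1 - x * (ϖ * y)) = 1 := fun x y hx hy => by
    rw [sub_eq_neg_add, absNorm_add_eq_of_lt p, map_one]
    rw [absNorm_neg, map_one, map_mul, map_mul]
    exact mul_lt_one_of_nonneg_of_lt_one_right hx
      (mul_nonneg (absNorm_nonneg p D _) (absNorm_nonneg p D _))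
      (mul_lt_one_of_nonneg_of_lt_one_left (absNorm_nonneg p D _) hϖ.lt_one hy)
  rw [mul_inv_rev, inv_inv, mul_inv_rev, mul_assoc, affineUnit_inv_mul_entries,
    betaUnit_inv_mul_entries] at h2
  rw [affineUnit_inv_mul_entries] at h1
  simp only [GL2_mul_apply, affineUnit_val, betaUnit_val, Matrix.of_apply, Matrix.cons_val', Matrix.cons_val_zero,
    Matrix.cons_val_one, Matrix.cons_val_fin_one, zero_mul, zero_add, one_mul, add_zero,
    mul_one, map_mul, absNorm_val_inv, Units.val_pow_eq_pow_val, map_pow, hu _ _ hν hμ] at h1 h2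
  have hu2 : absNorm p D (((ϖ⁻¹ : Dˣ) : D) - μ * ν) = (absNorm p D (ϖ : D))⁻¹ := by
    rw [sub_eq_neg_add, absNorm_add_eq_of_lt p, absNorm_val_inv]
    rw [absNorm_neg, absNorm_val_inv]
    refine lt_of_le_of_lt ?_ (one_lt_inv_iff₀.2 ⟨hpos, hϖ.lt_one⟩)
    rw [map_mul]
    exact mul_le_one₀ hμ (absNorm_nonneg p D _) hν
  rw [hu2, ← zpow_natCast, ← _root_.zpow_neg, ← zpow_neg_one, ← zpow_add₀ hpos.ne',
    hϖ.zpow_le_zpow_iff] at h2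
  rw [← zpow_natCast, ← _root_.zpow_neg, hϖ.zpow_le_zpow_iff] at h1
  omega

theorem weylUnit_notMem_IZZ {x : D} : weylUnit x ∉ IZZ p ϖ := by
  intro h
  obtain ⟨j, hj, hlt⟩ := (mem_IZZ_iff hϖ).1 h
  have h2 := hj.2 0 1
  rw [weylUnit_inv_val] at h2
  rw [weylUnit_val] at hlt
  simp only [Matrix.of_apply, Matrix.cons_val', Matrix.cons_val_zero, Matrix.cons_val_one,
    Matrix.cons_val_fin_one, map_one] at h2 hlt
  rw [← zpow_zero (absNorm p D (ϖ : D)), hϖ.zpow_le_zpow_iff] at h2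
  rw [← zpow_zero (absNorm p D (ϖ : D)), hϖ.zpow_lt_zpow_iff] at hlt
  omega

theorem weylUnit_coset_eq {x y : D} (h : (weylUnit x)⁻¹ * weylUnit y ∈ IZZ p ϖ) :
    absNorm p D (y - x) < 1 := by
  obtain ⟨j, hj, hlt⟩ := (mem_IZZ_iff hϖ).1 h
  have h0 := hj.1 0 0
  rw [GL2_mul_apply, weylUnit_inv_val, weylUnit_val] at h0 hlt
  simp only [Matrix.of_apply, Matrix.cons_val', Matrix.cons_val_zero, Matrix.cons_val_one,
    Matrix.cons_val_fin_one, map_one, zero_mul, one_mul, zero_add, mul_one] at h0 hlt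
  have h2 := hj.2 0 0
  rw [mul_inv_rev, inv_inv, GL2_mul_apply, weylUnit_inv_val, weylUnit_val] at h2
  simp only [Matrix.of_apply, Matrix.cons_val', Matrix.cons_val_zero, Matrix.cons_val_one,
    Matrix.cons_val_fin_one, map_one, zero_mul, one_mul, zero_add] at h2
  rw [← zpow_zero (absNorm p D (ϖ : D)), hϖ.zpow_le_zpow_iff] at h0 h2
  obtain rfl : j = 0 := by omega
  rw [zpow_zero] at hlt
  rwa [sub_eq_add_neg]

/-- The identity and the matrices `(s(x) 1; 1 0)` represent `KZZ' / IZZ'`. -/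
theorem exists_weyl_decomposition {s : residueRing p D → integers p D}
    (hs : ∀ x, red p D (s x) = x) (hg : g ∈ KZZ p ϖ) :
    g ∈ IZZ p ϖ ∨ ∃ x, (weylUnit (s x : D))⁻¹ * g ∈ IZZ p ϖ := by
  obtain ⟨j, hj⟩ := (mem_KZZ_iff hϖ).1 hg
  have hpos := zpow_pos (uniformizer_pos (p := p) ϖ) j
  by_cases h : absNorm p D (g.1 1 0) < absNorm p D (ϖ : D) ^ j
  · exact Or.inl (hj.mem_IZZ h)
  right
  have h10 : absNorm p D (g.1 1 0) = absNorm p D (ϖ : D) ^ j := le_antisymm (hj.1 1 0) (not_lt.1 h)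
  have hne : g.1 1 0 ≠ 0 := fun h0 => by rw [h0, absNorm_zero] at h10; exact hpos.ne h10
  have hint : absNorm p D (g.1 0 0 * (g.1 1 0)⁻¹) ≤ 1 := by
    rw [map_mul, absNorm_inv, h10, mul_inv_le_iff₀ hpos, one_mul]
    exact hj.1 0 0
  refine ⟨red p D ⟨_, hint⟩, IsScaled.mem_IZZ (j := j) ?_ ?_⟩
  · simpa using (isScaled_weylUnit ϖ (s _).2).inv.mul hj
  · rw [GL2_mul_apply, weylUnit_inv_val]
    simp only [Matrix.of_apply, Matrix.cons_val', Matrix.cons_val_zero, Matrix.cons_val_one,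
      Matrix.cons_val_fin_one, one_mul]
    have h1 := (red_eq_iff p).1 (hs (red p D ⟨_, hint⟩)).symm
    have e : g.1 0 0 + -(s (red p D ⟨_, hint⟩) : D) * g.1 1 0 =
        (g.1 0 0 * (g.1 1 0)⁻¹ - s (red p D ⟨_, hint⟩)) * g.1 1 0 := by
      rw [sub_mul, inv_mul_cancel_right₀ hne, neg_mul, sub_eq_add_neg]
    rw [e, map_mul, h10]
    exact mul_lt_of_lt_one_left hpos h1

/-- The Iwahori subgroup permutes the cosets `(ϖ^n μ; 0 1) KZZ'` with `μ` integral, and the diagonal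
entry of the factor in `K` is independent of `μ` up to elements of norm less than `1`. -/
theorem iwahori_mul_affineUnit (hg : g ∈ iwahori p D) (n : ℕ) {μ : D} (hμ : absNorm p D μ ≤ 1) :
    ∃ μ' : D, absNorm p D μ' ≤ 1 ∧ ∃ k ∈ iwahori p D,
      g * affineUnit (ϖ ^ n) μ = affineUnit (ϖ ^ n) μ' * k ∧
      absNorm p D (k.1 0 0 - ((ϖ ^ n)⁻¹ : Dˣ) * g.1 0 0 * (ϖ ^ n : Dˣ)) < 1 := by
  obtain ⟨hsc, hc⟩ := (mem_iwahori_iff (ϖ := ϖ)).1 hg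
  obtain ⟨ha, hd⟩ := iwahori_diag hg
  have hle : ∀ i k, absNorm p D (g.1 i k) ≤ 1 := by simpa using hsc.1
  have hcμ : absNorm p D (g.1 1 0 * μ) < 1 := by
    rw [map_mul]
    exact mul_lt_one_of_nonneg_of_lt_one_left (absNorm_nonneg p D _) hc hμ
  have hu : absNorm p D (g.1 1 0 * μ + g.1 1 1) = 1 := by
    rw [absNorm_add_eq_of_lt p (hcμ.trans_eq hd.symm), hd]
  have hune : g.1 1 0 * μ + g.1 1 1 ≠ 0 := fun h0 => by
    rw [h0, absNorm_zero] at hu; exact zero_ne_one hu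
  set μ' := (g.1 0 0 * μ + g.1 0 1) * (g.1 1 0 * μ + g.1 1 1)⁻¹ with hμ'
  have hμ'1 : absNorm p D μ' ≤ 1 := by
    rw [hμ', map_mul, absNorm_inv, hu, inv_one, mul_one]
    refine absNorm_add_le_of_le p ?_ (hle _ _)
    rw [map_mul]
    exact mul_le_one₀ (hle _ _) (absNorm_nonneg p D _) hμ
  have hμc : absNorm p D (μ' * g.1 1 0) < 1 := by
    rw [map_mul]
    exact mul_lt_one_of_nonneg_of_lt_one_right hμ'1 (absNorm_nonneg p D _) hc
  have hconj : ∀ x : D, absNorm p D (((ϖ ^ n)⁻¹ : Dˣ) * (x * (ϖ ^ n : Dˣ))) = absNorm p D x :=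
    fun x => by
      rw [map_mul, map_mul, mul_left_comm, ← map_mul (absNorm p D) ((ϖ ^ n)⁻¹ : Dˣ).1]
      simp
  refine ⟨μ', hμ'1, (affineUnit (ϖ ^ n) μ')⁻¹ * (g * affineUnit (ϖ ^ n) μ), ?_,
    (mul_inv_cancel_left _ _).symm, ?_⟩
  · have h10 : absNorm p D (g.1 1 0 * (ϖ ^ n : Dˣ)) < 1 := by
      rw [map_mul]
      refine mul_lt_one_of_nonneg_of_lt_one_left (absNorm_nonneg p D _) hc ?_
      rw [Units.val_pow_eq_pow_val, map_pow]
      exact pow_le_one₀ (absNorm_nonneg p D _) hϖ.lt_one.le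
    rw [mem_iwahori_iff (ϖ := ϖ)]
    refine ⟨isScaled_of_lower ?_ ?_ ?_ ?_, ?_⟩ <;>
      rw [affineUnit_inv_mul_entries] <;> simp only [GL2_mul_apply, affineUnit_val,
        Matrix.of_apply, Matrix.cons_val', Matrix.cons_val_zero, Matrix.cons_val_one,
        Matrix.cons_val_fin_one, mul_zero, add_zero, mul_one, zpow_zero]
    · rw [hμ', inv_mul_cancel_right₀ hune, sub_self, mul_zero]
    · rw [← mul_assoc μ', ← sub_mul, hconj, sub_eq_neg_add, absNorm_add_eq_of_lt p, ha]
      rw [absNorm_neg, ha]; exact hμc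
    · exact hu
    · exact h10.le
    · exact h10
  · rw [affineUnit_inv_mul_entries]
    simp only [GL2_mul_apply, affineUnit_val, Matrix.of_apply, Matrix.cons_val',
      Matrix.cons_val_zero, Matrix.cons_val_one, Matrix.cons_val_fin_one, mul_zero, add_zero]
    rw [mul_assoc _ (g.1 0 0), ← mul_sub, sub_sub_cancel_left, ← mul_assoc μ', ← neg_mul, hconj,
      absNorm_neg]
    exact hμc

theorem beta_conj_entries (g : GL (Fin 2) D) :
    ((betaUnit ϖ)⁻¹ * g * betaUnit ϖ).1 =
      !![((ϖ⁻¹ : Dˣ) : D) * g.1 1 1 * ϖ, ((ϖ⁻¹ : Dˣ) : D) * g.1 1 0; g.1 0 1 * ϖ, g.1 0 0] := by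
  ext i k
  rw [GL2_mul_apply, betaUnit_inv_mul_entries]
  fin_cases i <;> fin_cases k <;> simp [betaUnit_val]

/-- `β` normalizes the Iwahori subgroup. -/
theorem beta_conj_mem_iwahori (hg : g ∈ iwahori p D) :
    (betaUnit ϖ)⁻¹ * g * betaUnit ϖ ∈ iwahori p D := by
  have hpos := uniformizer_pos (p := p) ϖ
  have key : ∀ h ∈ iwahori p D, ∀ i k,
      absNorm p D (((betaUnit ϖ)⁻¹ * h * betaUnit ϖ).1 i k) ≤ 1 := by
    intro h hh i k
    obtain ⟨hsc, hc⟩ := (mem_iwahori_iff (ϖ := ϖ)).1 hh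
    have hle : ∀ i k, absNorm p D (h.1 i k) ≤ 1 := by simpa using hsc.1
    rw [beta_conj_entries hϖ]
    fin_cases i <;> fin_cases k
    · change absNorm p D (_ * _ * _) ≤ 1
      rw [map_mul, map_mul, absNorm_val_inv, mul_right_comm, inv_mul_cancel₀ hpos.ne', one_mul]
      exact hle 1 1
    · change absNorm p D (_ * _) ≤ 1
      rw [map_mul, absNorm_val_inv, inv_mul_le_iff₀ hpos, mul_one]
      exact hϖ.le_of_lt_one hc
    · change absNorm p D (_ * _) ≤ 1
      rw [map_mul]
      exact mul_le_one₀ (hle 0 1) (absNorm_nonneg p D _) hϖ.lt_one.le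
    · exact hle 0 0
  rw [mem_iwahori_iff (ϖ := ϖ)]
  refine ⟨⟨by simpa using key g hg, ?_⟩, ?_⟩
  · have := key g⁻¹ (inv_mem hg)
    simpa [mul_inv_rev, mul_assoc] using this
  · rw [beta_conj_entries hϖ]
    have hle := ((mem_iwahori_iff (ϖ := ϖ)).1 hg).1.1 0 1
    rw [zpow_zero] at hle
    change absNorm p D (_ * _) < 1
    rw [map_mul]
    exact mul_lt_one_of_nonneg_of_lt_one_right hle (absNorm_nonneg p D _) hϖ.lt_one

omit hϖ in
theorem proPIwahori_le_iwahori : proPIwahori p D ≤ iwahori p D := fun _ hg =>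
  (mem_iwahori_iff (ϖ := 1)).2 ⟨((mem_proPIwahori_iff (ϖ := 1)).1 hg).1,
    ((mem_proPIwahori_iff (ϖ := 1)).1 hg).2.1⟩

omit hϖ in
theorem iwahori_le_maxCompact : iwahori p D ≤ maxCompact p D := by
  rintro _ ⟨k, -, rfl⟩
  exact ⟨k, rfl⟩

omit hϖ in
theorem upper_mem_proPIwahori {x : D} (hx : absNorm p D x ≤ 1) :
    affineUnit 1 x ∈ proPIwahori p D :=
  (mem_proPIwahori_iff (ϖ := 1)).2 ⟨isScaled_upper 1 hx, by simp [affineUnit_val, absNorm_zero],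
    by simp [affineUnit_val, absNorm_zero], by simp [affineUnit_val, absNorm_zero]⟩

theorem lower_mem_proPIwahori {x : D} (hx : absNorm p D x ≤ 1) :
    lowerUnit 1 (ϖ * x) 1 ∈ proPIwahori p D := by
  have h : absNorm p D (ϖ * x) < 1 := by
    rw [map_mul]
    exact mul_lt_one_of_nonneg_of_lt_one_left (absNorm_nonneg p D _) hϖ.lt_one hx
  refine (mem_proPIwahori_iff (ϖ := ϖ)).2 ⟨isScaled_of_lower rfl ?_ ?_ ?_, ?_, ?_, ?_⟩
  · simp [lowerUnit_val]
  · simp [lowerUnit_val]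
  · rw [zpow_zero]; exact h.le
  · exact h
  · simp [lowerUnit_val, absNorm_zero]
  · simp [lowerUnit_val, absNorm_zero]

end Decomposition

/-! ### Compact induction and Frobenius reciprocity -/

section CompactInductionLemmas

variable {k G V : Type*} [Field k] [Group G] [AddCommGroup V] [Module k V] {H : Subgroup G}

theorem cInd_apply (σ : Representation k H V) (x : G) (f : cIndV σ) (y : G) :
    (cInd σ x f).1 y = f.1 (y * x) := rfl

theorem cIndV_mul (σ : Representation k H V) (f : cIndV σ) {h : G} (hh : h ∈ H) (g : G) :
    f.1 (h * g) = σ ⟨h, hh⟩ (f.1 g) := f.2.1 ⟨h, hh⟩ g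

theorem bracket_apply_of_mem (σ : Representation k H V) {g x : G} (v : V) (h : x * g ∈ H) :
    (bracket σ g v).1 x = σ ⟨x * g, h⟩ v := dif_pos h

theorem bracket_apply_of_notMem (σ : Representation k H V) {g x : G} (v : V) (h : x * g ∉ H) :
    (bracket σ g v).1 x = 0 := dif_neg h

theorem bracket_apply_inv (σ : Representation k H V) (g : G) (v : V) :
    (bracket σ g v).1 g⁻¹ = v := by
  have h : g⁻¹ * g ∈ H := by rw [inv_mul_cancel]; exact one_mem H
  rw [bracket_apply_of_mem σ v h]
  have : (⟨g⁻¹ * g, h⟩ : H) = 1 := Subtype.ext (inv_mul_cancel g)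
  rw [this, map_one, Module.End.one_apply]

theorem cInd_bracket (σ : Representation k H V) (x g : G) (v : V) :
    cInd σ x (bracket σ g v) = bracket σ (x * g) v := by
  refine Subtype.ext (funext fun y => ?_)
  rw [cInd_apply]
  by_cases h : y * x * g ∈ H
  · have h' : y * (x * g) ∈ H := by rwa [← mul_assoc]
    rw [bracket_apply_of_mem σ v h, bracket_apply_of_mem σ v h']
    congr 2
    exact Subtype.ext (mul_assoc _ _ _)
  · have h' : y * (x * g) ∉ H := by rwa [← mul_assoc]
    rw [bracket_apply_of_notMem σ v h, bracket_apply_of_notMem σ v h']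

theorem bracket_mul (σ : Representation k H V) (g : G) {h : G} (hh : h ∈ H) (v : V) :
    bracket σ (g * h) v = bracket σ g (σ ⟨h, hh⟩ v) := by
  refine Subtype.ext (funext fun y => ?_)
  by_cases hy : y * g ∈ H
  · have h' : y * (g * h) ∈ H := by rw [← mul_assoc]; exact mul_mem hy hh
    rw [bracket_apply_of_mem σ _ hy, bracket_apply_of_mem σ v h', ← Module.End.mul_apply,
      ← map_mul]
    congr 2
    exact Subtype.ext (mul_assoc _ _ _).symm
  · have h' : y * (g * h) ∉ H := by rw [← mul_assoc, H.mul_mem_cancel_right hh]; exact hy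
    rw [bracket_apply_of_notMem σ _ hy, bracket_apply_of_notMem σ v h']

/-- The map `v ↦ [g, v]`. -/
def bracketHom (σ : Representation k H V) (g : G) : V →ₗ[k] cIndV σ where
  toFun := bracket σ g
  map_add' v w := by
    refine Subtype.ext (funext fun y => ?_)
    change _ = (bracket σ g v).1 y + (bracket σ g w).1 y
    by_cases hy : y * g ∈ H
    · rw [bracket_apply_of_mem σ _ hy, bracket_apply_of_mem σ _ hy, bracket_apply_of_mem σ _ hy,
        map_add]
    · rw [bracket_apply_of_notMem σ _ hy, bracket_apply_of_notMem σ _ hy,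
        bracket_apply_of_notMem σ _ hy, add_zero]
  map_smul' c v := by
    refine Subtype.ext (funext fun y => ?_)
    change _ = c • (bracket σ g v).1 y
    by_cases hy : y * g ∈ H
    · rw [bracket_apply_of_mem σ _ hy, bracket_apply_of_mem σ _ hy, map_smul]
    · rw [bracket_apply_of_notMem σ _ hy, bracket_apply_of_notMem σ _ hy, smul_zero]

/-- Functions with a dual family of evaluation points are linearly independent. -/
theorem linearIndependent_of_apply {X : Type*} {σ : Representation k H V} {v : X → cIndV σ}
    {y : X → G} (h1 : ∀ i, (v i).1 (y i) ≠ 0) (h0 : ∀ i j, i ≠ j → (v i).1 (y j) = 0) :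
    LinearIndependent k v := by
  refine linearIndependent_iff'.2 fun s g hg i hi => ?_
  have h := congrArg (fun f : cIndV σ => f.1 (y i)) hg
  simp only [Submodule.coe_sum, Finset.sum_apply, Submodule.coe_smul, Pi.smul_apply,
    Submodule.coe_zero, Pi.zero_apply] at h
  rw [Finset.sum_eq_single i (fun j _ hj => by rw [h0 j i hj, smul_zero])
    (fun h => absurd hi h)] at h
  exact (smul_eq_zero.1 h).resolve_right (h1 i)

theorem exists_basis_invariants_of_span {X G' : Type*} [Group G'] {σ : Representation k H V}
    {ρ : Representation k G' (cIndV σ)} {v : X → cIndV σ} (hv : ∀ u i, ρ u (v i) = v i)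
    (hli : LinearIndependent k v)
    (hsp : ∀ f, (∀ u, ρ u f = f) → f ∈ Submodule.span k (Set.range v)) :
    ∃ b : Module.Basis X k ρ.invariants, ∀ i, (b i).1 = v i := by
  let v' : X → ρ.invariants := fun i => ⟨v i, fun u => hv u i⟩
  have hli' : LinearIndependent k v' := LinearIndependent.of_comp ρ.invariants.subtype hli
  refine ⟨Module.Basis.mk hli' ?_, fun i => by rw [Module.Basis.mk_apply]⟩
  rintro f -
  have h := hsp f.1 f.2
  have e : Set.range v = ρ.invariants.subtype '' Set.range v' := by
    rw [← Set.range_comp]; rfl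
  rw [e, ← Submodule.map_span] at h
  obtain ⟨f', hf', e'⟩ := h
  rwa [← Subtype.ext e']

end CompactInductionLemmas

section Generated

variable {k G V W : Type*} [Field k] [Group G] [AddCommGroup V] [Module k V] [AddCommGroup W]
  [Module k W] (ρ : Representation k G W) (σ : Representation k G V)

theorem apply_mem_generated (v : W) (g : G) : ρ g v ∈ (generated ρ v).toSubmodule :=
  Submodule.subset_span ⟨g, rfl⟩

theorem self_mem_generated (v : W) : v ∈ (generated ρ v).toSubmodule := by
  simpa using apply_mem_generated ρ v 1

theorem generated_le {v : W} {S : Submodule k W} (h : ∀ g, ρ g v ∈ S) :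
    (generated ρ v).toSubmodule ≤ S := by
  refine Submodule.span_le.2 ?_
  rintro _ ⟨g, rfl⟩
  exact h g

variable {ρ σ}

/-- An injective intertwining map identifies the representation generated by the image of a
generator. -/
theorem generated_equiv_of_injective {Φ : V →ₗ[k] W} (hΦ : ∀ g v, Φ (σ g v) = ρ g (Φ v))
    (hinj : Function.Injective Φ) {v : V} (hv : (generated σ v).toSubmodule = ⊤) :
    Nonempty ((generated ρ (Φ v)).toRepresentation.Equiv σ) := by
  have hr : LinearMap.range Φ = (generated ρ (Φ v)).toSubmodule := by
    rw [LinearMap.range_eq_map, ← hv]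
    change Submodule.map Φ (Submodule.span k _) = Submodule.span k _
    rw [Submodule.map_span]
    congr 1
    ext w
    simp [hΦ]
  let e : V ≃ₗ[k] (generated ρ (Φ v)).toSubmodule :=
    (LinearEquiv.ofInjective Φ hinj).trans (LinearEquiv.ofEq _ _ hr)
  refine ⟨(Representation.Equiv.mk e fun g => ?_).symm⟩
  refine LinearMap.ext fun u => Subtype.ext ?_
  exact hΦ g u

theorem isIrreducible_of_forall [Nontrivial W]
    (h : ∀ S : Submodule k W, (∀ g, ∀ v ∈ S, ρ g v ∈ S) → S ≠ ⊥ → S = ⊤) : ρ.IsIrreducible where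
  exists_pair_ne := ⟨⊥, ⊤, fun he =>
    bot_ne_top (α := Submodule k W) (congrArg Subrepresentation.toSubmodule he)⟩
  eq_bot_or_eq_top S := by
    by_cases hS : S.toSubmodule = ⊥
    · exact Or.inl (Subrepresentation.toSubmodule_injective hS)
    · exact Or.inr (Subrepresentation.toSubmodule_injective
        (h S.toSubmodule (fun g v hv => S.apply_mem_toSubmodule g hv) hS))

theorem isIrreducible_of_finrank_eq_one (h : Module.finrank k W = 1) : ρ.IsIrreducible := by
  have : Nontrivial W := Module.nontrivial_of_finrank_pos (R := k) (by omega)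
  have := (isSimpleModule_iff k W).1 (isSimpleModule_iff_finrank_eq_one.2 h)
  exact isIrreducible_of_forall fun S _ hS => (eq_bot_or_eq_top S).resolve_left hS

theorem isIrreducible_of_equiv [Nontrivial W] (e : ρ.Equiv σ) (hσ : σ.IsIrreducible) :
    ρ.IsIrreducible := by
  refine isIrreducible_of_forall fun S hS hne => ?_
  let T : Subrepresentation σ :=
    { toSubmodule := S.map e.toLinearEquiv.toLinearMap
      apply_mem_toSubmodule := by
        rintro g _ ⟨v, hv, rfl⟩
        exact ⟨ρ g v, hS g v hv, LinearMap.congr_fun (e.toIntertwiningMap.isIntertwining' g) v⟩ }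
  rcases hσ.eq_bot_or_eq_top T with h | h
  · refine absurd ?_ hne
    have h1 : S.map e.toLinearEquiv.toLinearMap = ⊥ := congrArg Subrepresentation.toSubmodule h
    exact Submodule.map_injective_of_injective e.toLinearEquiv.injective
      (h1.trans (Submodule.map_bot _).symm)
  · have h1 : S.map e.toLinearEquiv.toLinearMap = ⊤ := congrArg Subrepresentation.toSubmodule h
    refine Submodule.map_injective_of_injective e.toLinearEquiv.injective ?_
    rw [h1, Submodule.map_top, LinearEquiv.range]

theorem isIrreducible_generated_of_equiv {v : W} (hσ : σ.IsIrreducible)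
    (h : Nonempty ((generated ρ v).toRepresentation.Equiv σ)) (hv : v ≠ 0) :
    (generated ρ v).toRepresentation.IsIrreducible := by
  obtain ⟨e⟩ := h
  have : Nontrivial (generated ρ v).toSubmodule :=
    ⟨⟨⟨v, self_mem_generated ρ v⟩, 0, fun h => hv (congrArg Subtype.val h)⟩⟩
  exact isIrreducible_of_equiv e hσ

theorem isIrreducible_generated_of_finrank_eq_one {v : W}
    (h : Module.finrank k (generated ρ v).toSubmodule = 1) :
    (generated ρ v).toRepresentation.IsIrreducible :=
  isIrreducible_of_finrank_eq_one h

/-- A representation generated by a vector is reducible if another nonzero vector in it generates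
a different subrepresentation. -/
theorem not_isIrreducible_of_lt {v u : W} (hu0 : u ≠ 0)
    (hu : u ∈ (generated ρ v).toSubmodule)
    (hne : (generated ρ u).toSubmodule ≠ (generated ρ v).toSubmodule) :
    ¬ (generated ρ v).toRepresentation.IsIrreducible := by
  intro hirr
  let T : Subrepresentation (generated ρ v).toRepresentation :=
    { toSubmodule := (generated ρ u).toSubmodule.comap (generated ρ v).toSubmodule.subtype
      apply_mem_toSubmodule := fun g w hw => (generated ρ u).apply_mem_toSubmodule g hw }
  have hle : (generated ρ u).toSubmodule ≤ (generated ρ v).toSubmodule :=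
    generated_le ρ fun g => (generated ρ v).apply_mem_toSubmodule g hu
  rcases hirr.eq_bot_or_eq_top T with h | h
  · have h1 : (⟨u, hu⟩ : (generated ρ v).toSubmodule) ∈ T.toSubmodule := self_mem_generated ρ u
    rw [h] at h1
    exact hu0 (congrArg Subtype.val ((Submodule.mem_bot k).1 h1))
  · refine hne (le_antisymm hle fun w hw => ?_)
    have h1 : (⟨w, hw⟩ : (generated ρ v).toSubmodule) ∈ T.toSubmodule := by
      rw [h]; exact Submodule.mem_top
    exact h1

/-- A vector on which the group acts by scalars generates a line. -/
theorem generated_eq_span {v : W} (h : ∀ g, ∃ c : k, ρ g v = c • v) :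
    (generated ρ v).toSubmodule = Submodule.span k {v} := by
  refine le_antisymm (generated_le ρ fun g => ?_)
    ((Submodule.span_singleton_le_iff_mem _ _).2 (self_mem_generated ρ v))
  obtain ⟨c, hc⟩ := h g
  exact hc ▸ Submodule.smul_mem _ c (Submodule.mem_span_singleton_self v)

theorem finrank_generated_eq_one {v : W} (hv : v ≠ 0) (h : ∀ g, ∃ c : k, ρ g v = c • v) :
    Module.finrank k (generated ρ v).toSubmodule = 1 := by
  rw [generated_eq_span h, finrank_span_singleton hv]

end Generated

section Eigenvector

variable {k G W X : Type*} [Field k] [Group G] [AddCommGroup W] [Module k W] [Fintype X]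
  {H : Subgroup G} {ρ : Representation k G W} {v : W} {ε : W →ₗ[k] k} {rep : X → G}

/-- The character by which a subgroup acts on an eigenvector `v`, read off by a functional `ε` with
`ε v = 1`. -/
def eigenRep (ρ : Representation k G W) (v : W) (ε : W →ₗ[k] k) (h1 : ε v = 1)
    (hH : ∀ h ∈ H, ρ h v = ε (ρ h v) • v) : Representation k H k where
  toFun h := ε (ρ h v) • 1
  map_one' := by simp [h1]
  map_mul' g h := by
    have : ρ (g * h : H) v = (ε (ρ h v) * ε (ρ g v)) • v := by
      rw [Subgroup.coe_mul, map_mul, Module.End.mul_apply, hH h h.2, map_smul, hH g g.2, smul_smul]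
      simp [h1]
    rw [this, map_smul, h1]
    ext
    simp [mul_comm]

variable (h1 : ε v = 1) (hH : ∀ h ∈ H, ρ h v = ε (ρ h v) • v)

theorem eigenRep_apply (h : H) (c : k) : eigenRep ρ v ε h1 hH h c = ε (ρ h v) * c := rfl

variable (rep) in
/-- The map from the induced representation of the character of an eigenvector `v`, given by
`f ↦ ∑ f(g⁻¹) g v` over coset representatives `g`. -/
def eigenInd : cIndV (eigenRep ρ v ε h1 hH) →ₗ[k] W where
  toFun f := ∑ x, f.1 (rep x)⁻¹ • ρ (rep x) v
  map_add' f f' := by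
    rw [← Finset.sum_add_distrib]
    exact Finset.sum_congr rfl fun x _ => add_smul _ _ _
  map_smul' c f := by
    rw [Finset.smul_sum]
    exact Finset.sum_congr rfl fun x _ => mul_smul _ _ _

variable (hex : ∀ g, ∃ x, (rep x)⁻¹ * g ∈ H) (huniq : ∀ x y, (rep x)⁻¹ * rep y ∈ H → x = y)
include huniq in
theorem bracket_rep_apply [DecidableEq X] (χ : Representation k H k) (x y : X) :
    (bracket χ (rep x) 1).1 (rep y)⁻¹ = Pi.single (M := fun _ => k) x 1 y := by
  by_cases hxy : y = x
  · rw [hxy, bracket_apply_inv, Pi.single_eq_same]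
  · rw [Pi.single_eq_of_ne hxy, bracket_apply_of_notMem]
    exact fun h => hxy (huniq _ _ h)

include hex in
theorem cIndV_ext {χ : Representation k H k} {f f' : cIndV χ}
    (h : ∀ x, f.1 (rep x)⁻¹ = f'.1 (rep x)⁻¹) : f = f' := by
  refine Subtype.ext (funext fun g => ?_)
  obtain ⟨x, hx⟩ := hex g⁻¹
  have hx' : g * rep x ∈ H := by simpa using inv_mem hx
  rw [← mul_inv_cancel_right g (rep x), cIndV_mul χ f hx', cIndV_mul χ f' hx', h]

include hex huniq in
theorem finrank_cIndV (χ : Representation k H k) :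
    Module.finrank k (cIndV χ) = Fintype.card X := by
  classical
  let ev : cIndV χ →ₗ[k] (X → k) :=
    { toFun := fun f x => f.1 (rep x)⁻¹
      map_add' := fun _ _ => rfl
      map_smul' := fun _ _ => rfl }
  have hev : Function.Bijective ev := by
    constructor
    · exact fun f f' h => cIndV_ext hex fun x => congrFun h x
    · rw [← LinearMap.range_eq_top, eq_top_iff, ← (Pi.basisFun k X).span_eq, Submodule.span_le]
      rintro _ ⟨x, rfl⟩
      refine ⟨bracket χ (rep x) 1, funext fun y => ?_⟩
      rw [Pi.basisFun_apply]
      exact bracket_rep_apply huniq χ x y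
  rw [(LinearEquiv.ofBijective ev hev).finrank_eq, Module.finrank_fintype_fun_eq_card]

variable (h0 : ∀ g, g ∉ H → ε (ρ g v) = 0)
include hex huniq h0

/-- The functional `ε` recovers an element of the induced representation from its image. -/
theorem eigenInd_eval (f : cIndV (eigenRep ρ v ε h1 hH)) (g : G) :
    ε (ρ g (eigenInd rep h1 hH f)) = f.1 g := by
  obtain ⟨x, hx⟩ := hex g⁻¹
  have hx' : g * rep x ∈ H := by simpa using inv_mem hx
  change ε (ρ g (∑ x, f.1 (rep x)⁻¹ • ρ (rep x) v)) = _
  rw [map_sum, map_sum, Finset.sum_eq_single x]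
  · rw [map_smul, map_smul, ← Module.End.mul_apply, ← map_mul]
    conv_rhs => rw [← mul_inv_cancel_right g (rep x), cIndV_mul _ f hx', eigenRep_apply]
    rw [smul_eq_mul, mul_comm]
  · intro y _ hy
    rw [map_smul, map_smul, ← Module.End.mul_apply, ← map_mul, h0, smul_zero]
    intro h
    refine hy (huniq y x ?_)
    have := mul_mem (inv_mem h) hx'
    simpa [mul_assoc] using this
  · exact fun h => absurd (Finset.mem_univ x) h

theorem eigenInd_injective : Function.Injective (eigenInd (ρ := ρ) (v := v) rep h1 hH) :=
  fun f f' h => Subtype.ext (funext fun g => by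
    rw [← eigenInd_eval h1 hH hex huniq h0, h, eigenInd_eval h1 hH hex huniq h0])

theorem range_eigenInd :
    LinearMap.range (eigenInd rep h1 hH) = (generated ρ v).toSubmodule := by
  classical
  refine le_antisymm ?_ (generated_le ρ fun g => ?_)
  · rintro _ ⟨f, rfl⟩
    exact sum_mem fun x _ => Submodule.smul_mem _ _ (apply_mem_generated ρ v _)
  · obtain ⟨x, hx⟩ := hex g
    refine ⟨ε (ρ ((rep x)⁻¹ * g) v) • bracket _ (rep x) 1, ?_⟩
    rw [map_smul]
    have e : eigenInd rep h1 hH (bracket (eigenRep ρ v ε h1 hH) (rep x) 1) = ρ (rep x) v := by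
      change ∑ y, _ • _ = _
      rw [Finset.sum_eq_single x]
      · rw [bracket_apply_inv, one_smul]
      · intro y _ hy
        rw [bracket_rep_apply huniq, Pi.single_eq_of_ne hy, zero_smul]
      · exact fun h => absurd (Finset.mem_univ x) h
    rw [e, ← map_smul, ← hH _ hx, ← Module.End.mul_apply, ← map_mul, mul_inv_cancel_left]

theorem eigenInd_intertwining (g : G) (f : cIndV (eigenRep ρ v ε h1 hH)) :
    eigenInd rep h1 hH (cInd _ g f) = ρ g (eigenInd rep h1 hH f) := by
  have hmem : ρ g (eigenInd rep h1 hH f) ∈ LinearMap.range (eigenInd rep h1 hH) := by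
    have h := range_eigenInd h1 hH hex huniq h0
    rw [h]
    exact (generated ρ v).apply_mem_toSubmodule g (h ▸ ⟨f, rfl⟩)
  obtain ⟨f', hf'⟩ := hmem
  rw [← hf']
  congr 1
  refine Subtype.ext (funext fun y => ?_)
  rw [← eigenInd_eval h1 hH hex huniq h0 f', hf', cInd_apply, ← Module.End.mul_apply, ← map_mul,
    eigenInd_eval h1 hH hex huniq h0]

/-- A representation generated by an eigenvector of a subgroup of finite index is induced as soon
as the translates of the eigenvector under coset representatives are independent. -/
theorem generated_equiv_cInd :
    Nonempty ((generated ρ v).toRepresentation.Equiv (cInd (eigenRep ρ v ε h1 hH))) := by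
  let e : cIndV (eigenRep ρ v ε h1 hH) ≃ₗ[k] (generated ρ v).toSubmodule :=
    (LinearEquiv.ofInjective _ (eigenInd_injective h1 hH hex huniq h0)).trans
      (LinearEquiv.ofEq _ _ (range_eigenInd h1 hH hex huniq h0))
  refine ⟨(Representation.Equiv.mk e fun g => ?_).symm⟩
  refine LinearMap.ext fun u => Subtype.ext ?_
  exact eigenInd_intertwining h1 hH hex huniq h0 g u

include h1 hH in
theorem finrank_generated :
    Module.finrank k (generated ρ v).toSubmodule = Fintype.card X := by
  rw [← range_eigenInd h1 hH hex huniq h0,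
    LinearMap.finrank_range_of_inj (eigenInd_injective h1 hH hex huniq h0),
    finrank_cIndV hex huniq]

include h1 hH in
/-- Frobenius reciprocity: a functional `l` on which the subgroup acts by the character of an
eigenvector `v` gives an intertwining map. -/
theorem exists_frobenius_map {V : Type*} [AddCommGroup V] [Module k V] (σ : Representation k G V)
    (l : V →ₗ[k] k) (hl : ∀ h ∈ H, ∀ u, l (σ h u) = ε (ρ h v) * l u) :
    ∃ Φ : V →ₗ[k] W, (∀ g u, Φ (σ g u) = ρ g (Φ u)) ∧
      ∀ u, Φ u = ∑ x, l (σ (rep x)⁻¹ u) • ρ (rep x) v := by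
  classical
  let F : V → cIndV (eigenRep ρ v ε h1 hH) := fun u => ⟨fun g => l (σ g u), by
    refine ⟨fun h g => ?_, Finset.univ.image fun x => (rep x)⁻¹, fun g _ => ?_⟩
    · change l (σ (h * g) u) = _ * l (σ g u)
      rw [map_mul, Module.End.mul_apply, hl h h.2]
    · obtain ⟨x, hx⟩ := hex g⁻¹
      exact ⟨_, Finset.mem_image_of_mem _ (Finset.mem_univ x), by simpa using inv_mem hx⟩⟩
  let Φ : V →ₗ[k] W := ∑ x, (l.comp (σ (rep x)⁻¹)).smulRight (ρ (rep x) v)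
  have hΦ : ∀ u, Φ u = ∑ x, l (σ (rep x)⁻¹ u) • ρ (rep x) v := fun u => by
    rw [LinearMap.sum_apply]; rfl
  refine ⟨Φ, fun g u => ?_, hΦ⟩
  have h := eigenInd_intertwining h1 hH hex huniq h0 g (F u)
  have hF : cInd _ g (F u) = F (σ g u) := Subtype.ext (funext fun y => by
    change l (σ (y * g) u) = l (σ y (σ g u))
    rw [map_mul, Module.End.mul_apply])
  rw [hF] at h
  rw [hΦ, hΦ]
  exact h

end Eigenvector

/-! ### The action of the Iwahori subgroup on `s_n^0` -/

section Reduction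

variable {p : ℕ} [Fact p.Prime]
variable {D : Type*} [DivisionRing D] [Algebra ℚ_[p] D] [FiniteDimensional ℚ_[p] D]

instance : Fintype (residueRing p D) :=
  have : Finite (residueRing p D) := finite_residueRing
  Fintype.ofFinite _

open scoped Classical in
/-- The image in the coefficient field of the residue class of an element of `D`, extended by `0`
to the elements that are not integral. -/
def resChar (ι : residueRing p D →+* Coef p) (x : D) : Coef p :=
  if h : absNorm p D x ≤ 1 then ι (red p D ⟨x, h⟩) else 0

variable (ι : residueRing p D →+* Coef p)

theorem resChar_coe (x : integers p D) : resChar ι (x : D) = ι (red p D x) := dif_pos x.2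

theorem resChar_eq_of_lt {x y : D} (hx : absNorm p D x ≤ 1) (h : absNorm p D (x - y) < 1) :
    resChar ι x = resChar ι y := by
  have hy : absNorm p D y ≤ 1 := by
    have h1 := absNorm_sub_le_of_le p hx h.le
    rwa [sub_sub_cancel] at h1
  have e : red p D ⟨x, hx⟩ = red p D ⟨y, hy⟩ := (red_eq_iff p).2 h
  rw [resChar, resChar, dif_pos hx, dif_pos hy, e]

theorem resChar_eq_zero {x : D} (h : absNorm p D x < 1) : resChar ι x = 0 := by
  have e : red p D ⟨x, h.le⟩ = 0 := (red_eq_zero_iff p).2 h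
  rw [resChar, dif_pos h.le, e, map_zero]

theorem resChar_zero : resChar ι (0 : D) = 0 := resChar_eq_zero ι (by simp [absNorm_zero])

theorem resChar_one : resChar ι (1 : D) = 1 := by
  have h := resChar_coe ι (1 : integers p D)
  rwa [map_one, map_one] at h

theorem resChar_eq_one {x : D} (h : absNorm p D (x - 1) < 1) : resChar ι x = 1 := by
  rw [← resChar_one ι]
  refine (resChar_eq_of_lt ι (by rw [map_one]) ?_).symm
  rwa [← neg_sub, absNorm_neg]

/-- The reduction of a matrix over `𝒪_D`, as a matrix over the coefficient field. -/
def resMat (g : GL (Fin 2) D) : Matrix (Fin 2) (Fin 2) (Coef p) :=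
  Matrix.of fun i j => resChar ι (g.1 i j)

theorem resMat_eq (g : GL (Fin 2) D) : resMat ι g =
    !![resChar ι (g.1 0 0), resChar ι (g.1 0 1); resChar ι (g.1 1 0), resChar ι (g.1 1 1)] := by
  ext i j
  fin_cases i <;> fin_cases j <;> rfl

theorem wtAction_highest {m : ℕ} {r : Fin m → ℕ} {A : Matrix (Fin 2) (Fin 2) (Coef p)}
    (h : A 1 0 = 0) : wtAction p r A (highest p r) =
      A 0 0 ^ (∑ j : Fin m, p ^ (j : ℕ) * r j) • highest p r := by
  have hp : p ≠ 0 := (Fact.out : p.Prime).ne_zero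
  refine Subtype.ext ?_
  change subst p m A (∏ j, MvPolynomial.X (j, 0) ^ r j) =
    _ • (∏ j, MvPolynomial.X (j, 0) ^ r j : MvPolynomial (Fin m × Fin 2) (Coef p))
  rw [map_prod, MvPolynomial.smul_eq_C_mul, ← Finset.prod_pow_eq_pow_sum, map_prod,
    ← Finset.prod_mul_distrib]
  refine Finset.prod_congr rfl fun j _ => ?_
  rw [map_pow, subst, MvPolynomial.aeval_X]
  simp [h, hp, mul_pow, pow_mul]

end Reduction

section Action

variable {p : ℕ} [Fact p.Prime]
variable {D : Type*} [DivisionRing D] [Algebra ℚ_[p] D] [FiniteDimensional ℚ_[p] D]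
variable {m : ℕ} {r : Fin m → ℕ} {ϖ : Dˣ} {ι : residueRing p D →+* Coef p}
  {σ : Representation (Coef p) (KZZ p ϖ) (Wt p r)}

theorem scalarUnit_mem_KZZ (ϖ : Dˣ) : scalarUnit ϖ ∈ KZZ p ϖ :=
  Subgroup.mem_sup_right (Subgroup.mem_zpowers _)

theorem maxCompact_le_KZZ (ϖ : Dˣ) : maxCompact p D ≤ KZZ p ϖ :=
  le_sup_left.trans le_sup_left

theorem iwahori_le_KZZ (ϖ : Dˣ) : iwahori p D ≤ KZZ p ϖ :=
  iwahori_le_maxCompact.trans (maxCompact_le_KZZ ϖ)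

variable (hσ : ∀ g, σ (toKZZ ϖ g) = weight ι r g)
include hσ

/-- The group `GL₂(𝒪_D)` acts through the reduction. -/
theorem action_eq {g : GL (Fin 2) D} (hg : g ∈ maxCompact p D) (hK : g ∈ KZZ p ϖ) :
    σ ⟨g, hK⟩ = wtAction p r (resMat ι g) := by
  obtain ⟨k, rfl⟩ := hg
  refine (hσ k).trans ?_
  change wtAction p r _ = _
  congr 1
  ext i j
  exact (resChar_coe ι (k.1 i j)).symm

theorem iwahori_highest {g : GL (Fin 2) D} (hg : g ∈ iwahori p D) (hK : g ∈ KZZ p ϖ) :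
    σ ⟨g, hK⟩ (highest p r) =
      resChar ι (g.1 0 0) ^ (∑ j : Fin m, p ^ (j : ℕ) * r j) • highest p r := by
  rw [action_eq hσ (iwahori_le_maxCompact hg) hK, wtAction_highest]
  · rfl
  · exact resChar_eq_zero ι ((mem_iwahori_iff (ϖ := ϖ)).1 hg).2

theorem upper_action {x : D} (hx : absNorm p D x ≤ 1) (hK : affineUnit 1 x ∈ KZZ p ϖ) :
    σ ⟨affineUnit 1 x, hK⟩ = wtAction p r !![1, resChar ι x; 0, 1] := by
  rw [action_eq hσ (iwahori_le_maxCompact (proPIwahori_le_iwahori (upper_mem_proPIwahori hx))) hK,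
    resMat_eq]
  simp [affineUnit_val, resChar_zero, resChar_one]

theorem upper_highest {x : D} (hx : absNorm p D x ≤ 1) (hK : affineUnit 1 x ∈ KZZ p ϖ) :
    σ ⟨affineUnit 1 x, hK⟩ (highest p r) = highest p r := by
  rw [iwahori_highest hσ (proPIwahori_le_iwahori (upper_mem_proPIwahori hx)) hK, affineUnit_val]
  simp [resChar_one]

variable (hr : ∀ j, r j ≤ p - 1) (hκ : Fintype.card (residueRing p D) = p ^ m)
include hr hκ

/-- Conjugation by `ϖ` preserves the upper triangular unipotent matrices over `𝒪_D`, hence `ϖ`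
preserves the line of their fixed vectors. -/
theorem exists_scalar_eigenvalue : ∃ c : Coef p, c ≠ 0 ∧
    σ ⟨scalarUnit ϖ, scalarUnit_mem_KZZ ϖ⟩ (highest p r) = c • highest p r := by
  have hpos := uniformizer_pos (p := p) ϖ
  obtain ⟨c, hc⟩ := eq_smul_highest_of_fixed hr (residue_hom_injective p ι) hκ
    (P := σ ⟨scalarUnit ϖ, scalarUnit_mem_KZZ ϖ⟩ (highest p r)) (fun x => by
      obtain ⟨y, rfl⟩ := red_surjective p x
      have hy' : absNorm p D (((ϖ⁻¹ : Dˣ) : D) * y * ϖ) ≤ 1 := by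
        rw [map_mul, map_mul, absNorm_val_inv, mul_right_comm, inv_mul_cancel₀ hpos.ne', one_mul]
        exact y.2
      have hK := iwahori_le_KZZ ϖ (proPIwahori_le_iwahori (upper_mem_proPIwahori y.2))
      have hK' := iwahori_le_KZZ ϖ (proPIwahori_le_iwahori (upper_mem_proPIwahori hy'))
      rw [← resChar_coe, ← upper_action hσ y.2 hK, ← Module.End.mul_apply, ← map_mul]
      have e : (⟨affineUnit 1 (y : D), hK⟩ : KZZ p ϖ) * ⟨scalarUnit ϖ, scalarUnit_mem_KZZ ϖ⟩ =
          ⟨scalarUnit ϖ, scalarUnit_mem_KZZ ϖ⟩ *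
            ⟨affineUnit 1 (((ϖ⁻¹ : Dˣ) : D) * y * ϖ), hK'⟩ := by
        refine Subtype.ext ?_
        apply GL2_ext <;> simp [GL2_mul_apply, affineUnit_val, scalarUnit_val, mul_assoc]
      rw [e, map_mul, Module.End.mul_apply, upper_highest hσ hy'])
  refine ⟨c, fun h0 => ?_, hc⟩
  rw [h0, zero_smul] at hc
  have h1 := congrArg (σ ⟨scalarUnit ϖ, scalarUnit_mem_KZZ ϖ⟩⁻¹) hc
  rw [← Module.End.mul_apply, ← map_mul, inv_mul_cancel, map_one, map_zero] at h1
  exact highest_ne_zero h1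

/-- The character of the torus on `⊗ x_j^{r_j}` is invariant under conjugation by `ϖ`. -/
theorem resChar_conj_pow {u : D} (hu : absNorm p D u = 1) :
    resChar ι (((ϖ⁻¹ : Dˣ) : D) * u * ϖ) ^ (∑ j : Fin m, p ^ (j : ℕ) * r j) =
      resChar ι u ^ (∑ j : Fin m, p ^ (j : ℕ) * r j) := by
  have hpos := uniformizer_pos (p := p) ϖ
  have hu0 : u ≠ 0 := fun h => by rw [h, absNorm_zero] at hu; exact zero_ne_one hu
  obtain ⟨c, hc0, hc⟩ := exists_scalar_eigenvalue hσ hr hκ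
  have hI : ∀ a : Dˣ, absNorm p D (a : D) = 1 → lowerUnit a 0 1 ∈ iwahori p D := fun a ha =>
    (mem_iwahori_iff (ϖ := ϖ)).2 ⟨isScaled_of_lower rfl (by simpa [lowerUnit_val] using ha)
      (by simp [lowerUnit_val]) (by simp [lowerUnit_val, absNorm_zero]),
      by simp [lowerUnit_val, absNorm_zero]⟩
  have h1 := hI (Units.mk0 u hu0) hu
  have h2 := hI (ϖ⁻¹ * Units.mk0 u hu0 * ϖ) (by
    rw [Units.val_mul, Units.val_mul, map_mul, map_mul, absNorm_val_inv, Units.val_mk0, hu,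
      mul_one, inv_mul_cancel₀ hpos.ne'])
  have e : (⟨lowerUnit (Units.mk0 u hu0) 0 1, iwahori_le_KZZ ϖ h1⟩ : KZZ p ϖ) *
      ⟨scalarUnit ϖ, scalarUnit_mem_KZZ ϖ⟩ = ⟨scalarUnit ϖ, scalarUnit_mem_KZZ ϖ⟩ *
        ⟨lowerUnit (ϖ⁻¹ * Units.mk0 u hu0 * ϖ) 0 1, iwahori_le_KZZ ϖ h2⟩ := by
    refine Subtype.ext ?_
    apply GL2_ext <;> simp [GL2_mul_apply, lowerUnit_val, scalarUnit_val, mul_assoc]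
  have h3 := congrArg (fun g => σ g (highest p r)) e
  simp only [map_mul, Module.End.mul_apply] at h3
  rw [hc, map_smul, iwahori_highest hσ h1, iwahori_highest hσ h2, map_smul, hc, smul_comm] at h3
  have h4 := smul_left_injective (Coef p) (smul_ne_zero hc0 (highest_ne_zero (r := r))) h3
  exact h4.symm

theorem resChar_conj_pow_pow (n : ℕ) {u : D} (hu : absNorm p D u = 1) :
    resChar ι ((((ϖ ^ n)⁻¹ : Dˣ) : D) * u * ((ϖ ^ n : Dˣ) : D)) ^
        (∑ j : Fin m, p ^ (j : ℕ) * r j) =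
      resChar ι u ^ (∑ j : Fin m, p ^ (j : ℕ) * r j) := by
  have hpos := uniformizer_pos (p := p) ϖ
  induction n with
  | zero => simp
  | succ n ih =>
    have h1 : absNorm p D ((((ϖ ^ n)⁻¹ : Dˣ) : D) * u * ((ϖ ^ n : Dˣ) : D)) = 1 := by
      have h := pow_pos hpos n
      rw [map_mul, map_mul, absNorm_val_inv, hu, mul_one, Units.val_pow_eq_pow_val, map_pow,
        inv_mul_cancel₀ h.ne']
    rw [← ih, ← resChar_conj_pow hσ hr hκ h1, pow_succ, mul_inv_rev, Units.val_mul, Units.val_mul]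
    simp only [mul_assoc]

end Action

section SVec

variable {p : ℕ} [Fact p.Prime]
variable {D : Type*} [DivisionRing D] [Algebra ℚ_[p] D] [FiniteDimensional ℚ_[p] D]
variable {m : ℕ} {r : Fin m → ℕ} {ϖ : Dˣ} {ι : residueRing p D →+* Coef p}
  {τ : residueRing p D →*₀ integers p D}
  {σ : Representation (Coef p) (KZZ p ϖ) (Wt p r)}

theorem sVec_eq_sum (τ : residueRing p D →*₀ integers p D)
    (σ : Representation (Coef p) (KZZ p ϖ) (Wt p r)) (n : ℕ) :
    sVec ϖ τ σ n = ∑ μ : Fin n → residueRing p D,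
      bracket σ (affineUnit (ϖ ^ n) (digitSum ϖ τ μ)) (highest p r) :=
  finsum_eq_sum_of_fintype _

theorem sVec_apply (τ : residueRing p D →*₀ integers p D)
    (σ : Representation (Coef p) (KZZ p ϖ) (Wt p r)) (n : ℕ) (x : GL (Fin 2) D) :
    (sVec ϖ τ σ n).1 x = ∑ μ : Fin n → residueRing p D,
      (bracket σ (affineUnit (ϖ ^ n) (digitSum ϖ τ μ)) (highest p r)).1 x := by
  rw [sVec_eq_sum, Submodule.coe_sum, Finset.sum_apply]

theorem affineUnit_eq_mul_upper (n : ℕ) (μ ν : D) :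
    affineUnit (ϖ ^ n) μ =
      affineUnit (ϖ ^ n) ν * affineUnit 1 ((((ϖ ^ n)⁻¹ : Dˣ) : D) * (μ - ν)) := by
  rw [affineUnit_mul_upper, Units.mul_inv_cancel_left, sub_add_cancel]

theorem absNorm_inv_mul_le {n : ℕ} {x : D} (h : absNorm p D x ≤ absNorm p D (ϖ : D) ^ n) :
    absNorm p D ((((ϖ ^ n)⁻¹ : Dˣ) : D) * x) ≤ 1 := by
  have hpos := pow_pos (uniformizer_pos (p := p) ϖ) n
  rwa [map_mul, absNorm_val_inv, Units.val_pow_eq_pow_val, map_pow, inv_mul_le_iff₀ hpos, mul_one]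

variable (hσ : ∀ g, σ (toKZZ ϖ g) = weight ι r g)

variable (hϖ : IsUniformizer p ϖ) (hτ : ∀ x, red p D (τ x) = x)
include hϖ hτ hσ

/-- An element of `GL₂(D)` that maps the vertices `(ϖ^n μ; 0 1)` to such vertices, with the same
scalar at each of them, permutes them and hence multiplies `s_n^0` by this scalar. -/
theorem cInd_sVec_of_forall {n : ℕ} {h : GL (Fin 2) D} {θ : Coef p}
    (H : ∀ μ : D, absNorm p D μ ≤ 1 → ∃ μ' : D, absNorm p D μ' ≤ 1 ∧
      ∃ (k : GL (Fin 2) D) (hk : k ∈ KZZ p ϖ),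
        h * affineUnit (ϖ ^ n) μ = affineUnit (ϖ ^ n) μ' * k ∧
          σ ⟨k, hk⟩ (highest p r) = θ • highest p r) :
    cInd σ h (sVec ϖ τ σ n) = θ • sVec ϖ τ σ n := by
  have H' : ∀ μ : Fin n → residueRing p D, ∃ ν : Fin n → residueRing p D,
      ∃ (k : GL (Fin 2) D) (hk : k ∈ KZZ p ϖ),
        h * affineUnit (ϖ ^ n) (digitSum ϖ τ μ) = affineUnit (ϖ ^ n) (digitSum ϖ τ ν) * k ∧
          σ ⟨k, hk⟩ (highest p r) = θ • highest p r := by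
    intro μ
    obtain ⟨μ', hμ', k, hk, e, hs⟩ := H _ (absNorm_digitSum_le hϖ τ μ)
    obtain ⟨ν, hν⟩ := digitSum_exists hϖ hτ n hμ'
    have hx := absNorm_inv_mul_le hν
    have hI := upper_mem_proPIwahori hx
    have hK := iwahori_le_KZZ ϖ (proPIwahori_le_iwahori hI)
    refine ⟨ν, _ * k, mul_mem hK hk, ?_, ?_⟩
    · rw [e, affineUnit_eq_mul_upper n μ' (digitSum ϖ τ ν), mul_assoc]
    · have e2 : (⟨_ * k, mul_mem hK hk⟩ : KZZ p ϖ) = ⟨_, hK⟩ * ⟨k, hk⟩ := rfl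
      rw [e2, map_mul, Module.End.mul_apply, hs, map_smul, upper_highest hσ hx]
  choose π k hk e hs using H'
  -- `π` is injective, hence a permutation of the digits
  have hπ : Function.Injective π := fun μ ν h1 => by
    refine digitSum_unique hϖ hτ (affineUnit_coset_eq hϖ (?_ : (affineUnit (ϖ ^ n) _)⁻¹ *
      affineUnit (ϖ ^ n) _ ∈ KZZ p ϖ)).2
    have h2 : (affineUnit (ϖ ^ n) (digitSum ϖ τ ν))⁻¹ * affineUnit (ϖ ^ n) (digitSum ϖ τ μ) =
        (k ν)⁻¹ * k μ := by
      rw [← mul_right_inj (h * affineUnit (ϖ ^ n) (digitSum ϖ τ ν)), mul_assoc h,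
        mul_inv_cancel_left, e, e, h1, mul_assoc, mul_inv_cancel_left]
    rw [h2]
    exact mul_mem (inv_mem (hk ν)) (hk μ)
  rw [sVec_eq_sum, map_sum, Finset.smul_sum]
  refine Eq.trans ?_ (Equiv.sum_comp (Equiv.ofBijective π (Finite.injective_iff_bijective.1 hπ))
    fun ν => θ • bracket σ (affineUnit (ϖ ^ n) (digitSum ϖ τ ν)) (highest p r))
  refine Finset.sum_congr rfl fun μ _ => ?_
  rw [cInd_bracket, e, bracket_mul σ _ (hk μ), hs]
  exact (bracketHom σ _).map_smul _ _

theorem scalar_sVec {c : Coef p}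
    (hc : σ ⟨scalarUnit ϖ, scalarUnit_mem_KZZ ϖ⟩ (highest p r) = c • highest p r) (n : ℕ) :
    cInd σ (scalarUnit ϖ) (sVec ϖ τ σ n) = c • sVec ϖ τ σ n := by
  refine cInd_sVec_of_forall hσ hϖ hτ fun μ hμ =>
    ⟨ϖ * μ * ((ϖ⁻¹ : Dˣ) : D), ?_, _, scalarUnit_mem_KZZ ϖ, scalarUnit_mul_affineUnit _ _ _, hc⟩
  rw [map_mul, map_mul, absNorm_val_inv, mul_right_comm,
    mul_inv_cancel₀ (uniformizer_pos (p := p) ϖ).ne', one_mul]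
  exact hμ

theorem scalar_betaVec {c : Coef p}
    (hc : σ ⟨scalarUnit ϖ, scalarUnit_mem_KZZ ϖ⟩ (highest p r) = c • highest p r) (n : ℕ) :
    cInd σ (scalarUnit ϖ) (betaVec ϖ τ σ n) = c • betaVec ϖ τ σ n := by
  rw [betaVec, ← Module.End.mul_apply, ← map_mul, scalarUnit_mul_betaUnit, map_mul,
    Module.End.mul_apply, scalar_sVec hσ hϖ hτ hc, map_smul]

variable (hr : ∀ j, r j ≤ p - 1) (hκ : Fintype.card (residueRing p D) = p ^ m)
include hr hκ

/-- `I` permutes the vertices `(ϖ^n μ; 0 1)`, and the stabilizing elements have upper left entry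
congruent to the conjugate of that of `g` by `ϖ^n`, which does not change the character. -/
theorem iwahori_sVec {g : GL (Fin 2) D} (hg : g ∈ iwahori p D) (n : ℕ) :
    cInd σ g (sVec ϖ τ σ n) =
      resChar ι (g.1 0 0) ^ (∑ j : Fin m, p ^ (j : ℕ) * r j) • sVec ϖ τ σ n := by
  refine cInd_sVec_of_forall hσ hϖ hτ fun μ hμ => ?_
  obtain ⟨μ', hμ', k, hk, e, hlt⟩ := iwahori_mul_affineUnit hϖ hg n hμ
  refine ⟨μ', hμ', k, iwahori_le_KZZ ϖ hk, e, ?_⟩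
  rw [iwahori_highest hσ hk, resChar_eq_of_lt ι (iwahori_diag hk).1.le hlt,
    resChar_conj_pow_pow hσ hr hκ n (iwahori_diag hg).1]

theorem iwahori_betaVec {g : GL (Fin 2) D} (hg : g ∈ iwahori p D) (n : ℕ) :
    cInd σ g (betaVec ϖ τ σ n) =
      resChar ι (g.1 1 1) ^ (∑ j : Fin m, p ^ (j : ℕ) * r j) • betaVec ϖ τ σ n := by
  have e : g * betaUnit ϖ = betaUnit ϖ * ((betaUnit ϖ)⁻¹ * g * betaUnit ϖ) := by
    rw [mul_assoc, mul_inv_cancel_left]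
  rw [betaVec, ← Module.End.mul_apply, ← map_mul, e, map_mul, Module.End.mul_apply,
    iwahori_sVec hσ hϖ hτ hr hκ (beta_conj_mem_iwahori hϖ hg), map_smul, beta_conj_entries hϖ]
  congr 1
  exact resChar_conj_pow hσ hr hκ (iwahori_diag hg).2

theorem proPIwahori_sVec {g : GL (Fin 2) D} (hg : g ∈ proPIwahori p D) (n : ℕ) :
    cInd σ g (sVec ϖ τ σ n) = sVec ϖ τ σ n := by
  rw [iwahori_sVec hσ hϖ hτ hr hκ (proPIwahori_le_iwahori hg),
    resChar_eq_one ι ((mem_proPIwahori_iff (ϖ := ϖ)).1 hg).2.2.1, one_pow, one_smul]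

theorem proPIwahori_betaVec {g : GL (Fin 2) D} (hg : g ∈ proPIwahori p D) (n : ℕ) :
    cInd σ g (betaVec ϖ τ σ n) = betaVec ϖ τ σ n := by
  rw [iwahori_betaVec hσ hϖ hτ hr hκ (proPIwahori_le_iwahori hg),
    resChar_eq_one ι ((mem_proPIwahori_iff (ϖ := ϖ)).1 hg).2.2.2, one_pow, one_smul]

end SVec

/-! ### The basis of the `I(1)`-invariants -/

section Vertices

variable {p : ℕ} [Fact p.Prime]
variable {D : Type*} [DivisionRing D] [Algebra ℚ_[p] D] [FiniteDimensional ℚ_[p] D]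
variable {m : ℕ} {r : Fin m → ℕ} {ϖ : Dˣ} {ι : residueRing p D →+* Coef p}
  {τ : residueRing p D →*₀ integers p D}
  {σ : Representation (Coef p) (KZZ p ϖ) (Wt p r)}

/-- Representatives of the double cosets in `I(1) \ G / KZZ'`: the matrices `(ϖ^n 0; 0 1)` and
their multiples by `β`. -/
def baseVertex (ϖ : Dˣ) : ℕ ⊕ ℕ → GL (Fin 2) D :=
  Sum.elim (fun n => affineUnit (ϖ ^ n) 0) fun n => betaUnit ϖ * affineUnit (ϖ ^ n) 0

/-- The family of the vectors `s_n^0` and `β s_n^0`. -/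
def invariantVec (τ : residueRing p D →*₀ integers p D)
    (σ : Representation (Coef p) (KZZ p ϖ) (Wt p r)) : ℕ ⊕ ℕ → cIndV σ :=
  Sum.elim (sVec ϖ τ σ) (betaVec ϖ τ σ)

theorem sVec_apply_eq_zero {n : ℕ} {x : GL (Fin 2) D}
    (h : ∀ μ : Fin n → residueRing p D, x * affineUnit (ϖ ^ n) (digitSum ϖ τ μ) ∉ KZZ p ϖ) :
    (sVec ϖ τ σ n).1 x = 0 := by
  rw [sVec_apply]
  exact Finset.sum_eq_zero fun μ _ => bracket_apply_of_notMem σ _ (h μ)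

variable (hϖ : IsUniformizer p ϖ)
include hϖ

theorem betaUnit_affineUnit_notMem {n k : ℕ} {μ ν : D} (hμ : absNorm p D μ ≤ 1)
    (hν : absNorm p D ν ≤ 1) :
    (betaUnit ϖ * affineUnit (ϖ ^ n) μ)⁻¹ * affineUnit (ϖ ^ k) ν ∉ KZZ p ϖ := fun h => by
  refine affineUnit_beta_notMem hϖ hμ hν (n := n) (m := k) ?_
  simpa using inv_mem h

theorem baseVertex_coset_eq {i j : ℕ ⊕ ℕ} (h : (baseVertex ϖ i)⁻¹ * baseVertex ϖ j ∈ KZZ p ϖ) :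
    i = j := by
  have h0 : absNorm p D (0 : D) ≤ 1 := by simp [absNorm_zero]
  rcases i with n | n <;> rcases j with k | k
  · exact congrArg _ (affineUnit_coset_eq hϖ h).1
  · exact absurd h (affineUnit_beta_notMem hϖ h0 h0)
  · exact absurd h (betaUnit_affineUnit_notMem hϖ h0 h0)
  · refine congrArg _ (affineUnit_coset_eq hϖ (n := k) (m := n) (μ := 0) (ν := 0) ?_).1
    simpa [baseVertex, mul_assoc] using h

/-- The upper triangular unipotent matrices are conjugate into `I(1)` by the base vertices. -/
theorem exists_baseVertex_mul_upper (i : ℕ ⊕ ℕ) {x : D} (hx : absNorm p D x ≤ 1) :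
    ∃ g ∈ proPIwahori p D, g * baseVertex ϖ i = baseVertex ϖ i * affineUnit 1 x := by
  have hx' : ∀ n : ℕ, absNorm p D (((ϖ ^ n : Dˣ) : D) * x) ≤ 1 := fun n => by
    rw [map_mul, Units.val_pow_eq_pow_val, map_pow]
    exact mul_le_one₀ (pow_le_one₀ (absNorm_nonneg p D _) hϖ.lt_one.le) (absNorm_nonneg p D _) hx
  rcases i with n | n
  · refine ⟨_, upper_mem_proPIwahori (hx' n), ?_⟩
    change _ * affineUnit _ _ = affineUnit _ _ * _
    rw [upper_mul_affineUnit, affineUnit_mul_upper, zero_add, add_zero]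
  · refine ⟨_, lower_mem_proPIwahori hϖ (hx' n), ?_⟩
    change _ * (betaUnit ϖ * affineUnit _ _) = betaUnit ϖ * affineUnit _ _ * _
    rw [mul_assoc, affineUnit_mul_upper, add_zero, betaUnit_mul_affineUnit ϖ (ϖ ^ n) (_ * x)]

theorem exists_proPIwahori_decomposition (g : GL (Fin 2) D) :
    ∃ i, ∃ u ∈ proPIwahori p D, ∃ k ∈ KZZ p ϖ, g = u * baseVertex ϖ i * k := by
  obtain ⟨n, μ, hμ, k, hk, h | h⟩ := exists_decomposition hϖ g
  · refine ⟨Sum.inl n, _, upper_mem_proPIwahori hμ, k, hk, h.trans ?_⟩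
    change _ = _ * affineUnit _ _ * _
    rw [upper_mul_affineUnit, zero_add]
  · refine ⟨Sum.inr n, _, lower_mem_proPIwahori hϖ hμ, k, hk, h.trans ?_⟩
    change _ = _ * (betaUnit ϖ * affineUnit _ _) * _
    rw [← betaUnit_mul_affineUnit]

/-- An `I(1)`-invariant function is determined by its values at the inverses of the base
vertices. -/
theorem ext_of_proPIwahori_invariant {f f' : cIndV σ}
    (hf : ∀ u ∈ proPIwahori p D, cInd σ u f = f) (hf' : ∀ u ∈ proPIwahori p D, cInd σ u f' = f')
    (h : ∀ i, f.1 (baseVertex ϖ i)⁻¹ = f'.1 (baseVertex ϖ i)⁻¹) : f = f' := by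
  refine Subtype.ext (funext fun g => ?_)
  obtain ⟨i, u, hu, k, hk, e⟩ := exists_proPIwahori_decomposition hϖ g⁻¹
  have e' : g = k⁻¹ * ((baseVertex ϖ i)⁻¹ * u⁻¹) := by
    rw [← inv_inv g, e]; simp [mul_assoc]
  rw [e', cIndV_mul σ f (inv_mem hk), cIndV_mul σ f' (inv_mem hk), ← cInd_apply, ← cInd_apply,
    hf _ (inv_mem hu), hf' _ (inv_mem hu), h]

/-- The values of an `I(1)`-invariant function at the base vertices are fixed by the upper
triangular unipotent matrices, hence are multiples of `⊗ x_j^{r_j}`. -/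
theorem apply_baseVertex_eq_smul (hσ : ∀ g, σ (toKZZ ϖ g) = weight ι r g)
    (hr : ∀ j, r j ≤ p - 1) (hκ : Fintype.card (residueRing p D) = p ^ m) {f : cIndV σ}
    (hf : ∀ u ∈ proPIwahori p D, cInd σ u f = f) (i : ℕ ⊕ ℕ) :
    ∃ c : Coef p, f.1 (baseVertex ϖ i)⁻¹ = c • highest p r := by
  refine eq_smul_highest_of_fixed hr (residue_hom_injective p ι) hκ fun x => ?_
  obtain ⟨y, rfl⟩ := red_surjective p x
  obtain ⟨g, hg, e⟩ := exists_baseVertex_mul_upper hϖ i y.2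
  have hK := iwahori_le_KZZ ϖ (proPIwahori_le_iwahori (upper_mem_proPIwahori y.2))
  rw [← resChar_coe, ← upper_action hσ y.2 hK, ← cIndV_mul]
  have e2 : affineUnit 1 (y : D) * (baseVertex ϖ i)⁻¹ = (baseVertex ϖ i)⁻¹ * g := by
    rw [eq_inv_mul_iff_mul_eq, ← mul_assoc, ← e, mul_inv_cancel_right]
  rw [e2, ← cInd_apply, hf g hg]

variable (hτ : ∀ x, red p D (τ x) = x)
include hτ

theorem sVec_apply_inv (σ : Representation (Coef p) (KZZ p ϖ) (Wt p r)) (n : ℕ) :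
    (sVec ϖ τ σ n).1 (affineUnit (ϖ ^ n) 0)⁻¹ = highest p r := by
  have h0 : digitSum ϖ τ (0 : Fin n → residueRing p D) = 0 := by simp [digitSum]
  rw [sVec_apply, Finset.sum_eq_single 0]
  · rw [h0, bracket_apply_inv]
  · refine fun μ _ hμ => bracket_apply_of_notMem σ _ fun h => hμ (digitSum_unique hϖ hτ ?_)
    rw [h0]
    exact (affineUnit_coset_eq hϖ h).2
  · exact fun h => absurd (Finset.mem_univ _) h

theorem invariantVec_apply_self (i : ℕ ⊕ ℕ) :
    (invariantVec τ σ i).1 (baseVertex ϖ i)⁻¹ = highest p r := by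
  rcases i with n | n
  · exact sVec_apply_inv hϖ hτ σ n
  · change (sVec ϖ τ σ n).1 ((betaUnit ϖ * affineUnit _ _)⁻¹ * betaUnit ϖ) = _
    rw [mul_inv_rev, inv_mul_cancel_right, sVec_apply_inv hϖ hτ]

omit hτ in
theorem invariantVec_apply_of_ne {i j : ℕ ⊕ ℕ} (hij : i ≠ j) :
    (invariantVec τ σ i).1 (baseVertex ϖ j)⁻¹ = 0 := by
  have h0 : absNorm p D (0 : D) ≤ 1 := by simp [absNorm_zero]
  have hd : ∀ (n : ℕ) (μ : Fin n → residueRing p D), absNorm p D (digitSum ϖ τ μ) ≤ 1 :=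
    fun n μ => absNorm_digitSum_le hϖ τ μ
  have hs : ∀ n k : ℕ, n ≠ k → (sVec ϖ τ σ n).1 (affineUnit (ϖ ^ k) 0)⁻¹ = 0 := fun n k hnk =>
    sVec_apply_eq_zero fun μ h => hnk (affineUnit_coset_eq hϖ h).1.symm
  rcases i with n | n <;> rcases j with k | k
  · exact hs n k fun h => hij (congrArg _ h)
  · exact sVec_apply_eq_zero fun μ => betaUnit_affineUnit_notMem hϖ h0 (hd n μ)
  · change (sVec ϖ τ σ n).1 ((affineUnit _ _)⁻¹ * betaUnit ϖ) = _
    refine sVec_apply_eq_zero fun μ => ?_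
    rw [mul_assoc]
    exact affineUnit_beta_notMem hϖ (hd n μ) h0
  · change (sVec ϖ τ σ n).1 ((betaUnit ϖ * affineUnit _ _)⁻¹ * betaUnit ϖ) = _
    rw [mul_inv_rev, inv_mul_cancel_right]
    exact hs n k fun h => hij (congrArg _ h)

theorem linearIndependent_invariantVec :
    LinearIndependent (Coef p) (invariantVec τ σ) :=
  linearIndependent_of_apply (y := fun i => (baseVertex ϖ i)⁻¹)
    (fun i => by rw [invariantVec_apply_self hϖ hτ]; exact highest_ne_zero)
    fun _ _ hij => invariantVec_apply_of_ne hϖ hij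

omit hτ in
/-- An element of the compact induction is nonzero at finitely many base vertices only, since these
lie in different cosets. -/
theorem finite_apply_baseVertex_ne_zero (f : cIndV σ) :
    {i | f.1 (baseVertex ϖ i)⁻¹ ≠ 0}.Finite := by
  obtain ⟨S, hS⟩ := f.2.2
  choose! s hs hs' using fun i (hi : f.1 (baseVertex ϖ i)⁻¹ ≠ 0) => hS _ hi
  refine Set.Finite.of_finite_image (f := s) (S.finite_toSet.subset ?_) ?_
  · rintro _ ⟨i, hi, rfl⟩
    exact hs i hi
  · intro i hi j hj hij
    refine baseVertex_coset_eq hϖ ?_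
    have h := mul_mem (hs' i hi) (inv_mem (hs' j hj))
    simpa [hij] using h

variable (hσ : ∀ g, σ (toKZZ ϖ g) = weight ι r g)
  (hr : ∀ j, r j ≤ p - 1) (hκ : Fintype.card (residueRing p D) = p ^ m)
include hσ hr hκ

theorem proPIwahori_invariantVec {u : GL (Fin 2) D} (hu : u ∈ proPIwahori p D) (i : ℕ ⊕ ℕ) :
    cInd σ u (invariantVec τ σ i) = invariantVec τ σ i := by
  rcases i with n | n
  · exact proPIwahori_sVec hσ hϖ hτ hr hκ hu n
  · exact proPIwahori_betaVec hσ hϖ hτ hr hκ hu n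

theorem mem_span_invariantVec {f : cIndV σ} (hf : ∀ u ∈ proPIwahori p D, cInd σ u f = f) :
    f ∈ Submodule.span (Coef p) (Set.range (invariantVec τ σ)) := by
  classical
  choose c hc using apply_baseVertex_eq_smul hϖ hσ hr hκ hf
  set S := (finite_apply_baseVertex_ne_zero hϖ f).toFinset
  have h : f = ∑ i ∈ S, c i • invariantVec τ σ i := by
    refine ext_of_proPIwahori_invariant hϖ hf (fun u hu => ?_) fun j => ?_
    · rw [map_sum]
      exact Finset.sum_congr rfl fun i _ => by
        rw [map_smul, proPIwahori_invariantVec hϖ hτ hσ hr hκ hu]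
    · simp only [Submodule.coe_sum, Finset.sum_apply, Submodule.coe_smul, Pi.smul_apply]
      by_cases hj : j ∈ S
      · rw [Finset.sum_eq_single j (fun i _ hi => by
          rw [invariantVec_apply_of_ne hϖ hi, smul_zero]) (fun h => absurd hj h),
          invariantVec_apply_self hϖ hτ, hc]
      · rw [Finset.sum_eq_zero fun i hi => by
          rw [invariantVec_apply_of_ne hϖ (ne_of_mem_of_not_mem hi hj), smul_zero]]
        by_contra hne
        exact hj ((Set.Finite.mem_toFinset _).2 hne)
  rw [h]
  exact sum_mem fun i _ => Submodule.smul_mem _ _ (Submodule.subset_span ⟨i, rfl⟩)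

/-- The basis property: the values at the base vertices show the independence, and determine an
invariant function. -/
theorem exists_basis_invariants :
    ∃ b : Module.Basis (ℕ ⊕ ℕ) (Coef p) (resProP σ).invariants,
      ∀ n : ℕ, (b (Sum.inl n)).1 = sVec ϖ τ σ n ∧ (b (Sum.inr n)).1 = betaVec ϖ τ σ n := by
  obtain ⟨b, hb⟩ := exists_basis_invariants_of_span (ρ := resProP σ)
    (fun u => proPIwahori_invariantVec hϖ hτ hσ hr hκ u.2) (linearIndependent_invariantVec hϖ hτ)
    fun f hf => mem_span_invariantVec hϖ hτ hσ hr hκ fun u hu => hf ⟨u, hu⟩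
  exact ⟨b, fun n => ⟨hb _, hb _⟩⟩

end Vertices

/-! ### The cosets `KZZ'/IZZ'` and the irreducibility of the weight -/

section CommonEigen

variable {k G V W : Type*} [Field k] [Group G] [AddCommGroup V] [Module k V] [AddCommGroup W]
  [Module k W]

/-- The subgroup of the elements that act on the vector `v` and on the functional `l` by the same
nonzero scalar. -/
def commonEigen (ρ : Representation k G W) (v : W) (σ : Representation k G V) (l : V →ₗ[k] k) :
    Subgroup G where
  carrier := {g | ∃ c : kˣ, ρ g v = (c : k) • v ∧ ∀ u, l (σ g u) = c * l u}
  one_mem' := ⟨1, by simp, by simp⟩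
  mul_mem' := by
    rintro g h ⟨c, hc, hc'⟩ ⟨d, hd, hd'⟩
    refine ⟨c * d, ?_, fun u => ?_⟩
    · rw [map_mul, Module.End.mul_apply, hd, map_smul, hc, smul_smul, Units.val_mul, mul_comm]
    · rw [map_mul, Module.End.mul_apply, hc', hd', Units.val_mul, mul_assoc]
  inv_mem' := by
    rintro g ⟨c, hc, hc'⟩
    refine ⟨c⁻¹, ?_, fun u => ?_⟩
    · have h := congrArg (ρ g⁻¹) hc
      rw [← Module.End.mul_apply, ← map_mul, inv_mul_cancel, map_one, Module.End.one_apply,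
        map_smul] at h
      rw [eq_comm, Units.val_inv_eq_inv_val, inv_smul_eq_iff₀ c.ne_zero]
      exact h
    · rw [Units.val_inv_eq_inv_val, eq_inv_mul_iff_mul_eq₀ c.ne_zero, ← hc',
        ← Module.End.mul_apply, ← map_mul, mul_inv_cancel, map_one, Module.End.one_apply]

theorem mem_commonEigen {ρ : Representation k G W} {v : W} {σ : Representation k G V}
    {l : V →ₗ[k] k} {g : G} (c : kˣ) (h1 : ρ g v = (c : k) • v) (h2 : ∀ u, l (σ g u) = c * l u) :
    g ∈ commonEigen ρ v σ l := ⟨c, h1, h2⟩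

end CommonEigen

section Scale

variable {p : ℕ} [Fact p.Prime]
variable {D : Type*} [DivisionRing D] [Algebra ℚ_[p] D] [FiniteDimensional ℚ_[p] D]
variable {ϖ : Dˣ} (hϖ : IsUniformizer p ϖ)
include hϖ

theorem IsScaled.unique {g : GL (Fin 2) D} {i j : ℤ} (hi : IsScaled p ϖ i g)
    (hj : IsScaled p ϖ j g) : i = j := by
  have key : ∀ {i j : ℤ}, IsScaled p ϖ i g → IsScaled p ϖ j g → i ≤ j := fun {i j} hi hj => by
    have h := (hi.mul hj.inv).1 0 0
    rw [mul_inv_cancel, Units.val_one, Matrix.one_apply_eq, map_one,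
      ← zpow_zero (absNorm p D (ϖ : D)), hϖ.zpow_le_zpow_iff] at h
    omega
  exact le_antisymm (key hi hj) (key hj hi)

/-- The character of `KZZ'` that is trivial on `K` and maps `ϖ` to `c`. -/
def scaleChar {k : Type*} [Field k] (c : kˣ) : Representation k (KZZ p ϖ) k where
  toFun g := ((c ^ ((mem_KZZ_iff hϖ).1 g.2).choose : kˣ) : k) • 1
  map_one' := by
    have h : ((mem_KZZ_iff hϖ).1 (1 : KZZ p ϖ).2).choose = 0 :=
      IsScaled.unique hϖ ((mem_KZZ_iff hϖ).1 (1 : KZZ p ϖ).2).choose_spec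
        ((mem_maxCompact_iff (ϖ := ϖ)).1 (one_mem _))
    rw [h, zpow_zero, Units.val_one, one_smul]
  map_mul' g h := by
    have e : ((mem_KZZ_iff hϖ).1 (g * h).2).choose = ((mem_KZZ_iff hϖ).1 g.2).choose +
        ((mem_KZZ_iff hϖ).1 h.2).choose :=
      IsScaled.unique hϖ ((mem_KZZ_iff hϖ).1 (g * h).2).choose_spec
        (((mem_KZZ_iff hϖ).1 g.2).choose_spec.mul ((mem_KZZ_iff hϖ).1 h.2).choose_spec)
    rw [e, zpow_add, Units.val_mul, smul_mul_smul_comm, mul_one]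

theorem scaleChar_of_isScaled {k : Type*} [Field k] (c : kˣ) {g : KZZ p ϖ} {j : ℤ}
    (hj : IsScaled p ϖ j g.1) (x : k) : scaleChar hϖ c g x = ((c ^ j : kˣ) : k) * x := by
  have h := IsScaled.unique hϖ ((mem_KZZ_iff hϖ).1 g.2).choose_spec hj
  rw [← h]
  rfl

theorem scaleChar_scalarUnit {k : Type*} [Field k] (c : kˣ) (x : k) :
    scaleChar hϖ c ⟨scalarUnit ϖ, scalarUnit_mem_KZZ ϖ⟩ x = (c : k) * x := by
  have h := isScaled_scalarUnit (p := p) ϖ 1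
  rw [zpow_one] at h
  rw [scaleChar_of_isScaled hϖ c (g := ⟨scalarUnit ϖ, scalarUnit_mem_KZZ ϖ⟩) h, zpow_one]

theorem scaleChar_of_mem_maxCompact {k : Type*} [Field k] (c : kˣ) {g : KZZ p ϖ}
    (hg : g.1 ∈ maxCompact p D) (x : k) : scaleChar hϖ c g x = x := by
  rw [scaleChar_of_isScaled hϖ c ((mem_maxCompact_iff (ϖ := ϖ)).1 hg), zpow_zero, Units.val_one,
    one_mul]

end Scale

section Cosets

variable {p : ℕ} [Fact p.Prime]
variable {D : Type*} [DivisionRing D] [Algebra ℚ_[p] D] [FiniteDimensional ℚ_[p] D]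
variable {ϖ : Dˣ} {τ : residueRing p D →*₀ integers p D}

theorem weylUnit_mem_maxCompact {x : D} (hx : absNorm p D x ≤ 1) : weylUnit x ∈ maxCompact p D :=
  (mem_maxCompact_iff (ϖ := 1)).2 (isScaled_weylUnit 1 hx)

/-- Representatives of `KZZ' / IZZ'`: the identity and the matrices `([λ] 1; 1 0)`. -/
def cosetRep (ϖ : Dˣ) (τ : residueRing p D →*₀ integers p D) :
    Option (residueRing p D) → KZZ p ϖ :=
  fun x => x.elim 1 fun a =>
    ⟨weylUnit (τ a : D), maxCompact_le_KZZ ϖ (weylUnit_mem_maxCompact (τ a).2)⟩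

theorem cosetRep_mem_maxCompact (x : Option (residueRing p D)) :
    (cosetRep ϖ τ x).1 ∈ maxCompact p D := by
  rcases x with _ | a
  · exact one_mem _
  · exact weylUnit_mem_maxCompact (τ a).2

variable (hϖ : IsUniformizer p ϖ) (hτ : ∀ x, red p D (τ x) = x)
include hϖ hτ

theorem exists_cosetRep (g : KZZ p ϖ) :
    ∃ x, (cosetRep ϖ τ x)⁻¹ * g ∈ (IZZ p ϖ).subgroupOf (KZZ p ϖ) := by
  rcases exists_weyl_decomposition hϖ hτ g.2 with h | ⟨x, h⟩
  · refine ⟨none, Subgroup.mem_subgroupOf.2 ?_⟩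
    change ((1 : KZZ p ϖ)⁻¹ * g : KZZ p ϖ).1 ∈ _
    rwa [inv_one, one_mul]
  · exact ⟨some x, h⟩

theorem cosetRep_unique (x y : Option (residueRing p D))
    (h : (cosetRep ϖ τ x)⁻¹ * cosetRep ϖ τ y ∈ (IZZ p ϖ).subgroupOf (KZZ p ϖ)) : x = y := by
  have h1 : ∀ a, cosetRep ϖ τ (some a) ∉ (IZZ p ϖ).subgroupOf (KZZ p ϖ) := fun a =>
    weylUnit_notMem_IZZ hϖ
  have h0 : cosetRep ϖ τ none = 1 := rfl
  rcases x with _ | a <;> rcases y with _ | b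
  · rfl
  · rw [h0, inv_one, one_mul] at h
    exact absurd h (h1 b)
  · rw [h0, mul_one] at h
    exact absurd ((Subgroup.inv_mem_iff _).1 h) (h1 a)
  · have h2 := weylUnit_coset_eq hϖ (x := (τ a : D)) (y := (τ b : D)) h
    rw [← hτ a, ← hτ b, (red_eq_iff p).2 h2]

omit hτ in
theorem IZZ_subgroupOf_le {S : Subgroup (KZZ p ϖ)}
    (h1 : ⟨scalarUnit ϖ, scalarUnit_mem_KZZ ϖ⟩ ∈ S)
    (h2 : ∀ k (hk : k ∈ iwahori p D), ⟨k, iwahori_le_KZZ ϖ hk⟩ ∈ S) :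
    (IZZ p ϖ).subgroupOf (KZZ p ϖ) ≤ S := by
  intro g hg
  obtain ⟨j, k, hk, e⟩ := exists_of_mem_IZZ hϖ (Subgroup.mem_subgroupOf.1 hg)
  have e' : g = ⟨scalarUnit ϖ, scalarUnit_mem_KZZ ϖ⟩ ^ j * ⟨k, iwahori_le_KZZ ϖ hk⟩ := by
    refine Subtype.ext ?_
    rw [e, ← scalarUnit_zpow]
    rfl
  rw [e']
  exact mul_mem (zpow_mem h1 j) (h2 k hk)

end Cosets

section Weight

variable {p : ℕ} [Fact p.Prime]
variable {D : Type*} [DivisionRing D] [Algebra ℚ_[p] D] [FiniteDimensional ℚ_[p] D]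
variable {m : ℕ} {r : Fin m → ℕ} {ϖ : Dˣ} {ι : residueRing p D →+* Coef p}
  {σ : Representation (Coef p) (KZZ p ϖ) (Wt p r)}

instance : Nontrivial (Wt p r) := ⟨⟨highest p r, 0, highest_ne_zero⟩⟩

variable (p r) in
/-- The functional `x_j ↦ 0`, `y_j ↦ 1` on a weight, the coefficient of `⊗ y_j^{r_j}`. -/
def lowestCoord : Wt p r →ₗ[Coef p] Coef p :=
  (evalPair p m (0 : Coef p) 1).toLinearMap.comp (Wt p r).subtype

theorem lowestCoord_highest :
    lowestCoord p r (highest p r) = 0 ^ (∑ j : Fin m, p ^ (j : ℕ) * r j) :=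
  evalPair_highest 0 1

theorem lowestCoord_wtAction (A : Matrix (Fin 2) (Fin 2) (Coef p)) (P : Wt p r) :
    lowestCoord p r (wtAction p r A P) = evalPair p m (A 1 0) (A 1 1) P.1 := by
  change evalPair p m (0 : Coef p) 1 (subst p m A P.1) = _
  rw [evalPair_subst]
  simp

theorem lowestCoord_wtAction_of_upper {A : Matrix (Fin 2) (Fin 2) (Coef p)} (h : A 1 0 = 0)
    (P : Wt p r) : lowestCoord p r (wtAction p r A P) =
      A 1 1 ^ (∑ j : Fin m, p ^ (j : ℕ) * r j) * lowestCoord p r P := by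
  rw [lowestCoord_wtAction, h]
  have e := evalPair_smul (0 : Coef p) 1 (A 1 1) P.2
  rw [mul_zero, mul_one] at e
  exact e

variable (hσ : ∀ g, σ (toKZZ ϖ g) = weight ι r g)
include hσ

theorem lowestCoord_iwahori {g : GL (Fin 2) D} (hg : g ∈ iwahori p D) (hK : g ∈ KZZ p ϖ)
    (P : Wt p r) : lowestCoord p r (σ ⟨g, hK⟩ P) =
      resChar ι (g.1 1 1) ^ (∑ j : Fin m, p ^ (j : ℕ) * r j) * lowestCoord p r P := by
  rw [action_eq hσ (iwahori_le_maxCompact hg) hK, lowestCoord_wtAction_of_upper]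
  · rfl
  · exact resChar_eq_zero ι ((mem_iwahori_iff (ϖ := ϖ)).1 hg).2

theorem lowestCoord_weylUnit_inv {x : D} (hx : absNorm p D x ≤ 1)
    (hK : weylUnit x ∈ KZZ p ϖ) :
    lowestCoord p r (σ ⟨weylUnit x, hK⟩⁻¹ (highest p r)) = 1 := by
  have h := action_eq hσ (inv_mem (weylUnit_mem_maxCompact hx)) (inv_mem hK)
  have e : (⟨weylUnit x, hK⟩ : KZZ p ϖ)⁻¹ = ⟨(weylUnit x)⁻¹, inv_mem hK⟩ := rfl
  rw [e, h, lowestCoord_wtAction, evalPair_highest]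
  have e1 : resMat ι (weylUnit x)⁻¹ 1 0 = 1 := by
    change resChar ι (((weylUnit x)⁻¹).1 1 0) = 1
    rw [weylUnit_inv_val]
    simp [resChar_one]
  rw [e1, one_pow]

variable (hr : ∀ j, r j ≤ p - 1) (hκ : Fintype.card (residueRing p D) = p ^ m)
include hr hκ

/-- The functional `lowestCoord` is determined up to scalars by its invariance under the upper
triangular unipotent matrices, so `ϖ` multiplies it by a scalar; the Weyl element, which commutes
with `ϖ`, shows that it is the scalar by which `ϖ` acts on `⊗ x_j^{r_j}`. -/
theorem lowestCoord_scalar {c : Coef p}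
    (hc : σ ⟨scalarUnit ϖ, scalarUnit_mem_KZZ ϖ⟩ (highest p r) = c • highest p r) (P : Wt p r) :
    lowestCoord p r (σ ⟨scalarUnit ϖ, scalarUnit_mem_KZZ ϖ⟩ P) = c * lowestCoord p r P := by
  have hpos := uniformizer_pos (p := p) ϖ
  have hl : (lowestCoord p r).comp (σ ⟨scalarUnit ϖ, scalarUnit_mem_KZZ ϖ⟩) -
      c • lowestCoord p r = 0 := by
    refine functional_eq_zero hr (residue_hom_injective p ι) hκ (fun x P => ?_) ?_
    · obtain ⟨y, rfl⟩ := red_surjective p x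
      have hy' : absNorm p D ((ϖ : D) * y * ((ϖ⁻¹ : Dˣ) : D)) ≤ 1 := by
        rw [map_mul, map_mul, absNorm_val_inv, mul_right_comm, mul_inv_cancel₀ hpos.ne', one_mul]
        exact y.2
      have hI := proPIwahori_le_iwahori (upper_mem_proPIwahori (D := D) y.2)
      have hI' := proPIwahori_le_iwahori (upper_mem_proPIwahori (D := D) hy')
      have e : (⟨scalarUnit ϖ, scalarUnit_mem_KZZ ϖ⟩ : KZZ p ϖ) *
          ⟨affineUnit 1 (y : D), iwahori_le_KZZ ϖ hI⟩ =
            ⟨affineUnit 1 ((ϖ : D) * y * ((ϖ⁻¹ : Dˣ) : D)), iwahori_le_KZZ ϖ hI'⟩ *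
              ⟨scalarUnit ϖ, scalarUnit_mem_KZZ ϖ⟩ := by
        refine Subtype.ext ?_
        apply GL2_ext <;> simp [GL2_mul_apply, affineUnit_val, scalarUnit_val, mul_assoc]
      have h1 : ∀ (z : D) (hz : affineUnit 1 z ∈ iwahori p D) (Q : Wt p r),
          lowestCoord p r (σ ⟨affineUnit 1 z, iwahori_le_KZZ ϖ hz⟩ Q) = lowestCoord p r Q :=
        fun z hz Q => by
          rw [lowestCoord_iwahori hσ hz, affineUnit_val]
          simp [resChar_one]
      rw [← resChar_coe, ← upper_action hσ y.2 (iwahori_le_KZZ ϖ hI)]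
      simp only [LinearMap.sub_apply, LinearMap.smul_apply, LinearMap.comp_apply]
      rw [h1 _ hI, ← Module.End.mul_apply, ← map_mul, e, map_mul, Module.End.mul_apply, h1 _ hI']
    · have h0 : absNorm p D (0 : D) ≤ 1 := by simp [absNorm_zero]
      have hw := maxCompact_le_KZZ ϖ (weylUnit_mem_maxCompact (p := p) h0)
      have e : (⟨scalarUnit ϖ, scalarUnit_mem_KZZ ϖ⟩ : KZZ p ϖ) * ⟨weylUnit 0, hw⟩ =
          ⟨weylUnit 0, hw⟩ * ⟨scalarUnit ϖ, scalarUnit_mem_KZZ ϖ⟩ := by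
        refine Subtype.ext ?_
        apply GL2_ext <;> simp [GL2_mul_apply, weylUnit_val, scalarUnit_val]
      have h1 : wtAction p r !![0, 1; 1, 0] = σ ⟨weylUnit 0, hw⟩ := by
        rw [action_eq hσ (weylUnit_mem_maxCompact h0) hw, resMat_eq, weylUnit_val]
        simp [resChar_zero, resChar_one]
      rw [h1]
      simp only [LinearMap.sub_apply, LinearMap.smul_apply, LinearMap.comp_apply]
      rw [← Module.End.mul_apply, ← map_mul, e, map_mul, Module.End.mul_apply, hc, map_smul,
        map_smul, sub_self]
  exact sub_eq_zero.1 (LinearMap.congr_fun hl P)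

/-- The translates of `⊗ x_j^{r_j}` by the lower triangular unipotent matrices span the weight. -/
theorem generated_highest : (generated σ (highest p r)).toSubmodule = ⊤ := by
  refine eq_top_of_lower_mem hr (residue_hom_injective p ι) hκ fun x => ?_
  obtain ⟨y, rfl⟩ := red_surjective p x
  have hM : lowerUnit 1 (y : D) 1 ∈ maxCompact p D := (mem_maxCompact_iff (ϖ := 1)).2
    (isScaled_of_lower rfl (by simp [lowerUnit_val]) (by simp [lowerUnit_val])
      (by rw [zpow_zero]; exact y.2))
  have h := apply_mem_generated σ (highest p r) ⟨_, maxCompact_le_KZZ ϖ hM⟩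
  rw [action_eq hσ hM, resMat_eq, lowerUnit_val] at h
  simpa [resChar_one, resChar_zero, resChar_coe] using h

/-- A nonzero stable subspace contains a nonzero vector fixed by the upper triangular unipotent
matrices, hence `⊗ x_j^{r_j}`. -/
theorem highest_mem_of_stable {S : Submodule (Coef p) (Wt p r)} (hS : ∀ g, ∀ v ∈ S, σ g v ∈ S)
    (hne : S ≠ ⊥) : highest p r ∈ S := by
  refine highest_mem_of_upper_stable hr (residue_hom_injective p ι) hκ hne fun x P hP => ?_
  obtain ⟨y, rfl⟩ := red_surjective p x
  have hI := proPIwahori_le_iwahori (upper_mem_proPIwahori (D := D) y.2)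
  rw [← resChar_coe, ← upper_action hσ y.2 (iwahori_le_KZZ ϖ hI)]
  exact hS _ P hP

theorem weight_isIrreducible : σ.IsIrreducible :=
  isIrreducible_of_forall fun S hS hne => by
    have h := highest_mem_of_stable hσ hr hκ hS hne
    rw [eq_top_iff, ← generated_highest hσ hr hκ]
    exact generated_le σ fun g => hS g _ h

/-- An intertwining map that does not kill `⊗ x_j^{r_j}` identifies the weight with the
representation generated by the image of this vector. -/
theorem generated_equiv_weight {W : Type*} [AddCommGroup W] [Module (Coef p) W]
    {ρ : Representation (Coef p) (KZZ p ϖ) W} {Φ : Wt p r →ₗ[Coef p] W}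
    (hΦ : ∀ g v, Φ (σ g v) = ρ g (Φ v)) (h0 : Φ (highest p r) ≠ 0) :
    Nonempty ((generated ρ (Φ (highest p r))).toRepresentation.Equiv σ) := by
  refine generated_equiv_of_injective hΦ ?_ (generated_highest hσ hr hκ)
  rw [← LinearMap.ker_eq_bot]
  by_contra hne
  refine h0 (LinearMap.mem_ker.1 (highest_mem_of_stable hσ hr hκ (fun g v hv => ?_) hne))
  rw [LinearMap.mem_ker, hΦ, LinearMap.mem_ker.1 hv, map_zero]

end Weight

/-! ### The `KZZ'`-modules generated by the invariants -/

section Modules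

variable {p : ℕ} [Fact p.Prime]
variable {D : Type*} [DivisionRing D] [Algebra ℚ_[p] D] [FiniteDimensional ℚ_[p] D]
variable {m : ℕ} {r : Fin m → ℕ} {ϖ : Dˣ} {ι : residueRing p D →+* Coef p}
  {τ : residueRing p D →*₀ integers p D}
  {σ : Representation (Coef p) (KZZ p ϖ) (Wt p r)}

theorem resChar_ne_zero (ι : residueRing p D →+* Coef p) {x : D} (h : absNorm p D x = 1) :
    resChar ι x ≠ 0 := by
  have e := resChar_coe ι (⟨x, h.le⟩ : integers p D)
  rw [e, map_ne_zero_iff _ (residue_hom_injective p ι)]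
  intro h0
  have h1 : absNorm p D x < 1 := (red_eq_zero_iff p).1 h0
  exact h1.ne h

/-- Fermat's little theorem for the finite field `ι(k_D)`. -/
theorem resChar_pow_card_sub_one (ι : residueRing p D →+* Coef p) {x : D}
    (h : absNorm p D x = 1) : resChar ι x ^ (Fintype.card (residueRing p D) - 1) = 1 := by
  classical
  have h0 := resChar_ne_zero ι h
  have e := resChar_coe ι (⟨x, h.le⟩ : integers p D)
  rw [e] at h0 ⊢
  set y := red p D ⟨x, h.le⟩
  have hb : Function.Bijective ι.rangeRestrict :=
    ⟨fun a b hab => residue_hom_injective p ι (congrArg Subtype.val hab),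
      ι.rangeRestrict_surjective⟩
  let _ : Fintype ι.range := Fintype.ofBijective _ hb
  let _ : Field ι.range := Fintype.fieldOfDomain ι.range
  have h1 := FiniteField.pow_card_sub_one_eq_one (⟨ι y, y, rfl⟩ : ι.range)
    fun h2 => h0 (congrArg Subtype.val h2)
  rw [Fintype.card_of_bijective hb]
  exact congrArg Subtype.val h1

/-- The coefficient of `⊗ x_j^{r_j}` in the value at a base vertex. -/
def vertexCoord (σ : Representation (Coef p) (KZZ p ϖ) (Wt p r)) (i : ℕ ⊕ ℕ) :
    cIndV σ →ₗ[Coef p] Coef p where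
  toFun f := evalPair p m (1 : Coef p) 0 (f.1 (baseVertex ϖ i)⁻¹).1
  map_add' _ _ := map_add (evalPair p m (1 : Coef p) 0) _ _
  map_smul' c _ := map_smul (evalPair p m (1 : Coef p) 0) c _

theorem vertexCoord_eq_zero {i : ℕ ⊕ ℕ} {f : cIndV σ} (h : f.1 (baseVertex ϖ i)⁻¹ = 0) :
    vertexCoord σ i f = 0 := by
  change evalPair p m (1 : Coef p) 0 (f.1 (baseVertex ϖ i)⁻¹).1 = 0
  rw [h]
  exact map_zero _

theorem vertexCoord_eq_one {i : ℕ ⊕ ℕ} {f : cIndV σ}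
    (h : f.1 (baseVertex ϖ i)⁻¹ = highest p r) : vertexCoord σ i f = 1 := by
  change evalPair p m (1 : Coef p) 0 (f.1 (baseVertex ϖ i)⁻¹).1 = 1
  rw [h, evalPair_highest, one_pow]

/-- The vertices at distance `n + 1` are obtained from those of `β s_n^0` by the matrices
`([λ] 1; 1 0)`, where `λ` is the first digit. -/
theorem sVec_succ (τ : residueRing p D →*₀ integers p D)
    (σ : Representation (Coef p) (KZZ p ϖ) (Wt p r)) (n : ℕ) :
    sVec ϖ τ σ (n + 1) =
      ∑ a, resKZZ σ (cosetRep ϖ τ (some a)) (betaVec ϖ τ σ n) := by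
  rw [sVec_eq_sum, ← (Fin.consEquiv fun _ => residueRing p D).sum_comp, Fintype.sum_prod_type]
  refine Finset.sum_congr rfl fun a _ => ?_
  change _ = cInd σ (weylUnit (τ a : D)) (cInd σ (betaUnit ϖ) (sVec ϖ τ σ n))
  rw [sVec_eq_sum, map_sum, map_sum]
  refine Finset.sum_congr rfl fun μ _ => ?_
  rw [cInd_bracket, cInd_bracket, weylUnit_mul_beta_affineUnit, digitSum_succ]
  rfl

variable (hϖ : IsUniformizer p ϖ) (hτ : ∀ x, red p D (τ x) = x)
include hϖ hτ

theorem vertexCoord_betaVec (n : ℕ) :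
    vertexCoord σ (Sum.inr n) (betaVec ϖ τ σ n) = 1 :=
  vertexCoord_eq_one (invariantVec_apply_self hϖ hτ (Sum.inr n))

theorem add_smul_betaVec_ne_zero (n : ℕ) (c : Coef p) :
    c • betaVec ϖ τ σ n + sVec ϖ τ σ (n + 1) ≠ 0 := fun h => by
  have h1 := congrArg (vertexCoord σ (Sum.inl (n + 1))) h
  have h2 : vertexCoord σ (Sum.inl (n + 1)) (sVec ϖ τ σ (n + 1)) = 1 :=
    vertexCoord_eq_one (invariantVec_apply_self hϖ hτ (Sum.inl (n + 1)))
  have h3 : vertexCoord σ (Sum.inl (n + 1)) (betaVec ϖ τ σ n) = 0 :=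
    vertexCoord_eq_zero (invariantVec_apply_of_ne (i := Sum.inr n) hϖ Sum.inr_ne_inl)
  rw [map_add, map_smul, map_zero, h2, h3, smul_zero, zero_add] at h1
  exact one_ne_zero h1

theorem sVec_ne_zero (n : ℕ) : sVec ϖ τ σ n ≠ 0 := fun h => by
  have h2 : vertexCoord σ (Sum.inl n) (sVec ϖ τ σ n) = 1 :=
    vertexCoord_eq_one (invariantVec_apply_self hϖ hτ (Sum.inl n))
  rw [h, map_zero] at h2
  exact zero_ne_one h2

/-- The common eigenvalue is recovered as a vertex coordinate, because that of `β s_n^0` itself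
is `1`. -/
theorem eq_smul_of_mem_commonEigen {n : ℕ} {V : Type*} [AddCommGroup V] [Module (Coef p) V]
    {σ' : Representation (Coef p) (KZZ p ϖ) V} {l : V →ₗ[Coef p] Coef p} {h : KZZ p ϖ}
    (hh : h ∈ commonEigen (resKZZ σ) (betaVec ϖ τ σ n) σ' l) :
    resKZZ σ h (betaVec ϖ τ σ n) =
        vertexCoord σ (Sum.inr n) (resKZZ σ h (betaVec ϖ τ σ n)) • betaVec ϖ τ σ n ∧
      ∀ u, l (σ' h u) = vertexCoord σ (Sum.inr n) (resKZZ σ h (betaVec ϖ τ σ n)) * l u := by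
  obtain ⟨c, hc, hc'⟩ := hh
  have e : vertexCoord σ (Sum.inr n) (resKZZ σ h (betaVec ϖ τ σ n)) = c := by
    rw [hc, map_smul, vertexCoord_betaVec hϖ hτ, smul_eq_mul, mul_one]
  rw [e]
  exact ⟨hc, hc'⟩

variable (hσ : ∀ g, σ (toKZZ ϖ g) = weight ι r g)
  (hr : ∀ j, r j ≤ p - 1) (hκ : Fintype.card (residueRing p D) = p ^ m)
include hσ hr hκ

/-- `IZZ'` acts on `β s_n^0` and on the functional `lowestCoord` by the same character. -/
theorem IZZ_le_commonEigen (n : ℕ) : (IZZ p ϖ).subgroupOf (KZZ p ϖ) ≤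
    commonEigen (resKZZ σ) (betaVec ϖ τ σ n) σ (lowestCoord p r) := by
  obtain ⟨c, hc0, hc⟩ := exists_scalar_eigenvalue hσ hr hκ
  refine IZZ_subgroupOf_le hϖ (mem_commonEigen (Units.mk0 c hc0) ?_ ?_) fun k hk =>
    mem_commonEigen (Units.mk0 (resChar ι (k.1 1 1) ^ (∑ j : Fin m, p ^ (j : ℕ) * r j))
      (pow_ne_zero _ (resChar_ne_zero ι (iwahori_diag hk).2))) ?_ ?_
  · exact scalar_betaVec hσ hϖ hτ hc n
  · exact lowestCoord_scalar hσ hr hκ hc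
  · exact iwahori_betaVec hσ hϖ hτ hr hκ hk n
  · exact lowestCoord_iwahori hσ hk _

theorem IZZ_betaVec (n : ℕ) {h : KZZ p ϖ} (hh : h ∈ (IZZ p ϖ).subgroupOf (KZZ p ϖ)) :
    resKZZ σ h (betaVec ϖ τ σ n) =
      vertexCoord σ (Sum.inr n) (resKZZ σ h (betaVec ϖ τ σ n)) • betaVec ϖ τ σ n :=
  (eq_smul_of_mem_commonEigen hϖ hτ (IZZ_le_commonEigen hϖ hτ hσ hr hκ n hh)).1

/-- The translates of `β s_n^0` by the elements of `KZZ'` outside `IZZ'` are supported on vertices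
of the other half of the tree. -/
theorem vertexCoord_betaVec_of_notMem (n : ℕ) {g : KZZ p ϖ}
    (hg : g ∉ (IZZ p ϖ).subgroupOf (KZZ p ϖ)) :
    vertexCoord σ (Sum.inr n) (resKZZ σ g (betaVec ϖ τ σ n)) = 0 := by
  obtain ⟨x, hx⟩ := exists_cosetRep hϖ hτ g
  have e : g = cosetRep ϖ τ x * ((cosetRep ϖ τ x)⁻¹ * g) := (mul_inv_cancel_left _ _).symm
  have hx' := IZZ_betaVec hϖ hτ hσ hr hκ n hx
  rcases x with _ | a
  · exact absurd (by rw [e]; exact mul_mem (one_mem _) hx) hg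
  rw [e, map_mul, Module.End.mul_apply, hx', map_smul, map_smul, smul_eq_mul]
  refine mul_eq_zero_of_right _ (vertexCoord_eq_zero ?_)
  change (sVec ϖ τ σ n).1 ((betaUnit ϖ * affineUnit (ϖ ^ n) 0)⁻¹ * weylUnit (τ a : D) *
    betaUnit ϖ) = 0
  refine sVec_apply_eq_zero fun μ => ?_
  rw [mul_assoc, mul_assoc, weylUnit_mul_beta_affineUnit]
  refine betaUnit_affineUnit_notMem hϖ (by simp [absNorm_zero])
    (absNorm_add_le_of_le p (τ a).2 ?_)
  rw [map_mul]
  exact mul_le_one₀ hϖ.lt_one.le (absNorm_nonneg p D _) (absNorm_digitSum_le hϖ τ μ)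

/-- `β s_n^0` is an eigenvector of `IZZ'` whose translates under coset representatives are
independent, so it generates the induced representation of its character. -/
theorem isPrincipalSeries_generated_betaVec (n : ℕ) :
    IsPrincipalSeries (generated (resKZZ σ) (betaVec ϖ τ σ n)).toRepresentation := by
  have h1 := vertexCoord_betaVec (σ := σ) hϖ hτ n
  refine ⟨eigenRep (resKZZ σ) (betaVec ϖ τ σ n) (vertexCoord σ (Sum.inr n)) h1
    fun h hh => IZZ_betaVec hϖ hτ hσ hr hκ n hh, fun h hh => ?_, ?_⟩
  · refine LinearMap.ext fun c => ?_
    rw [eigenRep_apply]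
    have e : resKZZ σ h (betaVec ϖ τ σ n) = betaVec ϖ τ σ n :=
      proPIwahori_betaVec hσ hϖ hτ hr hκ hh n
    rw [e, h1, one_mul, Module.End.one_apply]
  · exact generated_equiv_cInd (rep := cosetRep ϖ τ) h1 _ (exists_cosetRep hϖ hτ)
      (cosetRep_unique hϖ hτ) fun g hg => vertexCoord_betaVec_of_notMem hϖ hτ hσ hr hκ n hg

theorem finrank_generated_betaVec (n : ℕ) :
    Module.finrank (Coef p) (generated (resKZZ σ) (betaVec ϖ τ σ n)).toSubmodule = p ^ m + 1 := by
  rw [finrank_generated (rep := cosetRep ϖ τ) (vertexCoord_betaVec (σ := σ) hϖ hτ n)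
    (fun h hh => IZZ_betaVec hϖ hτ hσ hr hκ n hh) (exists_cosetRep hϖ hτ)
    (cosetRep_unique hϖ hτ) fun g hg => vertexCoord_betaVec_of_notMem hϖ hτ hσ hr hκ n hg,
    Fintype.card_option, hκ]

/-- Frobenius reciprocity for the eigenvector `β s_n^0` of `IZZ'`. The coset representatives other
than the identity contribute `s_{n+1}^0`. -/
theorem exists_frobenius (n : ℕ) {V : Type*} [AddCommGroup V] [Module (Coef p) V]
    {σ' : Representation (Coef p) (KZZ p ϖ) V} {l : V →ₗ[Coef p] Coef p}
    (hH : (IZZ p ϖ).subgroupOf (KZZ p ϖ) ≤ commonEigen (resKZZ σ) (betaVec ϖ τ σ n) σ' l) :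
    ∃ Φ : V →ₗ[Coef p] cIndV σ, (∀ g v, Φ (σ' g v) = resKZZ σ g (Φ v)) ∧
      ∀ u, (∀ a, l (σ' (cosetRep ϖ τ (some a))⁻¹ u) = 1) →
        Φ u = l u • betaVec ϖ τ σ n + sVec ϖ τ σ (n + 1) := by
  obtain ⟨Φ, hΦ, h⟩ := exists_frobenius_map (rep := cosetRep ϖ τ) (ρ := resKZZ σ)
    (v := betaVec ϖ τ σ n) (ε := vertexCoord σ (Sum.inr n)) (vertexCoord_betaVec hϖ hτ n)
    (fun h hh => IZZ_betaVec hϖ hτ hσ hr hκ n hh) (exists_cosetRep hϖ hτ)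
    (cosetRep_unique hϖ hτ) (fun g hg => vertexCoord_betaVec_of_notMem hϖ hτ hσ hr hκ n hg) σ' l
    (fun h hh => (eq_smul_of_mem_commonEigen hϖ hτ (hH hh)).2)
  refine ⟨Φ, hΦ, fun u hu => (h u).trans ?_⟩
  have e : cosetRep ϖ τ none = 1 := rfl
  have e1 : l (σ' (cosetRep ϖ τ none)⁻¹ u) • resKZZ σ (cosetRep ϖ τ none) (betaVec ϖ τ σ n) =
      l u • betaVec ϖ τ σ n := by
    rw [e, inv_one, map_one σ', map_one (resKZZ σ), Module.End.one_apply, Module.End.one_apply]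
  rw [Fintype.sum_option, e1, sVec_succ]
  refine congrArg _ (Finset.sum_congr rfl fun a _ => ?_)
  rw [hu, one_smul]

/-- The functional `lowestCoord` gives an embedding of the weight that maps `⊗ x_j^{r_j}` to
`s_{n+1}^0`, up to a multiple of `β s_n^0` when the weight is trivial. -/
theorem generated_succ_equiv (n : ℕ) :
    Nonempty ((generated (resKZZ σ) ((0 : Coef p) ^ (∑ j : Fin m, p ^ (j : ℕ) * r j) •
      betaVec ϖ τ σ n + sVec ϖ τ σ (n + 1))).toRepresentation.Equiv σ) := by
  obtain ⟨Φ, hΦ, h⟩ := exists_frobenius hϖ hτ hσ hr hκ n (IZZ_le_commonEigen hϖ hτ hσ hr hκ n)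
  have e := h (highest p r) fun a => lowestCoord_weylUnit_inv hσ (τ a).2 _
  rw [lowestCoord_highest] at e
  rw [← e]
  refine generated_equiv_weight hσ hr hκ hΦ ?_
  rw [e]
  exact add_smul_betaVec_ne_zero hϖ hτ n _

/-- The vector `s_0^0 = [1, ⊗ x_j^{r_j}]` lies in the copy `{[1, v]}` of the weight. -/
theorem generated_zero_equiv :
    Nonempty ((generated (resKZZ σ) (sVec ϖ τ σ 0)).toRepresentation.Equiv σ) := by
  have e1 : affineUnit (ϖ ^ 0) (0 : D) = 1 := by
    apply GL2_ext <;> simp [affineUnit_val]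
  have e : sVec ϖ τ σ 0 = bracketHom σ 1 (highest p r) := by
    rw [sVec_eq_sum, Fintype.sum_unique, digitSum, Fin.sum_univ_zero, e1]
    rfl
  have h0 := sVec_ne_zero (σ := σ) hϖ hτ 0
  rw [e] at h0 ⊢
  refine generated_equiv_weight hσ hr hκ (fun g v => ?_) h0
  change bracket σ 1 (σ g v) = cInd σ g.1 (bracket σ 1 v)
  rw [cInd_bracket, mul_one, ← bracket_mul σ 1 g.2, one_mul]

theorem generated_sVec_equiv (hR : 0 < ∑ j : Fin m, p ^ (j : ℕ) * r j) (n : ℕ) :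
    Nonempty ((generated (resKZZ σ) (sVec ϖ τ σ n)).toRepresentation.Equiv σ) := by
  cases n with
  | zero => exact generated_zero_equiv hϖ hτ hσ hr hκ
  | succ n =>
    have h := generated_succ_equiv hϖ hτ hσ hr hκ n
    rwa [zero_pow hR.ne', zero_smul, zero_add] at h

/-- The principal series generated by `β s_n^0` contains `s_{n+1}^0`, which generates a smaller
subrepresentation. -/
theorem not_isIrreducible_generated_betaVec (hR : 0 < ∑ j : Fin m, p ^ (j : ℕ) * r j) (n : ℕ) :
    ¬ (generated (resKZZ σ) (betaVec ϖ τ σ n)).toRepresentation.IsIrreducible := by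
  refine not_isIrreducible_of_lt (u := sVec ϖ τ σ (n + 1)) (sVec_ne_zero hϖ hτ _) ?_ fun h => ?_
  · rw [sVec_succ]
    exact sum_mem fun a _ => apply_mem_generated _ _ _
  · obtain ⟨e⟩ := generated_sVec_equiv hϖ hτ hσ hr hκ hR (n + 1)
    have h1 := finrank_generated_betaVec hϖ hτ hσ hr hκ n
    rw [← h, e.toLinearEquiv.finrank_eq] at h1
    have h2 := (finite_Wt hr).2
    omega

omit hϖ hτ hσ hκ in
theorem finrank_Wt_of_trivial (h0 : ∑ j : Fin m, p ^ (j : ℕ) * r j = 0) :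
    Module.finrank (Coef p) (Wt p r) = 1 :=
  finrank_eq_one (highest p r) highest_ne_zero fun P =>
    (eq_smul_highest_of_sum_eq_zero hr h0 P).imp fun _ h => h.symm

theorem generated_equiv_of_trivial (h0 : ∑ j : Fin m, p ^ (j : ℕ) * r j = 0) (n : ℕ) :
    Nonempty ((generated (resKZZ σ) (if n = 0 then sVec ϖ τ σ 0
      else sVec ϖ τ σ n + betaVec ϖ τ σ (n - 1))).toRepresentation.Equiv σ) := by
  cases n with
  | zero =>
    rw [if_pos rfl]
    exact generated_zero_equiv hϖ hτ hσ hr hκ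
  | succ n =>
    have h := generated_succ_equiv hϖ hτ hσ hr hκ n
    rwa [h0, pow_zero, one_smul, add_comm] at h

/-- When `r = q^w - 1` the group `I` acts trivially on `β s_n^0`, so that the character of `IZZ'`
on this vector extends to `KZZ'`. -/
theorem IZZ_le_commonEigen_scaleChar (hR : ∑ j : Fin m, p ^ (j : ℕ) * r j = p ^ m - 1) (n : ℕ)
    {c : (Coef p)ˣ}
    (hc : σ ⟨scalarUnit ϖ, scalarUnit_mem_KZZ ϖ⟩ (highest p r) = (c : Coef p) • highest p r) :
    (IZZ p ϖ).subgroupOf (KZZ p ϖ) ≤ commonEigen (resKZZ σ) (betaVec ϖ τ σ n)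
      (scaleChar hϖ c) LinearMap.id := by
  refine IZZ_subgroupOf_le hϖ (mem_commonEigen c (scalar_betaVec hσ hϖ hτ hc n) fun u => ?_)
    fun k hk => mem_commonEigen 1 ?_ fun u => ?_
  · rw [LinearMap.id_apply, LinearMap.id_apply, scaleChar_scalarUnit]
  · have h := iwahori_betaVec hσ hϖ hτ hr hκ hk n
    rw [hR, ← hκ, resChar_pow_card_sub_one ι (iwahori_diag hk).2] at h
    exact h
  · rw [LinearMap.id_apply, LinearMap.id_apply,
      scaleChar_of_mem_maxCompact hϖ c (iwahori_le_maxCompact hk), Units.val_one, one_mul]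

/-- When `r = q^w - 1`, Frobenius reciprocity for the character of `KZZ'` that extends the one of
`IZZ'` on `β s_n^0` gives an eigenvector of `KZZ'`. -/
theorem exists_smul_of_eq_card_sub_one (hR : ∑ j : Fin m, p ^ (j : ℕ) * r j = p ^ m - 1) (n : ℕ)
    (g : KZZ p ϖ) : ∃ c : Coef p, resKZZ σ g (sVec ϖ τ σ (n + 1) + betaVec ϖ τ σ n) =
      c • (sVec ϖ τ σ (n + 1) + betaVec ϖ τ σ n) := by
  obtain ⟨c, hc0, hc⟩ := exists_scalar_eigenvalue hσ hr hκ
  obtain ⟨Φ, hΦ, h⟩ := exists_frobenius hϖ hτ hσ hr hκ n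
    (IZZ_le_commonEigen_scaleChar hϖ hτ hσ hr hκ hR n (c := Units.mk0 c hc0) hc)
  have e : Φ 1 = sVec ϖ τ σ (n + 1) + betaVec ϖ τ σ n := by
    refine (h 1 fun a => ?_).trans ?_
    · rw [LinearMap.id_apply, scaleChar_of_mem_maxCompact hϖ _
        (inv_mem (cosetRep_mem_maxCompact (some a)))]
    · rw [LinearMap.id_apply, one_smul]
      exact add_comm _ _
  have h2 : Φ (scaleChar hϖ (Units.mk0 c hc0) g 1) =
      scaleChar hϖ (Units.mk0 c hc0) g 1 • Φ 1 := by
    refine Eq.trans ?_ (Φ.map_smul _ _)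
    rw [smul_eq_mul, mul_one]
  refine ⟨scaleChar hϖ (Units.mk0 c hc0) g 1, ?_⟩
  rw [← e]
  exact (hΦ g 1).symm.trans h2

end Modules

end GL2D

end

theorem mainTheorem2 (p : ℕ) [Fact p.Prime]
    (F : Type*) [Field F] [Algebra ℚ_[p] F] [FiniteDimensional ℚ_[p] F]
    (D : Type*) [DivisionRing D] [Algebra F D] [Algebra.IsCentral F D] [FiniteDimensional F D]
    [Algebra ℚ_[p] D] [IsScalarTower ℚ_[p] F D] [FiniteDimensional ℚ_[p] D]
    (w f : ℕ) (hw : Module.finrank F D = w ^ 2)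
    (hf : Nat.card (GL2D.residueRing p F) = p ^ f)
    (ϖ : Dˣ) (hϖ : GL2D.IsUniformizer p ϖ)
    (τ : GL2D.residueRing p D →*₀ GL2D.integers p D) (hτ : ∀ x, GL2D.red p D (τ x) = x)
    (ι : GL2D.residueRing p D →+* GL2D.Coef p)
    (r : Fin (w * f) → ℕ) (hr : ∀ j, r j ≤ p - 1)
    (σ : Representation (GL2D.Coef p) (GL2D.KZZ p ϖ) (GL2D.Wt p r))
    (hσ : ∀ g, σ (GL2D.toKZZ ϖ g) = GL2D.weight ι r g) :
    (∃ b : Module.Basis (ℕ ⊕ ℕ) (GL2D.Coef p) (GL2D.resProP σ).invariants,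
      ∀ n : ℕ, (b (Sum.inl n)).1 = GL2D.sVec ϖ τ σ n ∧
        (b (Sum.inr n)).1 = GL2D.betaVec ϖ τ σ n) ∧
    (0 < ∑ j : Fin (w * f), p ^ (j : ℕ) * r j → ∀ n : ℕ,
      (Nonempty ((GL2D.generated (GL2D.resKZZ σ) (GL2D.sVec ϖ τ σ n)).toRepresentation.Equiv σ) ∧
        (GL2D.generated (GL2D.resKZZ σ) (GL2D.sVec ϖ τ σ n)).toRepresentation.IsIrreducible) ∧
      (GL2D.IsPrincipalSeries
          (GL2D.generated (GL2D.resKZZ σ) (GL2D.betaVec ϖ τ σ n)).toRepresentation ∧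
        Module.finrank (GL2D.Coef p)
          (GL2D.generated (GL2D.resKZZ σ) (GL2D.betaVec ϖ τ σ n)).toSubmodule
            = (p ^ f) ^ w + 1 ∧
        ¬ (GL2D.generated (GL2D.resKZZ σ) (GL2D.betaVec ϖ τ σ n)).toRepresentation.IsIrreducible)) ∧
    (∑ j : Fin (w * f), p ^ (j : ℕ) * r j = 0 → ∀ n : ℕ, ∀ v : GL2D.cIndV σ,
      v = (if n = 0 then GL2D.sVec ϖ τ σ 0
        else GL2D.sVec ϖ τ σ n + GL2D.betaVec ϖ τ σ (n - 1)) →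
      Module.finrank (GL2D.Coef p) (GL2D.generated (GL2D.resKZZ σ) v).toSubmodule = 1 ∧
        (GL2D.generated (GL2D.resKZZ σ) v).toRepresentation.IsIrreducible ∧
        Nonempty ((GL2D.generated (GL2D.resKZZ σ) v).toRepresentation.Equiv σ)) ∧
    (∑ j : Fin (w * f), p ^ (j : ℕ) * r j = (p ^ f) ^ w - 1 → ∀ n : ℕ, ∀ v : GL2D.cIndV σ, 1 ≤ n →
      v = GL2D.sVec ϖ τ σ n + GL2D.betaVec ϖ τ σ (n - 1) →
      Module.finrank (GL2D.Coef p) (GL2D.generated (GL2D.resKZZ σ) v).toSubmodule = 1 ∧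
        (GL2D.generated (GL2D.resKZZ σ) v).toRepresentation.IsIrreducible) := by
  have hκ : Fintype.card (GL2D.residueRing p D) = p ^ (w * f) :=
    Nat.card_eq_fintype_card.symm.trans (GL2D.card_residueRing p F D w f hw hf ι)
  have hpow : (p ^ f) ^ w = p ^ (w * f) := by rw [← pow_mul, mul_comm]
  have hirr := GL2D.weight_isIrreducible hσ hr hκ
  refine ⟨GL2D.exists_basis_invariants hϖ hτ hσ hr hκ, fun hR n => ⟨?_, ?_, ?_, ?_⟩, ?_, ?_⟩
  · have e := GL2D.generated_sVec_equiv hϖ hτ hσ hr hκ hR n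
    exact ⟨e, GL2D.isIrreducible_generated_of_equiv hirr e (GL2D.sVec_ne_zero hϖ hτ n)⟩
  · exact GL2D.isPrincipalSeries_generated_betaVec hϖ hτ hσ hr hκ n
  · rw [hpow]
    exact GL2D.finrank_generated_betaVec hϖ hτ hσ hr hκ n
  · exact GL2D.not_isIrreducible_generated_betaVec hϖ hτ hσ hr hκ hR n
  · rintro hR n v rfl
    have e := GL2D.generated_equiv_of_trivial hϖ hτ hσ hr hκ hR n
    have h1 := e.some.toLinearEquiv.finrank_eq.trans (GL2D.finrank_Wt_of_trivial hr hR)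
    exact ⟨h1, GL2D.isIrreducible_generated_of_finrank_eq_one h1, e⟩
  · rintro hR n v hn rfl
    obtain ⟨n, rfl⟩ : ∃ k, n = k + 1 := ⟨n - 1, by omega⟩
    rw [hpow] at hR
    rw [Nat.add_sub_cancel]
    have hne : GL2D.sVec ϖ τ σ (n + 1) + GL2D.betaVec ϖ τ σ n ≠ 0 := by
      have h := GL2D.add_smul_betaVec_ne_zero (σ := σ) hϖ hτ n 1
      rwa [one_smul, add_comm] at h
    have h1 := GL2D.finrank_generated_eq_one (k := GL2D.Coef p) (G := GL2D.KZZ p ϖ)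
      (W := GL2D.cIndV σ) (ρ := GL2D.resKZZ σ) hne
      (GL2D.exists_smul_of_eq_card_sub_one hϖ hτ hσ hr hκ hR n)
    exact ⟨h1, GL2D.isIrreducible_generated_of_finrank_eq_one h1⟩
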